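/- **Setting.** Let $V=\mathbb C^n$ with coordinates $x_1,\dots,x_n$, let $h\in\mathbb C[x_1,\dots,x_n]$ be one of the two polynomials below (each defines a reductive linear free divisor $D=h^{-1}(0)$ in unitary coordinates), regarded as a map $h:V\to T=\operatorname{Spec}\mathbb C[t]$, and let $f=\sum a_ix_i$ be a generic linear form, i.e. $h^*(a)\neq 0$, where $h^*(y)=\overline{h(\overline y)}$. Let $\Omega^p_V(*D)$ be the rational $p$-forms with poles along $D$, let $\Omega^p_V(\log D)$ be those $\omega$ for which $h\omega$ and $h\,d\omega$ are regular, and let $\Omega^p_{V/T}(\cdot)=\Omega^p_V(\cdot)/\tfrac{dh}{h}\wedge\Omega^{p-1}_V(\cdot)$. Put $$G_0(\cdot)=\frac{\Omega^{n-1}_{V/T}(\cdot)[\theta]}{(\theta d-df\wedge)\,\Omega^{n-2}_{V/T}(\cdot)[\theta]},\qquad G(\cdot)=G_0(\cdot)[\theta^{-1}],\qquad \nabla_{\partial_\theta}[\omega]=\theta^{-2}[f\omega],$$ with $t$ acting as multiplication by $h$. The logarithmic Brieskorn lattice $G_0(h)$ is the restriction of $(G_0(\log D),\nabla)$ to $t=0$.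 For a lattice $E$ with connection, $M=E[\theta^{-1}]$, regular singular at $\theta=0$ with quasi-unipotent monodromy, let $V^\bullet M$ be the canonical decreasing $V$-filtration at $\theta=0$ ($\theta\nabla_{\partial_\theta}-\alpha$ is nilpotent on $V^\alpha/V^{>\alpha}$). The spectrum of $E$ at $\theta=0$ is $$\operatorname{Sp}(E,\nabla)=\sum_{\alpha\in\mathbb Q}\dim\left(\frac{V^\alpha M\cap E}{V^\alpha M\cap\theta E+V^{>\alpha}M\cap E}\right)\cdot\alpha\in\mathbb Z[\mathbb Q].$$ The spectrum at $\theta=\infty$ is defined likewise with the increasing $V$-filtration $V_\bullet M$ at $\theta=\infty$: with $\tau=\theta^{-1}$, the operator $\tau\nabla_{\partial_\tau}+\alpha$ is nilpotent on $V_\alpha/V_{<\alpha}$, and the multiplicity of $\alpha$ is $\dim (V_\alpha\cap E)/(V_\alpha\cap\theta E+V_{<\alpha}\cap E)$. The spectrum at infinity of $G(*D)$ is that of $G_0(*D)$ restricted to a point $t=t_0\neq0$. The Bernstein polynomial $b_h(s)$ is the monic generator of the ideal of all $B(s)\in\mathbb C[s]$ such that $P\,h^{s+1}=B(s)h^s$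 for some $P\in\mathcal D_V[s]$. **Proposition.** 1. Let $n\ge 1$ and $h=x_1\cdots x_n$ (the normal crossing divisor, $A_n$ quiver). For every generic linear form $f$, $$\operatorname{Sp}(G_0(h),\nabla)=(0,1,\dots,n-1)\in\mathbb Z[\mathbb Q],$$ and this equals the spectrum at $\theta=\infty$ of $(G_0(h),\nabla)$ and that of $(G(*D),\nabla)$, the latter at every $t_0\ne0$. 2. Let $h=\begin{vmatrix}a&b\\d&e\end{vmatrix}\cdot\begin{vmatrix}a&c\\d&f\end{vmatrix}\cdot\begin{vmatrix}b&c\\e&f\end{vmatrix}$ on $\mathbb C^6$ with coordinates $(a,b,c,d,e,f)$ (the star quiver $\star_3=D_4$). For every generic linear form, $$\operatorname{Sp}(G_0(h),\nabla)=(-2,1,2,3,4,7)\in\mathbb Z[\mathbb Q].$$ It differs from the spectrum of $(G_0(h),\nabla)$ at $\theta=\infty$. Moreover $b_h(s)=(s+\tfrac43)(s+1)^4(s+\tfrac23)$, and $\operatorname{Sp}(G_0(h),\nabla)$ is not the image under any map $\varphi:\mathbb C\to\mathbb Q$ of the roots of $b_h$ counted with multiplicity. -/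

import Mathlib

noncomputable section

namespace LogBrieskorn

/-! ### Vector spaces with an invertible operator `θ` and a connection, and their spectra

A `ℂ[θ, θ⁻¹]`-module with connection is given by a complex vector space `X`, the bijective operator
`θ` and the operator `N = θ∇_θ`.  A `ℂ[θ]`-submodule `E` of `X` is a complex subspace with
`θ E ⊆ E`; its localization is `E[θ⁻¹] = ⋃ θ⁻ᵏ E`. -/

section Spectrum

variable {X : Type*} [AddCommGroup X] [Module ℂ X]

/-- The localization `E[θ⁻¹] = ∑ₖ θ⁻ᵏ E`. -/
def localize (θ : X ≃ₗ[ℂ] X) (E : Submodule ℂ X) : Submodule ℂ X :=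
  ⨆ k : ℕ, E.map ((θ.symm : X →ₗ[ℂ] X) ^ k)

/-- `L` is a finitely generated `ℂ[θ]`-submodule of `X`. -/
def IsFGSubmodule (θ : X ≃ₗ[ℂ] X) (L : Submodule ℂ X) : Prop :=
  ∃ s : Finset X, L = ⨆ k : ℕ, (Submodule.span ℂ (s : Set X)).map ((θ : X →ₗ[ℂ] X) ^ k)

/-- `L ⊆ M` is a finitely generated `ℂ[θ]`-submodule on which the connection is logarithmic
(`N L ⊆ L`, where `N = θ∇_θ`), and the residue, i.e. the endomorphism of `L / θL` induced by `N`, is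
annihilated by a nonzero polynomial all of whose roots are rational numbers `≥ α`. -/
structure IsLogLattice (θ : X ≃ₗ[ℂ] X) (N : X →ₗ[ℂ] X) (M : Submodule ℂ X) (α : ℚ)
    (L : Submodule ℂ X) : Prop where
  le : L ≤ M
  fg : IsFGSubmodule θ L
  log : L.map N ≤ L
  residue : ∃ b : Polynomial ℂ, b ≠ 0 ∧ (∀ z : ℂ, b.IsRoot z → ∃ q : ℚ, α ≤ q ∧ z = (q : ℂ)) ∧
    L.map (Polynomial.aeval N b) ≤ L.map (θ : X →ₗ[ℂ] X)

/-- The canonical decreasing `V`-filtration `V^α M` at `θ = 0` of `M` (for `M` regular singular at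
`θ = 0` with quasi-unipotent monodromy): the largest logarithmic lattice with residue
eigenvalues in `[α, ∞)`, that is, Deligne's lattice with residue eigenvalues in `[α, α + 1)`. -/
def vFiltration (θ : X ≃ₗ[ℂ] X) (N : X →ₗ[ℂ] X) (M : Submodule ℂ X) (α : ℚ) : Submodule ℂ X :=
  sSup {L | IsLogLattice θ N M α L}

/-- The cardinal `dim (U ∩ E) / (U ∩ θE + U' ∩ E)`. -/
def gradedDim (θ : X ≃ₗ[ℂ] X) (E U U' : Submodule ℂ X) : Cardinal :=
  Module.rank ℂ (↥(U ⊓ E) ⧸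
    ((U ⊓ E.map (θ : X →ₗ[ℂ] X)) ⊔ (U' ⊓ E)).comap (U ⊓ E).subtype)

/-- The spectrum of `(E, ∇)` at `θ = 0`, as the function giving the multiplicity of `α ∈ ℚ`:
`dim (V^α ∩ E) / (V^α ∩ θE + V^{>α} ∩ E)`, with `V` the `V`-filtration of `E[θ⁻¹]` at `θ = 0`. -/
def spectrumAtZero (θ : X ≃ₗ[ℂ] X) (N : X →ₗ[ℂ] X) (E : Submodule ℂ X) (α : ℚ) : Cardinal :=
  gradedDim θ E (vFiltration θ N (localize θ E) α)
    (⨆ β : ℚ, ⨆ _ : α < β, vFiltration θ N (localize θ E) β)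

/-- The increasing `V`-filtration `V_α M` at `θ = ∞`.  In the coordinate `τ = θ⁻¹` one has
`τ∇_τ = -θ∇_θ`, and `τ∇_τ + α` is nilpotent on `V_α / V_{<α}`. -/
def vFiltrationInfty (θ : X ≃ₗ[ℂ] X) (N : X →ₗ[ℂ] X) (M : Submodule ℂ X) (α : ℚ) :
    Submodule ℂ X :=
  vFiltration θ.symm (-N) M (-α)

/-- The spectrum of `(E, ∇)` at `θ = ∞`, as the function giving the multiplicity of `α ∈ ℚ`:
`dim (V_α ∩ E) / (V_α ∩ θE + V_{<α} ∩ E)`, with `V` the `V`-filtration of `E[θ⁻¹]` at `θ = ∞`. -/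
def spectrumAtInfty (θ : X ≃ₗ[ℂ] X) (N : X →ₗ[ℂ] X) (E : Submodule ℂ X) (α : ℚ) : Cardinal :=
  gradedDim θ E (vFiltrationInfty θ N (localize θ E) α)
    (⨆ β : ℚ, ⨆ _ : β < α, vFiltrationInfty θ N (localize θ E) β)

/-- The element of `ℤ[ℚ]` (given by its multiplicities) attached to a finite list of rational
numbers. -/
def formalSum (s : Multiset ℚ) : ℚ → Cardinal := fun α => (s.count α : Cardinal)

end Spectrum

/-! ### Rational differential forms on `V = ℂⁿ` with poles along `D = {h = 0}` -/

section Forms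

variable {n : ℕ}

/-- The ring `𝒪_V(*D) = ℂ[x₁, …, xₙ][h⁻¹]`. -/
def PolarRing (h : MvPolynomial (Fin n) ℂ) : Type := Localization.Away h

instance (h : MvPolynomial (Fin n) ℂ) : CommRing (PolarRing h) :=
  inferInstanceAs (CommRing (Localization.Away h))

instance (h : MvPolynomial (Fin n) ℂ) : Algebra (MvPolynomial (Fin n) ℂ) (PolarRing h) :=
  inferInstanceAs (Algebra (MvPolynomial (Fin n) ℂ) (Localization.Away h))

instance (h : MvPolynomial (Fin n) ℂ) : IsLocalization.Away h (PolarRing h) :=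
  inferInstanceAs (IsLocalization.Away h (Localization.Away h))

instance (h : MvPolynomial (Fin n) ℂ) : Algebra ℂ (PolarRing h) :=
  inferInstanceAs (Algebra ℂ (Localization.Away h))

instance (h : MvPolynomial (Fin n) ℂ) :
    IsScalarTower ℂ (MvPolynomial (Fin n) ℂ) (PolarRing h) :=
  inferInstanceAs (IsScalarTower ℂ (MvPolynomial (Fin n) ℂ) (Localization.Away h))

theorem algebraMap_C (h : MvPolynomial (Fin n) ℂ) (a : ℂ) :
    algebraMap (MvPolynomial (Fin n) ℂ) (PolarRing h) (MvPolynomial.C a) =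
      algebraMap ℂ (PolarRing h) a :=
  (IsScalarTower.algebraMap_apply ℂ (MvPolynomial (Fin n) ℂ) (PolarRing h) a).symm

/-- The homomorphism `g ↦ g + ε ∂ᵢg` from polynomials to dual numbers over `𝒪_V(*D)`. -/
def partialDual (h : MvPolynomial (Fin n) ℂ) (i : Fin n) :
    MvPolynomial (Fin n) ℂ →ₐ[ℂ] DualNumber (PolarRing h) :=
  MvPolynomial.aeval fun j =>
    TrivSqZeroExt.inl (algebraMap (MvPolynomial (Fin n) ℂ) (PolarRing h) (MvPolynomial.X j)) +
      TrivSqZeroExt.inr (if j = i then 1 else 0)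

theorem partialDual_apply (h : MvPolynomial (Fin n) ℂ) (i : Fin n) (g : MvPolynomial (Fin n) ℂ) :
    partialDual h i g = TrivSqZeroExt.inl (algebraMap _ (PolarRing h) g) +
      TrivSqZeroExt.inr (algebraMap _ (PolarRing h) (MvPolynomial.pderiv i g)) := by
  induction g using MvPolynomial.induction_on with
  | C a =>
    ext
    · simp [partialDual, TrivSqZeroExt.algebraMap_eq_inl', algebraMap_C]
    · simp [partialDual, TrivSqZeroExt.algebraMap_eq_inl']
  | add p q hp hq =>
    rw [map_add, hp, hq]
    ext <;> simp only [TrivSqZeroExt.fst_add, TrivSqZeroExt.snd_add, TrivSqZeroExt.fst_inl,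
      TrivSqZeroExt.snd_inl, TrivSqZeroExt.fst_inr, TrivSqZeroExt.snd_inr, map_add, add_zero,
      zero_add]
  | mul_X p j hp =>
    have hX : partialDual h i (MvPolynomial.X j) =
        TrivSqZeroExt.inl (algebraMap (MvPolynomial (Fin n) ℂ) (PolarRing h) (MvPolynomial.X j)) +
          TrivSqZeroExt.inr (if j = i then 1 else 0) := by
      simp only [partialDual, MvPolynomial.aeval_X]
    rw [map_mul, hp, hX]
    ext
    · simp only [TrivSqZeroExt.fst_add, TrivSqZeroExt.fst_mul, TrivSqZeroExt.fst_inl,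
        TrivSqZeroExt.fst_inr, map_mul, add_zero]
    · simp only [TrivSqZeroExt.snd_add, TrivSqZeroExt.snd_mul, TrivSqZeroExt.fst_add,
        TrivSqZeroExt.fst_inl, TrivSqZeroExt.snd_inl, TrivSqZeroExt.fst_inr,
        TrivSqZeroExt.snd_inr, Derivation.leibniz, MvPolynomial.pderiv_X, smul_eq_mul, map_add,
        map_mul, add_zero, zero_add, MulOpposite.smul_eq_mul_unop, MulOpposite.unop_op]
      by_cases hj : j = i
      · subst hj
        simp only [if_true, Pi.single_eq_same, map_one]
        ring
      · rw [if_neg hj, Pi.single_eq_of_ne hj, map_zero]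
        ring

theorem partialDual_isUnit (h : MvPolynomial (Fin n) ℂ) (i : Fin n) (y : Submonoid.powers h) :
    IsUnit (partialDual h i y) := by
  rw [TrivSqZeroExt.isUnit_iff_isUnit_fst, partialDual_apply]
  simpa using IsLocalization.map_units (PolarRing h) y

/-- The extension of `partialDual` to `𝒪_V(*D)`. -/
def partialDualExt (h : MvPolynomial (Fin n) ℂ) (i : Fin n) :
    PolarRing h →ₐ[ℂ] DualNumber (PolarRing h) :=
  IsLocalization.liftAlgHom (M := Submonoid.powers h) (partialDual_isUnit h i)

theorem partialDualExt_algebraMap (h : MvPolynomial (Fin n) ℂ) (i : Fin n)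
    (g : MvPolynomial (Fin n) ℂ) :
    partialDualExt h i (algebraMap _ (PolarRing h) g) = partialDual h i g := by
  simp [partialDualExt]

theorem fst_partialDualExt (h : MvPolynomial (Fin n) ℂ) (i : Fin n) (x : PolarRing h) :
    (partialDualExt h i x).fst = x := by
  have key : ((TrivSqZeroExt.fstHom ℂ (PolarRing h) (PolarRing h)).comp
      (partialDualExt h i)).toRingHom = RingHom.id (PolarRing h) := by
    apply IsLocalization.ringHom_ext (Submonoid.powers h)
    refine RingHom.ext fun g => ?_
    change (partialDualExt h i (algebraMap _ (PolarRing h) g)).fst = algebraMap _ (PolarRing h) g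
    rw [partialDualExt_algebraMap, partialDual_apply, TrivSqZeroExt.fst_add,
      TrivSqZeroExt.fst_inl, TrivSqZeroExt.fst_inr, add_zero]
  exact congrArg (fun φ : PolarRing h →+* PolarRing h => φ x) key

/-- The partial derivative `∂ᵢ` on `𝒪_V(*D)`. -/
def polarDeriv (h : MvPolynomial (Fin n) ℂ) (i : Fin n) :
    Derivation ℂ (PolarRing h) (PolarRing h) :=
  Derivation.mk'
    ((TrivSqZeroExt.sndHom (PolarRing h) (PolarRing h)).restrictScalars ℂ ∘ₗ
      (partialDualExt h i).toLinearMap)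
    (by
      intro a b
      change (partialDualExt h i (a * b)).snd =
        a * (partialDualExt h i b).snd + b * (partialDualExt h i a).snd
      rw [map_mul, TrivSqZeroExt.snd_mul, fst_partialDualExt, fst_partialDualExt,
        MulOpposite.smul_eq_mul_unop, MulOpposite.unop_op, smul_eq_mul,
        mul_comm (partialDualExt h i a).snd])

theorem polarDeriv_algebraMap (h : MvPolynomial (Fin n) ℂ) (i : Fin n)
    (g : MvPolynomial (Fin n) ℂ) :
    polarDeriv h i (algebraMap _ (PolarRing h) g) =
      algebraMap _ (PolarRing h) (MvPolynomial.pderiv i g) := by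
  change (partialDualExt h i (algebraMap _ (PolarRing h) g)).snd = _
  rw [partialDualExt_algebraMap, partialDual_apply, TrivSqZeroExt.snd_add,
    TrivSqZeroExt.snd_inl, TrivSqZeroExt.snd_inr, zero_add]

/-- Differential forms of mixed degree with poles along `D`: the coefficient at `I` is that of
`dx_I = dx_{i₁} ∧ ⋯ ∧ dx_{i_p}`, where `i₁ < ⋯ < i_p` are the elements of `I`. -/
abbrev Form (h : MvPolynomial (Fin n) ℂ) : Type := Finset (Fin n) → PolarRing h

/-- The operator `ω ↦ dxᵢ ∧ ω`. -/
def dxWedge (h : MvPolynomial (Fin n) ℂ) (i : Fin n) : Form h →ₗ[PolarRing h] Form h where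
  toFun ω I := if i ∈ I then (-1) ^ (I.filter (· < i)).card * ω (I.erase i) else 0
  map_add' ω η := by
    funext I
    by_cases hi : i ∈ I <;> simp [hi, mul_add]
  map_smul' c ω := by
    funext I
    by_cases hi : i ∈ I
    · simp [hi]
      ring
    · simp [hi]

/-- The exterior derivative `dω = ∑ᵢ dxᵢ ∧ ∂ᵢω`. -/
def extDeriv (h : MvPolynomial (Fin n) ℂ) : Form h →ₗ[ℂ] Form h :=
  ∑ i : Fin n, (dxWedge h i).restrictScalars ℂ ∘ₗ
    (polarDeriv h i : PolarRing h →ₗ[ℂ] PolarRing h).compLeft (Finset (Fin n))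

/-- The operator `ω ↦ dg ∧ ω`, where `dg = ∑ᵢ ∂ᵢg dxᵢ`, for a polynomial `g`. -/
def dWedge (h g : MvPolynomial (Fin n) ℂ) : Form h →ₗ[PolarRing h] Form h :=
  ∑ i : Fin n, algebraMap _ (PolarRing h) (MvPolynomial.pderiv i g) • dxWedge h i

theorem extDeriv_smul (h g : MvPolynomial (Fin n) ℂ) (ω : Form h) :
    extDeriv h (g • ω) = dWedge h g ω + g • extDeriv h ω := by
  have hd : ∀ i : Fin n,
      (polarDeriv h i : PolarRing h →ₗ[ℂ] PolarRing h).compLeft (Finset (Fin n)) (g • ω) =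
      algebraMap _ (PolarRing h) (MvPolynomial.pderiv i g) • ω +
        algebraMap _ (PolarRing h) g •
          (polarDeriv h i : PolarRing h →ₗ[ℂ] PolarRing h).compLeft (Finset (Fin n)) ω := by
    intro i
    funext I
    simp [Algebra.smul_def, polarDeriv_algebraMap]
    ring
  have hg : ∀ η : Form h, g • η = algebraMap _ (PolarRing h) g • η := fun η => by
    funext I
    simp [Algebra.smul_def]
  rw [hg (extDeriv h ω)]
  simp only [extDeriv, dWedge, LinearMap.sum_apply, LinearMap.comp_apply, Finset.smul_sum]
  rw [← Finset.sum_add_distrib]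
  refine Finset.sum_congr rfl fun i _ => ?_
  rw [hd, LinearMap.restrictScalars_apply, LinearMap.restrictScalars_apply, map_add, map_smul,
    map_smul, LinearMap.smul_apply]

theorem dWedge_smul (h f g : MvPolynomial (Fin n) ℂ) (ω : Form h) :
    dWedge h f (g • ω) = g • dWedge h f ω := by
  have hg : ∀ η : Form h, g • η = algebraMap _ (PolarRing h) g • η := fun η => by
    funext I
    simp [Algebra.smul_def]
  rw [hg, hg, map_smul]

/-- The regular (polynomial) forms, of mixed degree. -/
def regularForms (h : MvPolynomial (Fin n) ℂ) : Submodule (MvPolynomial (Fin n) ℂ) (Form h) where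
  carrier := {ω | ∀ I, ω I ∈ (algebraMap (MvPolynomial (Fin n) ℂ) (PolarRing h)).range}
  add_mem' ha hb I := add_mem (ha I) (hb I)
  zero_mem' I := zero_mem _
  smul_mem' c ω hω I := by
    rw [Pi.smul_apply, Algebra.smul_def]
    exact mul_mem ⟨c, rfl⟩ (hω I)

theorem dWedge_mem_regularForms (h g : MvPolynomial (Fin n) ℂ) (ω : Form h)
    (hω : ω ∈ regularForms h) : dWedge h g ω ∈ regularForms h := by
  intro I
  simp only [dWedge, LinearMap.sum_apply, LinearMap.smul_apply, Finset.sum_apply, Pi.smul_apply,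
    smul_eq_mul]
  refine sum_mem fun i _ => mul_mem ⟨_, rfl⟩ ?_
  by_cases hi : i ∈ I
  · simp only [dxWedge, LinearMap.coe_mk, AddHom.coe_mk, hi, if_true]
    exact mul_mem (pow_mem (neg_mem (one_mem _)) _) (hω _)
  · simp [dxWedge, hi]

/-- The module `Ω^p_V(*D)` of `p`-forms with arbitrary poles along `D`, where `p = n - q`; it is zero
if `n < q`. -/
def polarForms (h : MvPolynomial (Fin n) ℂ) (q : ℕ) :
    Submodule (MvPolynomial (Fin n) ℂ) (Form h) where
  carrier := {ω | ∀ I, ω I ≠ 0 → I.card + q = n}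
  add_mem' {a b} ha hb I hI := by
    by_cases h0 : a I = 0
    · exact hb I fun h1 => hI (by simp [h0, h1])
    · exact ha I h0
  zero_mem' I hI := absurd rfl hI
  smul_mem' c ω hω I hI := hω I fun h0 => hI (by simp [h0])

/-- The module `Ω^p_V(log D)` of logarithmic `p`-forms, where `p = n - q`: the forms `ω` with poles
along `D` such that `h ω` and `h dω` are regular. -/
def logForms (h : MvPolynomial (Fin n) ℂ) (q : ℕ) :
    Submodule (MvPolynomial (Fin n) ℂ) (Form h) where
  carrier := {ω | ω ∈ polarForms h q ∧ h • ω ∈ regularForms h ∧ h • extDeriv h ω ∈ regularForms h}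
  add_mem' ha hb := ⟨add_mem ha.1 hb.1, by rw [smul_add]; exact add_mem ha.2.1 hb.2.1,
    by rw [map_add, smul_add]; exact add_mem ha.2.2 hb.2.2⟩
  zero_mem' := by simp
  smul_mem' c ω hω := by
    refine ⟨Submodule.smul_mem _ _ hω.1, ?_, ?_⟩
    · rw [smul_comm]
      exact Submodule.smul_mem _ _ hω.2.1
    · rw [extDeriv_smul, smul_add, ← dWedge_smul, smul_comm h c]
      exact add_mem (dWedge_mem_regularForms _ _ _ hω.2.1) (Submodule.smul_mem _ _ hω.2.2)

end Forms

/-! ### Gauß–Manin systems and Brieskorn lattices -/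

section GaussManin

variable {n : ℕ} (h f : MvPolynomial (Fin n) ℂ)

/-- Laurent polynomials in `θ` with coefficients in the forms with poles along `D`. -/
abbrev LaurentForm : Type := ℤ →₀ Form h

/-- Multiplication by `θ`. -/
def thetaEquiv : LaurentForm h ≃ₗ[ℂ] LaurentForm h :=
  Finsupp.domLCongr (Equiv.addRight (1 : ℤ))

theorem thetaEquiv_apply (c : LaurentForm h) (k : ℤ) : thetaEquiv h c k = c (k - 1) := by
  simp [thetaEquiv, Finsupp.domLCongr_apply, Finsupp.domCongr_apply,
    Finsupp.equivMapDomain_apply, sub_eq_add_neg]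

theorem thetaEquiv_symm_apply (c : LaurentForm h) (k : ℤ) :
    (thetaEquiv h).symm c k = c (k + 1) := by
  obtain ⟨c, rfl⟩ := (thetaEquiv h).surjective c
  rw [LinearEquiv.symm_apply_apply, thetaEquiv_apply, add_sub_cancel_right]

/-- The `θ`-linear extension of an operator on forms. -/
def coeffwise (T : Form h →ₗ[ℂ] Form h) : LaurentForm h →ₗ[ℂ] LaurentForm h :=
  Finsupp.mapRange.linearMap T

/-- Multiplication of forms by a polynomial `g`. -/
def mulForm (g : MvPolynomial (Fin n) ℂ) : Form h →ₗ[ℂ] Form h :=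
  LinearMap.lsmul (MvPolynomial (Fin n) ℂ) (Form h) g |>.restrictScalars ℂ

/-- The operator `θ∂_θ` on Laurent polynomials in `θ`. -/
def eulerTheta : LaurentForm h →ₗ[ℂ] LaurentForm h :=
  Finsupp.lsum ℂ fun k : ℤ => (k : ℂ) • Finsupp.lsingle k

theorem eulerTheta_apply (c : LaurentForm h) (k : ℤ) : eulerTheta h c k = (k : ℂ) • c k := by
  induction c using Finsupp.induction_linear with
  | zero => simp
  | add a b ha hb => rw [map_add, Finsupp.add_apply, ha, hb, Finsupp.add_apply, smul_add]
  | single m x =>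
    by_cases hm : m = k
    · subst hm
      simp [eulerTheta]
    · simp [eulerTheta, hm]

/-- The twisted differential `θ d - df ∧`. -/
def twistedDiff : LaurentForm h →ₗ[ℂ] LaurentForm h :=
  (thetaEquiv h : LaurentForm h →ₗ[ℂ] LaurentForm h) ∘ₗ coeffwise h (extDeriv h) -
    coeffwise h ((dWedge h f).restrictScalars ℂ)

/-- The operator `ω ↦ dh/h ∧ ω`. -/
def dlogWedge : Form h →ₗ[ℂ] Form h :=
  ((IsLocalization.Away.invSelf h : PolarRing h) • dWedge h h).restrictScalars ℂ

theorem mulForm_smul (g g' : MvPolynomial (Fin n) ℂ) (ω : Form h) :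
    mulForm h g (g' • ω) = g' • mulForm h g ω :=
  smul_comm g g' ω

theorem dlogWedge_smul (g : MvPolynomial (Fin n) ℂ) (ω : Form h) :
    dlogWedge h (g • ω) = g • dlogWedge h ω := by
  change (IsLocalization.Away.invSelf h : PolarRing h) • dWedge h h (g • ω) =
    g • (IsLocalization.Away.invSelf h : PolarRing h) • dWedge h h ω
  rw [dWedge_smul, smul_comm]

/-- `A[θ, θ⁻¹]`. -/
def laurent (A : Submodule (MvPolynomial (Fin n) ℂ) (Form h)) : Submodule ℂ (LaurentForm h) where
  carrier := {c | ∀ k, c k ∈ A}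
  add_mem' ha hb k := add_mem (ha k) (hb k)
  zero_mem' _ := zero_mem A
  smul_mem' z _ hc k := (A.restrictScalars ℂ).smul_mem z (hc k)

/-- `A[θ]`. -/
def polynomialPart (A : Submodule (MvPolynomial (Fin n) ℂ) (Form h)) :
    Submodule ℂ (LaurentForm h) where
  carrier := {c | (∀ k, c k ∈ A) ∧ ∀ k < 0, c k = 0}
  add_mem' ha hb := ⟨fun k => add_mem (ha.1 k) (hb.1 k),
    fun k hk => by rw [Finsupp.add_apply, ha.2 k hk, hb.2 k hk, add_zero]⟩
  zero_mem' := ⟨fun _ => zero_mem A, fun _ _ => rfl⟩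
  smul_mem' z c hc := ⟨fun k => (A.restrictScalars ℂ).smul_mem z (hc.1 k),
    fun k hk => by rw [Finsupp.smul_apply, hc.2 k hk, smul_zero]⟩

/-- For `Ω = logForms h` or `Ω = polarForms h`, with `Ω 1` in degree `n - 1` and `Ω 2` in degree
`n - 2`: the subspace of `Ω 1 [θ, θ⁻¹]` spanned by
* `(θ d - df ∧) Ω 2 [θ, θ⁻¹]`,
* `dh/h ∧ Ω 2 [θ, θ⁻¹]`, to pass to forms relative to `h : V → T`,
* `(h - t₀) Ω 1 [θ, θ⁻¹]`, to restrict to the fibre at the point `t₀ ∈ T` (the coordinate `t` of `T`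
  acts as multiplication by `h`). -/
def relations (Ω : ℕ → Submodule (MvPolynomial (Fin n) ℂ) (Form h)) (t₀ : ℂ) :
    Submodule ℂ (LaurentForm h) :=
  (laurent h (Ω 2)).map (twistedDiff h f) ⊔
    (laurent h (Ω 2)).map (coeffwise h (dlogWedge h)) ⊔
    (laurent h (Ω 1)).map (coeffwise h (mulForm h (h - MvPolynomial.C t₀)))

/-- The operator `θ∇_θ` on forms: `θ∂_θ + θ⁻¹ f`. -/
def nablaForm : LaurentForm h →ₗ[ℂ] LaurentForm h :=
  eulerTheta h + ((thetaEquiv h).symm : LaurentForm h →ₗ[ℂ] LaurentForm h) ∘ₗ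
    coeffwise h (mulForm h f)

theorem coeffwise_apply (T : Form h →ₗ[ℂ] Form h) (c : LaurentForm h) (k : ℤ) :
    coeffwise h T c k = T (c k) := rfl

theorem map_thetaEquiv_laurent (A : Submodule (MvPolynomial (Fin n) ℂ) (Form h)) :
    (laurent h A).map (thetaEquiv h : LaurentForm h →ₗ[ℂ] LaurentForm h) = laurent h A := by
  apply le_antisymm
  · rintro _ ⟨c, hc, rfl⟩ k
    rw [LinearEquiv.coe_coe, thetaEquiv_apply]
    exact hc _
  · intro c hc
    refine ⟨(thetaEquiv h).symm c, fun k => ?_, by simp⟩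
    rw [thetaEquiv_symm_apply]
    exact hc _

theorem thetaEquiv_comp_coeffwise (T : Form h →ₗ[ℂ] Form h) :
    (thetaEquiv h : LaurentForm h →ₗ[ℂ] LaurentForm h) ∘ₗ coeffwise h T =
      coeffwise h T ∘ₗ (thetaEquiv h : LaurentForm h →ₗ[ℂ] LaurentForm h) := by
  refine LinearMap.ext fun c => Finsupp.ext fun k => ?_
  simp only [LinearMap.comp_apply, LinearEquiv.coe_coe, thetaEquiv_apply, coeffwise_apply]

theorem thetaEquiv_comp_twistedDiff :
    (thetaEquiv h : LaurentForm h →ₗ[ℂ] LaurentForm h) ∘ₗ twistedDiff h f =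
      twistedDiff h f ∘ₗ (thetaEquiv h : LaurentForm h →ₗ[ℂ] LaurentForm h) := by
  rw [twistedDiff, LinearMap.comp_sub, LinearMap.sub_comp, LinearMap.comp_assoc,
    ← thetaEquiv_comp_coeffwise, ← thetaEquiv_comp_coeffwise]

theorem map_thetaEquiv_relations (Ω : ℕ → Submodule (MvPolynomial (Fin n) ℂ) (Form h)) (t₀ : ℂ) :
    (relations h f Ω t₀).map (thetaEquiv h : LaurentForm h →ₗ[ℂ] LaurentForm h) =
      relations h f Ω t₀ := by
  have key : ∀ (T : LaurentForm h →ₗ[ℂ] LaurentForm h)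
      (A : Submodule (MvPolynomial (Fin n) ℂ) (Form h)),
      (thetaEquiv h : LaurentForm h →ₗ[ℂ] LaurentForm h) ∘ₗ T =
        T ∘ₗ (thetaEquiv h : LaurentForm h →ₗ[ℂ] LaurentForm h) →
      ((laurent h A).map T).map (thetaEquiv h : LaurentForm h →ₗ[ℂ] LaurentForm h) =
        (laurent h A).map T := by
    intro T A hT
    rw [← Submodule.map_comp, hT, Submodule.map_comp, map_thetaEquiv_laurent]
  rw [relations, Submodule.map_sup, Submodule.map_sup, key _ _ (thetaEquiv_comp_twistedDiff h f),
    key _ _ (thetaEquiv_comp_coeffwise h _), key _ _ (thetaEquiv_comp_coeffwise h _)]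

theorem nablaForm_apply (c : LaurentForm h) (k : ℤ) :
    nablaForm h f c k = (k : ℂ) • c k + f • c (k + 1) := by
  simp only [nablaForm, LinearMap.add_apply, LinearMap.comp_apply, LinearEquiv.coe_coe,
    Finsupp.add_apply, eulerTheta_apply, thetaEquiv_symm_apply, coeffwise_apply]
  rfl

theorem nablaForm_mem_laurent (A : Submodule (MvPolynomial (Fin n) ℂ) (Form h))
    (c : LaurentForm h) (hc : c ∈ laurent h A) : nablaForm h f c ∈ laurent h A := by
  intro k
  rw [nablaForm_apply]
  exact add_mem ((A.restrictScalars ℂ).smul_mem _ (hc k)) (A.smul_mem _ (hc _))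

theorem nablaForm_twistedDiff (c : LaurentForm h) :
    nablaForm h f (twistedDiff h f c) = twistedDiff h f (nablaForm h f c + c) := by
  refine Finsupp.ext fun k => ?_
  have e : ∀ (c : LaurentForm h) (k : ℤ),
      twistedDiff h f c k = extDeriv h (c (k - 1)) - dWedge h f (c k) := by
    intro c k
    simp only [twistedDiff, LinearMap.sub_apply, LinearMap.comp_apply, LinearEquiv.coe_coe,
      Finsupp.sub_apply, thetaEquiv_apply, coeffwise_apply, LinearMap.restrictScalars_apply]
  have hw : ∀ (z : ℂ) (ω : Form h), dWedge h f (z • ω) = z • dWedge h f ω := fun z ω =>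
    ((dWedge h f).restrictScalars ℂ).map_smul z ω
  have hz : ∀ (z : ℂ) (ω : Form h), extDeriv h (z • ω) = z • extDeriv h ω := fun z ω =>
    (extDeriv h).map_smul z ω
  simp only [e, nablaForm_apply, map_add, map_sub, Finsupp.add_apply, extDeriv_smul, hz,
    add_sub_cancel_right, sub_add_cancel, dWedge_smul, hw, smul_sub, Int.cast_sub, Int.cast_one,
    sub_smul, one_smul]
  abel

theorem nablaForm_coeffwise (T : Form h →ₗ[ℂ] Form h) (hT : ∀ ω, T (f • ω) = f • T ω)
    (c : LaurentForm h) : nablaForm h f (coeffwise h T c) = coeffwise h T (nablaForm h f c) := by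
  refine Finsupp.ext fun k => ?_
  rw [coeffwise_apply, nablaForm_apply, nablaForm_apply, coeffwise_apply, coeffwise_apply,
    LinearMap.map_add, LinearMap.map_smul, hT]

theorem nablaForm_map_twistedDiff (A : Submodule (MvPolynomial (Fin n) ℂ) (Form h))
    (x : LaurentForm h) (hx : x ∈ (laurent h A).map (twistedDiff h f)) :
    nablaForm h f x ∈ (laurent h A).map (twistedDiff h f) := by
  obtain ⟨c, hc, rfl⟩ := Submodule.mem_map.mp hx
  rw [nablaForm_twistedDiff]
  exact Submodule.mem_map_of_mem (Submodule.add_mem _ (nablaForm_mem_laurent h f A c hc) hc)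

theorem nablaForm_map_coeffwise (A : Submodule (MvPolynomial (Fin n) ℂ) (Form h))
    (T : Form h →ₗ[ℂ] Form h) (hT : ∀ ω, T (f • ω) = f • T ω)
    (x : LaurentForm h) (hx : x ∈ (laurent h A).map (coeffwise h T)) :
    nablaForm h f x ∈ (laurent h A).map (coeffwise h T) := by
  obtain ⟨c, hc, rfl⟩ := Submodule.mem_map.mp hx
  rw [nablaForm_coeffwise h f T hT]
  exact Submodule.mem_map_of_mem (nablaForm_mem_laurent h f A c hc)

theorem relations_le_comap (Ω : ℕ → Submodule (MvPolynomial (Fin n) ℂ) (Form h)) (t₀ : ℂ) :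
    relations h f Ω t₀ ≤ (relations h f Ω t₀).comap (nablaForm h f) := by
  unfold relations
  refine sup_le (sup_le ?_ ?_) ?_
  · intro x hx
    exact Submodule.mem_sup_left (Submodule.mem_sup_left (nablaForm_map_twistedDiff h f _ x hx))
  · intro x hx
    exact Submodule.mem_sup_left (Submodule.mem_sup_right
      (nablaForm_map_coeffwise h f _ _ (dlogWedge_smul h f) x hx))
  · intro x hx
    exact Submodule.mem_sup_right
      (nablaForm_map_coeffwise h f _ _ (mulForm_smul h _ f) x hx)

/-- The space of all Laurent forms modulo `relations`.  It contains the fibre at `t₀` of the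
Gauß–Manin system of `(f, h)`, namely `Ω 1 [θ, θ⁻¹]` modulo `relations`. -/
abbrev GaussManin (Ω : ℕ → Submodule (MvPolynomial (Fin n) ℂ) (Form h)) (t₀ : ℂ) : Type :=
  LaurentForm h ⧸ relations h f Ω t₀

variable (Ω : ℕ → Submodule (MvPolynomial (Fin n) ℂ) (Form h)) (t₀ : ℂ)

/-- Multiplication by `θ`. -/
def theta : GaussManin h f Ω t₀ ≃ₗ[ℂ] GaussManin h f Ω t₀ :=
  Submodule.Quotient.equiv _ _ (thetaEquiv h) (map_thetaEquiv_relations h f Ω t₀)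

/-- The operator `θ∇_θ`, determined by `∇_θ [ω] = θ⁻² [f ω]` and the Leibniz rule. -/
def nabla : GaussManin h f Ω t₀ →ₗ[ℂ] GaussManin h f Ω t₀ :=
  (relations h f Ω t₀).mapQ (relations h f Ω t₀) (nablaForm h f) (relations_le_comap h f Ω t₀)

/-- The fibre at `t₀` of the Brieskorn lattice of `(f, h)`: the classes of the elements of
`Ω 1 [θ]`. -/
def brieskorn : Submodule ℂ (GaussManin h f Ω t₀) :=
  (polynomialPart h (Ω 1)).map (relations h f Ω t₀).mkQ

/-- The spectrum at `θ = 0` of the logarithmic Brieskorn lattice `G₀(h)`, the fibre at `t = 0` of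
`G₀(log D)`, computed with the linear form `f`. -/
def logSpectrumAtZero : ℚ → Cardinal :=
  spectrumAtZero (theta h f (logForms h) 0) (nabla h f (logForms h) 0)
    (brieskorn h f (logForms h) 0)

/-- The spectrum at `θ = ∞` of the logarithmic Brieskorn lattice `G₀(h)`. -/
def logSpectrumAtInfty : ℚ → Cardinal :=
  spectrumAtInfty (theta h f (logForms h) 0) (nabla h f (logForms h) 0)
    (brieskorn h f (logForms h) 0)

/-- The spectrum at `θ = ∞` of the Gauß–Manin system `G(*D)` with its Brieskorn lattice `G₀(*D)`,
restricted to the point `t₀ ≠ 0` of `T`. -/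
def gmSpectrumAtInfty : ℚ → Cardinal :=
  spectrumAtInfty (theta h f (polarForms h) t₀) (nabla h f (polarForms h) t₀)
    (brieskorn h f (polarForms h) t₀)

end GaussManin

/-! ### Bernstein polynomials -/

section Bernstein

variable {n : ℕ} (h : MvPolynomial (Fin n) ℂ)

/-- The action of `∂ᵢ` on `𝒪_V(*D)[s] hˢ`, where `g hˢ` is written as `g`:
`∂ᵢ (g hˢ) = (∂ᵢg + s h⁻¹ ∂ᵢ(h) g) hˢ`. -/
def twistedPartial (i : Fin n) : Polynomial (PolarRing h) →ₗ[ℂ] Polynomial (PolarRing h) :=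
  { toFun := fun p => p.sum fun k c => Polynomial.monomial k (polarDeriv h i c)
    map_add' := fun p q => Polynomial.sum_add_index p q _ (by simp) (by simp)
    map_smul' := fun z p => by
      rw [Polynomial.sum_smul_index' p z _ (by simp), RingHom.id_apply, Polynomial.smul_sum]
      refine Finset.sum_congr rfl fun k _ => ?_
      change Polynomial.monomial k (polarDeriv h i (z • p.coeff k)) =
        z • Polynomial.monomial k (polarDeriv h i (p.coeff k))
      rw [Derivation.map_smul, Polynomial.smul_monomial] } +
    LinearMap.mulLeft ℂ (Polynomial.X * Polynomial.C
      (IsLocalization.Away.invSelf h * algebraMap _ (PolarRing h) (MvPolynomial.pderiv i h)))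

/-- The image of `𝒟_V[s]` in the operators on `𝒪_V(*D)[s] hˢ`: the algebra generated by the
multiplications by `x₁, …, xₙ`, the operators `∂₁, …, ∂ₙ`, and the multiplication by `s`. -/
def diffOperators : Subalgebra ℂ (Module.End ℂ (Polynomial (PolarRing h))) :=
  Algebra.adjoin ℂ
    (Set.range (fun i : Fin n => LinearMap.mulLeft ℂ
        (Polynomial.C (algebraMap (MvPolynomial (Fin n) ℂ) (PolarRing h) (MvPolynomial.X i)))) ∪
      Set.range (twistedPartial h) ∪
      {LinearMap.mulLeft ℂ Polynomial.X})

/-- `B(s)` satisfies a functional equation `P h^{s+1} = B(s) hˢ` with `P ∈ 𝒟_V[s]`. -/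
def HasFunctionalEquation (B : Polynomial ℂ) : Prop :=
  ∃ P ∈ diffOperators h, P (Polynomial.C (algebraMap _ (PolarRing h) h)) =
    B.map (algebraMap ℂ (PolarRing h))

/-- `b` is the Bernstein polynomial `b_h(s)`: the monic generator of the ideal of all `B(s)` which
satisfy a functional equation. -/
def IsBernsteinPolynomial (b : Polynomial ℂ) : Prop :=
  b.Monic ∧ ∀ B : Polynomial ℂ, HasFunctionalEquation h B ↔ b ∣ B

end Bernstein

/-! ### The divisors and linear forms -/

section Examples

variable {n : ℕ}

/-- The linear form `∑ aᵢ xᵢ`. -/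
def linearForm (a : Fin n → ℂ) : MvPolynomial (Fin n) ℂ :=
  ∑ i : Fin n, MvPolynomial.C (a i) * MvPolynomial.X i

/-- The linear form `∑ aᵢ xᵢ` is generic with respect to `h`, i.e. it does not lie on the dual divisor
`D* = {h* = 0}`, where `h*(y) = conj (h (conj y))`.  Here the coordinates `xᵢ` have to be unitary, as
the standard coordinates are for both divisors below: there the group is a torus of diagonal
matrices, respectively `GL₂ × (torus)` acting on `2 × 3` matrices. -/
def IsGenericForm (h : MvPolynomial (Fin n) ℂ) (a : Fin n → ℂ) : Prop :=
  MvPolynomial.eval a (MvPolynomial.map (starRingEnd ℂ) h) ≠ 0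

/-- The equation `x₁ ⋯ xₙ` of the normal crossing divisor (the `Aₙ` quiver). -/
def normalCrossing (n : ℕ) : MvPolynomial (Fin n) ℂ := ∏ i : Fin n, MvPolynomial.X i

/-- The equation of the discriminant of the star quiver `⋆₃ = D₄` in `ℂ⁶`: the product of the maximal
minors of the matrix with rows `(a, b, c)` and `(d, e, f)`, where
`(a, b, c, d, e, f) = (x₀, …, x₅)`. -/
def starThree : MvPolynomial (Fin 6) ℂ :=
  Matrix.det !![MvPolynomial.X 0, MvPolynomial.X 1; MvPolynomial.X 3, MvPolynomial.X 4] *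
  Matrix.det !![MvPolynomial.X 0, MvPolynomial.X 2; MvPolynomial.X 3, MvPolynomial.X 5] *
  Matrix.det !![MvPolynomial.X 1, MvPolynomial.X 2; MvPolynomial.X 4, MvPolynomial.X 5]

end Examples

end LogBrieskorn

end

noncomputable section

namespace LogBrieskorn

section AbstractSpectrum

open Polynomial Cardinal

variable {X : Type} [AddCommGroup X] [Module ℂ X]

/-! ### Computing `V`-filtrations and spectra from an adapted basis -/

/-! Write `N = θ∇_θ`, let `E` be the Euler field and put `α = ι_E vol / (n h)`. Then `dh ∧ α = vol`,
and a form of degree `n - 1` killed by `dh ∧` is of the form `dh/h ∧ η`. Hence `dh ∧` identifies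
relative top forms with functions, and in both kinds of fibre every class is that of `g α` with `g`
a polynomial: logarithmic forms produce polynomials directly, and for polar forms a denominator `h ^
r` acts as the nonzero scalar `t₀ ^ r`. Writing `[g]` for the class of `g α`, the relations become
`θN[g] = [f g]`, `[h] = t₀[1]`, and `θ[ξ(g)] = [ξ(f) g]` for linear divergence-free fields `ξ` with
`ξ(h) = 0`. For generic `f`, the form `f` and its derivatives `ξ(f)` span all linear forms, so
induction on the degree `d` of `g` gives `[g] = θᵈ P_g(N)[1]`.

The polynomials `P_g` are computed by the functional `capelliPhi`, the value at the coefficient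
vector of `f` of `h⁻ˢ g(-z∂) hˢ`; it is an algebraic substitute for oscillating integrals. The only
special input is the family of Capelli identities `(∂ⱼh)(∂) hˢ⁺¹ = c(s) xⱼ hˢ` with `deg c = n - 1`.
They imply `h(∂) hˢ⁺¹ = b(s) hˢ` with `b = c · (s + 1)`, and they force the functional to kill
twisted divergences (`capelliPhi_divergence`). So `P_h` is a constant times `b(-X/n - 1)`, and `θⁿ
P_h(N)[1] = t₀[1]`. Conversely the functional sends every relation into the image of `fibreOp`, an
operator raising degrees by `n`; hence no nontrivial combination `∑ θᵏ pₖ(N)[1]` with all `deg pₖ <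
n` vanishes (`eq_zero_of_laurentEval_eq_zero`). The Brieskorn lattice is therefore spanned by the
`θʲ p(N)[1]` with `deg p ≤ j` and `deg p < n` (`brieskorn_eq_degreeLattice`).

In both examples the roots `-m₀, …, -mₙ₋₁` of `P_h` are integers. With `wᵢ = θ^{mᵢ} ∏_{j<i} (N +
mⱼ)[1]` one has `N wᵢ = θ^{mᵢ - mᵢ₊₁} wᵢ₊₁`. If the `mᵢ` decrease, the `wᵢ` generate at `t₀ = 0` a
lattice with nilpotent residue at `θ = 0`, which determines the `V`-filtration; if they increase,
the same holds at `θ = ∞`. The Brieskorn lattice is spanned by the `θᵏwᵢ` with `k ≥ i - mᵢ`, so the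
spectrum consists of the `i - mᵢ`. For the normal crossing divisor all `mᵢ` vanish and the order is
irrelevant. For the star quiver `P_h` is proportional to `X⁴(X - 2)(X + 2)`, and the two orderings
give different spectra.

The functional equation for `b` is already at hand. Its minimality follows from the apolar pairing
`⟨p, q⟩ = (p(∂)q)(0)`, for which the operators of `𝒟_V[s]` have adjoints
(`dvd_of_hasFunctionalEquation`). The root `-1` of multiplicity four is incompatible with a spectrum
without multiplicities. -/

theorem rank_span_quotient {κ : Type} {v : κ → X} (hv : LinearIndependent ℂ v) {A B : Set κ}
    (hBA : B ⊆ A) {P Q : Submodule ℂ X} (hP : P = Submodule.span ℂ (v '' A))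
    (hQ : Q = Submodule.span ℂ (v '' B)) :
    Module.rank ℂ (↥P ⧸ Q.comap P.subtype) = #(A \ B : Set κ) := by
  subst hP hQ
  have hsup : Submodule.span ℂ (v '' (A \ B)) ⊔ Submodule.span ℂ (v '' B) =
      Submodule.span ℂ (v '' A) := by
    rw [← Submodule.span_union, ← Set.image_union, Set.sdiff_union_of_subset hBA]
  have hdis : Submodule.span ℂ (v '' (A \ B)) ⊓ Submodule.span ℂ (v '' B) = ⊥ :=
    (hv.disjoint_span_image Set.disjoint_sdiff_left).eq_bot
  have e := (LinearMap.quotientInfEquivSupQuotient (Submodule.span ℂ (v '' (A \ B)))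
    (Submodule.span ℂ (v '' B))).rank_eq
  rw [← Submodule.comap_inf, hdis] at e
  rw [hsup] at e
  rw [← e]
  have hbot : (⊥ : Submodule ℂ X).comap (Submodule.span ℂ (v '' (A \ B))).subtype = ⊥ := by
    rw [Submodule.comap_bot, Submodule.ker_subtype]
  rw [hbot, (Submodule.quotEquivOfEqBot _ rfl).rank_eq]
  have h2 := hv.comp (fun x : (A \ B : Set κ) => (x : κ)) Subtype.val_injective
  have h3 := rank_span h2
  have h4 : Set.range (v ∘ fun x : (A \ B : Set κ) => (x : κ)) = v '' (A \ B) := by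
    rw [Set.range_comp, Subtype.range_coe]
  rw [h4] at h3
  rw [h3, ← h4]
  have := hv.injective
  exact Cardinal.mk_range_eq _ (h2.injective)

theorem span_image_inf {κ : Type} {v : κ → X} (hv : LinearIndependent ℂ v) (A B : Set κ) :
    Submodule.span ℂ (v '' A) ⊓ Submodule.span ℂ (v '' B) = Submodule.span ℂ (v '' (A ∩ B)) := by
  apply le_antisymm
  · rintro x ⟨hA, hB⟩
    rw [SetLike.mem_coe, Finsupp.mem_span_image_iff_linearCombination] at hA hB
    obtain ⟨l, hl, rfl⟩ := hA
    obtain ⟨m, hm, hlm⟩ := hB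
    have := hv.finsuppLinearCombination_injective hlm
    subst this
    rw [Finsupp.mem_span_image_iff_linearCombination]
    refine ⟨m, ?_, rfl⟩
    rw [Finsupp.mem_supported] at *
    exact Set.subset_inter hl hm
  · exact le_inf (Submodule.span_mono (Set.image_mono Set.inter_subset_left))
      (Submodule.span_mono (Set.image_mono Set.inter_subset_right))

/-- The span of the vectors `θᵏ wᵢ` with `(k, i) ∈ S`. -/
def thetaSpan (θ : X ≃ₗ[ℂ] X) {n : ℕ} (w : Fin n → X) (S : Set (ℤ × Fin n)) : Submodule ℂ X :=
  Submodule.span ℂ ((fun p : ℤ × Fin n => (θ ^ p.1) (w p.2)) '' S)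

variable (θ : X ≃ₗ[ℂ] X) {n : ℕ} (w : Fin n → X)

theorem map_thetaSpan (m : ℤ) (S : Set (ℤ × Fin n)) :
    (thetaSpan θ w S).map ((θ ^ m : X ≃ₗ[ℂ] X) : X →ₗ[ℂ] X) =
      thetaSpan θ w {p | (p.1 - m, p.2) ∈ S} := by
  rw [thetaSpan, thetaSpan, Submodule.map_span]
  congr 1
  ext x
  constructor
  · rintro ⟨_, ⟨p, hp, rfl⟩, rfl⟩
    refine ⟨(p.1 + m, p.2), by simpa using hp, ?_⟩
    simp [add_comm p.1 m, zpow_add]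
  · rintro ⟨p, hp, rfl⟩
    refine ⟨_, ⟨_, hp, rfl⟩, ?_⟩
    simp only [LinearEquiv.coe_coe]
    rw [← LinearEquiv.mul_apply, ← zpow_add, add_sub_cancel]

theorem map_thetaSpan_one (S : Set (ℤ × Fin n)) :
    (thetaSpan θ w S).map (θ : X →ₗ[ℂ] X) = thetaSpan θ w {p | (p.1 - 1, p.2) ∈ S} := by
  rw [← map_thetaSpan, zpow_one]

theorem coe_symm_pow (k : ℕ) :
    ((θ.symm : X →ₗ[ℂ] X) ^ k) = ((θ ^ (-(k : ℤ)) : X ≃ₗ[ℂ] X) : X →ₗ[ℂ] X) := by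
  induction k with
  | zero => rfl
  | succ k ih =>
    rw [pow_succ, ih]
    ext x
    rw [Nat.cast_succ, neg_add, zpow_add, zpow_neg_one]
    rfl

theorem coe_pow_eq (k : ℕ) :
    ((θ : X →ₗ[ℂ] X) ^ k) = ((θ ^ (k : ℤ) : X ≃ₗ[ℂ] X) : X →ₗ[ℂ] X) := by
  induction k with
  | zero => rfl
  | succ k ih =>
    rw [pow_succ, ih]
    ext x
    rw [Nat.cast_succ, zpow_add, zpow_one]
    rfl

theorem thetaSpan_symm (S : Set (ℤ × Fin n)) :
    thetaSpan θ.symm w S = thetaSpan θ w {p | (-p.1, p.2) ∈ S} := by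
  rw [thetaSpan, thetaSpan]
  congr 1
  have h : ∀ (k : ℤ) (x : X), (θ.symm ^ k) x = (θ ^ (-k)) x := by
    intro k x
    rw [zpow_neg, ← inv_zpow]
    rfl
  ext x
  constructor
  · rintro ⟨p, hp, rfl⟩
    exact ⟨(-p.1, p.2), by simpa using hp, (h _ _).symm⟩
  · rintro ⟨p, hp, rfl⟩
    exact ⟨(-p.1, p.2), hp, by simp only [h, neg_neg]⟩

theorem thetaSpan_mono {S T : Set (ℤ × Fin n)} (h : S ⊆ T) : thetaSpan θ w S ≤ thetaSpan θ w T :=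
  Submodule.span_mono (Set.image_mono h)

theorem mem_thetaSpan {S : Set (ℤ × Fin n)} {k : ℤ} {i : Fin n} (h : (k, i) ∈ S) :
    (θ ^ k) (w i) ∈ thetaSpan θ w S :=
  Submodule.subset_span ⟨(k, i), h, rfl⟩

theorem localize_thetaSpan (a : Fin n → ℤ) :
    localize θ (thetaSpan θ w {p | a p.2 ≤ p.1}) = thetaSpan θ w Set.univ := by
  rw [localize]
  simp only [coe_symm_pow, map_thetaSpan]
  apply le_antisymm
  · exact iSup_le fun k => thetaSpan_mono θ w (Set.subset_univ _)
  · rw [thetaSpan, Submodule.span_le]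
    rintro _ ⟨p, -, rfl⟩
    refine Submodule.mem_iSup_of_mem (a p.2 - p.1).toNat (mem_thetaSpan θ w ?_)
    simp only [Set.mem_ofPred_eq]
    have := Int.self_le_toNat (a p.2 - p.1)
    linarith

/-! ### Logarithmic lattices and the `V`-filtration -/

section VFiltration

variable {θ} {N : X →ₗ[ℂ] X}

theorem nabla_zpow (hcomm : ∀ x, N (θ x) = θ (N x) + θ x) (k : ℤ) (x : X) :
    N ((θ ^ k) x) = (θ ^ k) (N x) + (k : ℂ) • (θ ^ k) x := by
  induction k generalizing x with
  | zero => simp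
  | succ k ih =>
    rw [add_comm (k : ℤ) 1, zpow_add, zpow_one, LinearEquiv.mul_apply, hcomm, ih,
      LinearEquiv.mul_apply, map_add, map_smul]
    push_cast
    module
  | pred k ih =>
    have h1 := ih ((θ ^ (-1 : ℤ)) x)
    have h2 : ∀ y, (θ ^ (-(k : ℤ) - 1)) y = (θ ^ (-1 : ℤ)) ((θ ^ (-(k : ℤ))) y) := by
      intro y
      rw [sub_eq_add_neg, add_comm, zpow_add, LinearEquiv.mul_apply]
    have h3 : ∀ y, N ((θ ^ (-1 : ℤ)) y) = (θ ^ (-1 : ℤ)) (N y) - (θ ^ (-1 : ℤ)) y := by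
      intro y
      have hy : θ ((θ ^ (-1 : ℤ)) y) = y := by
        rw [zpow_neg_one]; exact θ.apply_symm_apply y
      have hy' : ∀ y, (θ ^ (-1 : ℤ)) (θ y) = y := by
        intro y
        rw [zpow_neg_one]; exact θ.symm_apply_apply y
      have := hcomm ((θ ^ (-1 : ℤ)) y)
      rw [hy] at this
      have h4 := congrArg (θ ^ (-1 : ℤ)) this
      rw [map_add, hy'] at h4
      rw [h4, add_sub_cancel_right]
    rw [h2 x, h2 (N x), h3, ih, map_add, map_smul]
    push_cast
    module

theorem nabla_map_zpow (hcomm : ∀ x, N (θ x) = θ (N x) + θ x) {W : Submodule ℂ X}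
    (hW : W.map N ≤ W) (k : ℤ) {x : X} (hx : x ∈ W.map ((θ ^ k : X ≃ₗ[ℂ] X) : X →ₗ[ℂ] X)) :
    N x ∈ W.map ((θ ^ k : X ≃ₗ[ℂ] X) : X →ₗ[ℂ] X) := by
  obtain ⟨y, hy, rfl⟩ := hx
  rw [LinearEquiv.coe_coe, nabla_zpow hcomm]
  refine add_mem ⟨N y, hW ⟨y, hy, rfl⟩, rfl⟩ (Submodule.smul_mem _ _ ⟨y, hy, rfl⟩)

theorem aeval_mem_of_map_le {W : Submodule ℂ X} (hW : ∀ x ∈ W, N x ∈ W) (p : ℂ[X]) {x : X}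
    (hx : x ∈ W) : aeval N p x ∈ W := by
  induction p using Polynomial.induction_on' with
  | add p q hp hq => rw [map_add]; exact add_mem hp hq
  | monomial k c =>
    rw [aeval_monomial]
    refine Submodule.smul_mem _ _ ?_
    induction k with
    | zero => exact hx
    | succ k ih => rw [pow_succ']; exact hW _ ih

/-- Conjugation by `θᵏ` turns `N` into `N - k`. Nilpotency of the residue on a lattice thus becomes
nilpotency of `N - k` on its translate by `θᵏ`. -/
theorem sub_pow_zpow (hcomm : ∀ x, N (θ x) = θ (N x) + θ x) (k : ℤ) (r : ℕ) (x : X) :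
    aeval N ((Polynomial.X - C (k : ℂ)) ^ r : ℂ[X]) ((θ ^ k) x) = (θ ^ k) ((N ^ r) x) := by
  induction r with
  | zero => simp
  | succ r ih =>
    rw [pow_succ', map_mul, Module.End.mul_apply, ih, pow_succ' N, Module.End.mul_apply]
    simp [nabla_zpow hcomm, Int.cast_smul_eq_zsmul]

variable {M W : Submodule ℂ X}

theorem map_le_of_isFGSubmodule (h : IsFGSubmodule θ W) {x : X} (hx : x ∈ W) : θ x ∈ W := by
  obtain ⟨s, rfl⟩ := h
  have : (⨆ k : ℕ, (Submodule.span ℂ (s : Set X)).map ((θ : X →ₗ[ℂ] X) ^ k)).map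
      (θ : X →ₗ[ℂ] X) ≤ ⨆ k : ℕ, (Submodule.span ℂ (s : Set X)).map ((θ : X →ₗ[ℂ] X) ^ k) := by
    rw [Submodule.map_iSup]
    refine iSup_le fun k => ?_
    rw [← Submodule.map_comp]
    refine le_trans (le_of_eq ?_) (le_iSup _ (k + 1))
    rw [pow_succ']
    rfl
  exact this ⟨x, hx, rfl⟩

theorem map_zpow_antitone (h : ∀ x ∈ W, θ x ∈ W) {k l : ℤ} (hkl : k ≤ l) :
    W.map ((θ ^ l : X ≃ₗ[ℂ] X) : X →ₗ[ℂ] X) ≤ W.map ((θ ^ k : X ≃ₗ[ℂ] X) : X →ₗ[ℂ] X) := by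
  obtain ⟨m, rfl⟩ := Int.le.dest hkl
  rintro _ ⟨x, hx, rfl⟩
  refine ⟨(θ ^ (m : ℤ)) x, ?_, ?_⟩
  · clear hkl
    induction m with
    | zero => simpa using hx
    | succ m ih =>
      rw [Nat.cast_succ, add_comm, zpow_add, zpow_one]
      exact h _ ih
  · rw [zpow_add]
    rfl

/-- A logarithmic lattice whose residue is nilpotent determines the `V`-filtration. -/
theorem vFiltration_eq (hcomm : ∀ x, N (θ x) = θ (N x) + θ x) (hfg : IsFGSubmodule θ W)
    (hN : W.map N ≤ W) (r : ℕ) (hr : ∀ x ∈ W, (N ^ r) x ∈ W.map (θ : X →ₗ[ℂ] X))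
    (hM : M = ⨆ k : ℕ, W.map ((θ.symm : X →ₗ[ℂ] X) ^ k)) (α : ℚ) :
    vFiltration θ N M α = W.map ((θ ^ ⌈α⌉ : X ≃ₗ[ℂ] X) : X →ₗ[ℂ] X) := by
  have hθ : ∀ x ∈ W, θ x ∈ W := fun x hx => map_le_of_isFGSubmodule hfg hx
  set V : ℤ → Submodule ℂ X := fun k => W.map ((θ ^ k : X ≃ₗ[ℂ] X) : X →ₗ[ℂ] X) with hV
  have hanti : ∀ {k l : ℤ}, k ≤ l → V l ≤ V k := fun h => map_zpow_antitone hθ h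
  have hVN : ∀ k, ∀ x ∈ V k, N x ∈ V k := fun k x hx => nabla_map_zpow hcomm hN k hx
  have hVθ : ∀ k, (V k).map (θ : X →ₗ[ℂ] X) = V (k + 1) := by
    intro k
    rw [hV]
    simp only
    rw [← Submodule.map_comp, add_comm, zpow_add, zpow_one]
    rfl
  have hVr : ∀ k, ∀ x ∈ V k, aeval N ((Polynomial.X - C (k : ℂ)) ^ r : ℂ[X]) x ∈ V (k + 1) := by
    rintro k _ ⟨x, hx, rfl⟩
    rw [LinearEquiv.coe_coe, sub_pow_zpow hcomm]
    obtain ⟨y, hy, hyx⟩ := hr x hx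
    rw [← hyx]
    refine ⟨y, hy, ?_⟩
    rw [zpow_add, zpow_one]
    rfl
  have hVM : ∀ k, V k ≤ M := by
    intro k
    rw [hM]
    refine le_trans (hanti (neg_le_of_abs_le (le_refl |k|))) ?_
    refine le_trans (le_of_eq ?_) (le_iSup _ k.natAbs)
    rw [coe_symm_pow, Int.natCast_natAbs]
  apply le_antisymm
  · refine sSup_le fun L hL => ?_
    obtain ⟨b, -, hb, hbL⟩ := hL.residue
    -- A competing lattice is finitely generated and `M` is the increasing union of the `V (-k)`, so
    -- one level contains it. It is then pushed up one level at a time to `⌈α⌉`.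
    have hstart : ∃ k : ℕ, L ≤ V (-(k : ℤ)) := by
      obtain ⟨s, hs⟩ := hL.fg
      have hdir : Monotone fun k : ℕ => V (-(k : ℤ)) := fun k l h => hanti (by omega)
      have hex : ∃ k : ℕ, (s : Set X) ⊆ V (-(k : ℤ)) := by
        have hsM : ∀ x ∈ s, ∃ k : ℕ, x ∈ V (-(k : ℤ)) := by
          intro x hx
          have hxM : x ∈ M := hL.le (by
            rw [hs]
            exact Submodule.mem_iSup_of_mem 0 ⟨x, Submodule.subset_span hx, rfl⟩)
          rw [hM] at hxM
          simp only [coe_symm_pow] at hxM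
          exact (Submodule.mem_iSup_of_directed _ hdir.directed_le).1 hxM
        choose! g hg using hsM
        refine ⟨s.sup g, fun x hx => hdir (Finset.le_sup (f := g) hx) (hg x hx)⟩
      obtain ⟨k, hk⟩ := hex
      refine ⟨k, ?_⟩
      rw [hs]
      refine iSup_le fun m => ?_
      rintro _ ⟨x, hx, rfl⟩
      have hx' : x ∈ V (-(k : ℤ)) := Submodule.span_le.2 hk hx
      have : ((θ : X →ₗ[ℂ] X) ^ m) x ∈ V (-(k : ℤ) + m) := by
        clear hx
        induction m with
        | zero => simpa using hx'
        | succ m ih =>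
          rw [Nat.cast_succ, ← add_assoc, ← hVθ, pow_succ']
          exact ⟨_, ih, rfl⟩
      exact hanti (by omega) this
    -- On `V j / V (j + 1)` the only eigenvalue of `N` is `j`, whereas the roots of `b` are at least
    -- `α > j`. A Bézout identity between `b` and `(X - j)ʳ` then recovers `x` from `b(N)x` and `(N
    -- - j)ʳx`, both of which lie in `V (j + 1)`.
    have hstep : ∀ j : ℤ, j < ⌈α⌉ → L ≤ V j → L ≤ V (j + 1) := by
      intro j hj hLj x hx
      have hcop : IsCoprime b ((Polynomial.X - C (j : ℂ)) ^ r) := by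
        refine IsCoprime.pow_right (IsCoprime.symm ?_)
        rw [(irreducible_X_sub_C (j : ℂ)).coprime_iff_not_dvd, dvd_iff_isRoot]
        intro hroot
        obtain ⟨q, hq, hqj⟩ := hb _ hroot
        have : (j : ℚ) = q := by exact_mod_cast hqj
        rw [Int.lt_ceil] at hj
        linarith
      obtain ⟨u, v, huv⟩ := hcop
      have hbx : aeval N b x ∈ V (j + 1) := by
        rw [← hVθ]
        exact Submodule.map_mono hLj (hbL ⟨x, hx, rfl⟩)
      have hrx := hVr j x (hLj hx)
      have hx1 : x = aeval N u (aeval N b x) +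
          aeval N v (aeval N ((Polynomial.X - C (j : ℂ)) ^ r : ℂ[X]) x) := by
        rw [← Module.End.mul_apply, ← Module.End.mul_apply, ← map_mul, ← map_mul,
          ← LinearMap.add_apply, ← map_add, huv, map_one, Module.End.one_apply]
      rw [hx1]
      exact add_mem (aeval_mem_of_map_le (hVN _) u hbx) (aeval_mem_of_map_le (hVN _) v hrx)
    obtain ⟨k, hk⟩ := hstart
    change L ≤ V ⌈α⌉
    by_cases hkc : ⌈α⌉ ≤ -(k : ℤ)
    · exact hk.trans (hanti hkc)
    · have hup : ∀ m : ℕ, -(k : ℤ) + m ≤ ⌈α⌉ → L ≤ V (-(k : ℤ) + m) := by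
        intro m
        induction m with
        | zero => intro _; simpa using hk
        | succ m ih =>
          intro h
          push_cast at h ⊢
          rw [← add_assoc]
          exact hstep _ (by omega) (ih (by omega))
      have := hup (⌈α⌉ + k).toNat (by omega)
      rwa [show -(k : ℤ) + ((⌈α⌉ + k).toNat : ℤ) = ⌈α⌉ by omega] at this
  -- Conversely `V ⌈α⌉` itself competes: its residue is annihilated by `(X - ⌈α⌉)ʳ`, whose only
  -- possible root is at least `α`.
  · refine le_sSup ⟨hVM _, ?_, ?_, ?_⟩
    · obtain ⟨s, hs⟩ := hfg
      classical
      refine ⟨s.image (θ ^ ⌈α⌉ : X ≃ₗ[ℂ] X), ?_⟩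
      rw [Finset.coe_image]
      conv_lhs => rw [hs]
      rw [Submodule.map_iSup]
      refine iSup_congr fun k => ?_
      rw [← LinearEquiv.coe_coe (θ ^ ⌈α⌉), ← Submodule.map_span, ← Submodule.map_comp,
        ← Submodule.map_comp, coe_pow_eq]
      congr 1
      ext x
      simp only [LinearMap.comp_apply, LinearEquiv.coe_coe]
      rw [← LinearEquiv.mul_apply, ← LinearEquiv.mul_apply, ← zpow_add, ← zpow_add, add_comm]
    · rintro _ ⟨x, hx, rfl⟩
      exact hVN _ x hx
    · refine ⟨(Polynomial.X - C (⌈α⌉ : ℂ)) ^ r, pow_ne_zero _ (X_sub_C_ne_zero _), ?_, ?_⟩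
      · intro z hz
        refine ⟨⌈α⌉, Int.le_ceil _, ?_⟩
        rw [IsRoot, eval_pow] at hz
        have := eq_zero_of_pow_eq_zero hz
        simp only [eval_sub, eval_X, eval_C, sub_eq_zero] at this
        rw [this]
        simp
      · rintro _ ⟨x, hx, rfl⟩
        change _ ∈ (V ⌈α⌉).map _
        rw [hVθ]
        exact hVr _ x hx

end VFiltration

theorem isFGSubmodule_thetaSpan :
    IsFGSubmodule θ (thetaSpan θ w {p | 0 ≤ p.1}) := by
  classical
  refine ⟨Finset.univ.image w, ?_⟩
  have h : ∀ k : ℕ, (Submodule.span ℂ ((Finset.univ.image w : Finset X) : Set X)).map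
      ((θ : X →ₗ[ℂ] X) ^ k) = thetaSpan θ w {p | p.1 = (k : ℤ)} := by
    intro k
    rw [coe_pow_eq, Submodule.map_span, thetaSpan]
    congr 1
    ext x
    constructor
    · rintro ⟨y, hy, rfl⟩
      rw [Finset.coe_image] at hy
      obtain ⟨i, -, rfl⟩ := hy
      exact ⟨((k : ℤ), i), rfl, rfl⟩
    · rintro ⟨p, hp, rfl⟩
      refine ⟨w p.2, by simp, ?_⟩
      rw [← show p.1 = (k : ℤ) from hp]
      rfl
  simp only [h]
  apply le_antisymm
  · rw [thetaSpan, Submodule.span_le]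
    rintro _ ⟨⟨k, i⟩, hp, rfl⟩
    obtain ⟨m, rfl⟩ := Int.eq_ofNat_of_zero_le (show 0 ≤ k from hp)
    exact Submodule.mem_iSup_of_mem m (mem_thetaSpan θ w rfl)
  · refine iSup_le fun k => thetaSpan_mono θ w ?_
    rintro ⟨l, i⟩ hp
    have : l = (k : ℤ) := hp
    change 0 ≤ l
    omega

/-! ### Bases in which the residue is strictly triangular -/

section Chain

variable {θ w} {N : X →ₗ[ℂ] X}

/-- Each `N wᵢ` is a combination of the `wⱼ` with `j > i`, up to `θ ∑ ℂ[θ] wⱼ`. -/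
def IsNilpotentChain (θ : X ≃ₗ[ℂ] X) (N : X →ₗ[ℂ] X) (w : Fin n → X) : Prop :=
  ∀ i, N (w i) ∈ Submodule.span ℂ (w '' {j | i < j}) ⊔ thetaSpan θ w {p | 1 ≤ p.1}

/-- Modulo positive powers of `θ` the operator `N` is strictly triangular, so each application
raises the lowest index by one. The part with positive powers of `θ` is preserved because `N θᵏ = θᵏ
(N + k)`. -/
theorem IsNilpotentChain.nabla_mem (hcomm : ∀ x, N (θ x) = θ (N x) + θ x)
    (hw : IsNilpotentChain θ N w) (m : ℕ) {x : X}
    (hx : x ∈ Submodule.span ℂ (w '' {j | m ≤ (j : ℕ)}) ⊔ thetaSpan θ w {p | 1 ≤ p.1}) :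
    N x ∈ Submodule.span ℂ (w '' {j | m + 1 ≤ (j : ℕ)}) ⊔ thetaSpan θ w {p | 1 ≤ p.1} := by
  have hmono : ∀ i : Fin n, m ≤ (i : ℕ) →
      Submodule.span ℂ (w '' {j | i < j}) ≤ Submodule.span ℂ (w '' {j | m + 1 ≤ (j : ℕ)}) := by
    intro i hi
    refine Submodule.span_mono (Set.image_mono fun j (hj : i < j) => ?_)
    change m + 1 ≤ (j : ℕ)
    omega
  have hspan : ∀ i : Fin n, Submodule.span ℂ (w '' {j | i < j}) ≤ thetaSpan θ w {p | 0 ≤ p.1} := by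
    intro i
    rw [Submodule.span_le]
    rintro _ ⟨j, -, rfl⟩
    exact mem_thetaSpan θ w (k := 0) (show (0 : ℤ) ≤ 0 from le_refl 0)
  suffices h : Submodule.span ℂ (w '' {j | m ≤ (j : ℕ)}) ⊔ thetaSpan θ w {p | 1 ≤ p.1} ≤
      (Submodule.span ℂ (w '' {j | m + 1 ≤ (j : ℕ)}) ⊔ thetaSpan θ w {p | 1 ≤ p.1}).comap N from
    h hx
  refine sup_le ?_ ?_
  · rw [Submodule.span_le]
    rintro _ ⟨i, hi, rfl⟩
    exact sup_le_sup_right (hmono i hi) _ (hw i)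
  · conv_lhs => rw [thetaSpan]
    rw [Submodule.span_le]
    rintro _ ⟨⟨k, i⟩, hk, rfl⟩
    have hk : 1 ≤ k := hk
    refine Submodule.mem_sup_right ?_
    simp only
    rw [nabla_zpow hcomm]
    refine add_mem ?_ (Submodule.smul_mem _ _ (mem_thetaSpan θ w hk))
    have h0 : N (w i) ∈ thetaSpan θ w {p | 0 ≤ p.1} :=
      sup_le (hspan i) (thetaSpan_mono θ w fun p (hp : 1 ≤ p.1) =>
        (le_trans zero_le_one hp : 0 ≤ p.1)) (hw i)
    have h1 := Submodule.mem_map_of_mem (f := ((θ ^ k : X ≃ₗ[ℂ] X) : X →ₗ[ℂ] X)) h0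
    rw [map_thetaSpan] at h1
    refine thetaSpan_mono θ w (fun p hp => ?_) h1
    have : 0 ≤ p.1 - k := hp
    change 1 ≤ p.1
    omega

theorem thetaSpan_nonneg (m : ℕ) (hm : m = 0) :
    Submodule.span ℂ (w '' {j | m ≤ (j : ℕ)}) ⊔ thetaSpan θ w {p | 1 ≤ p.1} =
      thetaSpan θ w {p | 0 ≤ p.1} := by
  subst hm
  apply le_antisymm
  · refine sup_le ?_ (thetaSpan_mono θ w fun p (hp : 1 ≤ p.1) =>
        (le_trans zero_le_one hp : 0 ≤ p.1))
    rw [Submodule.span_le]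
    rintro _ ⟨j, -, rfl⟩
    exact mem_thetaSpan θ w (k := 0) (show (0 : ℤ) ≤ 0 from le_refl 0)
  · conv_lhs => rw [thetaSpan]
    rw [Submodule.span_le]
    rintro _ ⟨⟨k, i⟩, hk, rfl⟩
    have hk : 0 ≤ k := hk
    rcases hk.eq_or_lt with rfl | hk
    · exact Submodule.mem_sup_left (Submodule.subset_span ⟨i, Nat.zero_le _, rfl⟩)
    · exact Submodule.mem_sup_right (mem_thetaSpan θ w (show 1 ≤ k by omega))

/-- Strict triangularity gives `Nⁿ ≡ 0` modulo `θ`. Thus the lattice generated by the `wᵢ` has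
nilpotent residue, and the `V`-filtration jumps only at integers. -/
theorem IsNilpotentChain.vFiltration_eq (hcomm : ∀ x, N (θ x) = θ (N x) + θ x)
    (hw : IsNilpotentChain θ N w) (α : ℚ) :
    vFiltration θ N (thetaSpan θ w Set.univ) α = thetaSpan θ w {p | ⌈α⌉ ≤ p.1} := by
  have hmem := fun m x hx => hw.nabla_mem hcomm m (x := x) hx
  have hpow : ∀ m : ℕ, ∀ x ∈ thetaSpan θ w {p | 0 ≤ p.1},
      (N ^ m) x ∈ Submodule.span ℂ (w '' {j | m ≤ (j : ℕ)}) ⊔ thetaSpan θ w {p | 1 ≤ p.1} := by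
    intro m x hx
    induction m with
    | zero => rw [thetaSpan_nonneg 0 rfl]; exact hx
    | succ m ih =>
      rw [pow_succ', Module.End.mul_apply]
      exact hmem m _ ih
  have h := LogBrieskorn.vFiltration_eq (W := thetaSpan θ w {p | 0 ≤ p.1})
    (M := thetaSpan θ w Set.univ) hcomm (isFGSubmodule_thetaSpan θ w) ?_ n ?_ ?_ α
  · rw [h, map_thetaSpan]
    congr 1
    ext p
    simp
  · rintro _ ⟨x, hx, rfl⟩
    have h1 := hpow 1 x hx
    rw [pow_one] at h1
    rw [← thetaSpan_nonneg 0 rfl]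
    have h2 : {j : Fin n | 1 ≤ (j : ℕ)} ⊆ {j | 0 ≤ (j : ℕ)} := fun j _ => Nat.zero_le _
    have h3 := Submodule.span_mono (R := ℂ) (Set.image_mono (f := w) h2)
    exact (sup_le_sup_right h3 _ : _ ≤ _ ⊔ thetaSpan θ w {p | 1 ≤ p.1}) h1
  · intro x hx
    have h1 := hpow n x hx
    have hempty : {j : Fin n | n ≤ (j : ℕ)} = ∅ := by
      ext j
      simp
    rw [hempty, Set.image_empty, Submodule.span_empty, bot_sup_eq] at h1
    rw [map_thetaSpan_one]
    refine thetaSpan_mono θ w (fun p (hp : 1 ≤ p.1) => ?_) h1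
    change 0 ≤ p.1 - 1
    omega
  · have := localize_thetaSpan θ w (fun _ => 0)
    rw [localize] at this
    exact this.symm

end Chain

/-- All subspaces involved are spanned by parts of one basis, so the dimension is a count of pairs
`(k, i)`. Belonging to `E` but not to `θE` forces `k = aᵢ`, and belonging to `S` but not to `T`
forces `k = α`. -/
theorem gradedDim_thetaSpan (hv : LinearIndependent ℂ fun p : ℤ × Fin n => (θ ^ p.1) (w p.2))
    (a : Fin n → ℤ) (α : ℚ) (S T : Set (ℤ × Fin n))
    (hST : ∀ p, p ∈ S ∧ p ∉ T ↔ (p.1 : ℚ) = α) (hTS : T ⊆ S) :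
    gradedDim θ (thetaSpan θ w {p | a p.2 ≤ p.1}) (thetaSpan θ w S) (thetaSpan θ w T) =
      formalSum (Finset.univ.val.map fun i => (a i : ℚ)) α := by
  have hinf : ∀ A B : Set (ℤ × Fin n),
      thetaSpan θ w A ⊓ thetaSpan θ w B = thetaSpan θ w (A ∩ B) := span_image_inf hv
  have hsup : ∀ A B : Set (ℤ × Fin n),
      thetaSpan θ w A ⊔ thetaSpan θ w B = thetaSpan θ w (A ∪ B) := fun A B => by
    rw [thetaSpan, thetaSpan, thetaSpan, ← Submodule.span_union, ← Set.image_union]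
  rw [gradedDim, rank_span_quotient hv ?_ (hinf S _)
    (B := S ∩ {p | (p.1 - 1, p.2) ∈ {p : ℤ × Fin n | a p.2 ≤ p.1}} ∪ T ∩ {p | a p.2 ≤ p.1})
    (by rw [map_thetaSpan_one, hinf, hinf, hsup]; rfl)]
  · rw [formalSum, Multiset.count_map]
    have e : ((S ∩ {p | a p.2 ≤ p.1}) \ (S ∩ {p | (p.1 - 1, p.2) ∈ {p : ℤ × Fin n | a p.2 ≤ p.1}} ∪
        T ∩ {p | a p.2 ≤ p.1})) = (fun i => (a i, i)) '' {i | α = (a i : ℚ)} := by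
      ext ⟨k, i⟩
      have h := hST (k, i)
      simp only [Set.mem_sdiff, Set.mem_inter_iff, Set.mem_ofPred_eq, Set.mem_union, Set.mem_image,
        Prod.mk.injEq] at h ⊢
      constructor
      · rintro ⟨⟨h1, h2⟩, h3⟩
        have h4 : k = a i := by
          by_contra hne
          exact h3 (Or.inl ⟨h1, by omega⟩)
        have h5 : (k, i) ∉ T := fun h5 => h3 (Or.inr ⟨h5, h2⟩)
        exact ⟨i, by rw [← h4]; exact (h.1 ⟨h1, h5⟩).symm, h4.symm, rfl⟩
      · rintro ⟨j, hj, rfl, rfl⟩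
        obtain ⟨h1, h2⟩ := h.2 hj.symm
        refine ⟨⟨h1, le_refl _⟩, ?_⟩
        rintro (⟨-, h3⟩ | ⟨h3, -⟩)
        · omega
        · exact h2 h3
    rw [e, Cardinal.mk_image_eq (fun i j hij => (Prod.mk.inj hij).2)]
    classical
    rw [Cardinal.mk_fintype, Fintype.card_subtype]
    rfl
  · rintro p (hp | hp)
    · refine ⟨hp.1, ?_⟩
      have h2 : a p.2 ≤ p.1 - 1 := hp.2
      change a p.2 ≤ p.1
      omega
    · exact ⟨hTS hp.1, hp.2⟩

/-! ### Reading off both spectra from an adapted basis -/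

section Spectra

variable {θ w} {N : X →ₗ[ℂ] X}

theorem spectrumAtZero_eq (hcomm : ∀ x, N (θ x) = θ (N x) + θ x)
    (hv : LinearIndependent ℂ fun p : ℤ × Fin n => (θ ^ p.1) (w p.2))
    (hw : IsNilpotentChain θ N w) (a : Fin n → ℤ) :
    spectrumAtZero θ N (thetaSpan θ w {p | a p.2 ≤ p.1}) =
      formalSum (Finset.univ.val.map fun i => (a i : ℚ)) := by
  funext α
  rw [spectrumAtZero, localize_thetaSpan]
  simp only [hw.vFiltration_eq hcomm]
  -- The least integer level reached by some `β > α` is `⌊α⌋ + 1`. The graded piece is then the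
  -- level `k = α` if `α` is an integer, and zero otherwise.
  have hsup : (⨆ β : ℚ, ⨆ _ : α < β, thetaSpan θ w {p | ⌈β⌉ ≤ p.1}) =
      thetaSpan θ w {p | ⌊α⌋ + 1 ≤ p.1} := by
    apply le_antisymm
    · refine iSup₂_le fun β hβ => thetaSpan_mono θ w fun p (hp : ⌈β⌉ ≤ p.1) => ?_
      have h1 : ⌊α⌋ < ⌈β⌉ := by
        rw [Int.lt_ceil]
        exact lt_of_le_of_lt (Int.floor_le α) hβ
      change ⌊α⌋ + 1 ≤ p.1
      omega
    · refine le_trans ?_ (le_iSup₂ ((⌊α⌋ + 1 : ℤ) : ℚ) (by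
        push_cast
        exact Int.lt_floor_add_one α))
      rw [Int.ceil_intCast]
  rw [hsup]
  refine gradedDim_thetaSpan θ w hv a α _ _ (fun p => ?_) (fun p (hp : ⌊α⌋ + 1 ≤ p.1) => ?_)
  · simp only [Set.mem_ofPred_eq, not_le, Int.ceil_le, Int.lt_add_one_iff, Int.le_floor]
    constructor
    · rintro ⟨h1, h2⟩
      exact le_antisymm h2 h1
    · intro h
      exact ⟨h.ge, h.le⟩
  · have := Int.ceil_le_floor_add_one α
    change ⌈α⌉ ≤ p.1
    omega

/-- The pair `(θ⁻¹, -N)` satisfies the same commutation relation as `(θ, N)`, so the `V`-filtration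
at infinity is an instance of the one at zero. Only the lattice keeps its description in terms of
`θ`. -/
theorem spectrumAtInfty_eq (hcomm : ∀ x, N (θ x) = θ (N x) + θ x)
    (hv : LinearIndependent ℂ fun p : ℤ × Fin n => (θ ^ p.1) (w p.2))
    (hw : IsNilpotentChain θ.symm (-N) w) (a : Fin n → ℤ) :
    spectrumAtInfty θ N (thetaSpan θ w {p | a p.2 ≤ p.1}) =
      formalSum (Finset.univ.val.map fun i => (a i : ℚ)) := by
  have hcomm' : ∀ x, (-N) (θ.symm x) = θ.symm ((-N) x) + θ.symm x := by
    intro x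
    have h1 := congrArg θ.symm (hcomm (θ.symm x))
    simp only [LinearEquiv.apply_symm_apply, map_add, LinearEquiv.symm_apply_apply] at h1
    simp only [LinearMap.neg_apply, map_neg, h1]
    abel
  funext α
  rw [spectrumAtInfty, localize_thetaSpan]
  have huniv : thetaSpan θ w Set.univ = thetaSpan θ.symm w Set.univ := by
    rw [thetaSpan_symm]
    rfl
  have hV : ∀ β : ℚ, vFiltrationInfty θ N (thetaSpan θ w Set.univ) β =
      thetaSpan θ w {p | p.1 ≤ ⌊β⌋} := by
    intro β
    rw [vFiltrationInfty, huniv, hw.vFiltration_eq hcomm', thetaSpan_symm]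
    congr 1
    ext p
    simp [Int.ceil_neg]
  simp only [hV]
  have hsup : (⨆ β : ℚ, ⨆ _ : β < α, thetaSpan θ w {p | p.1 ≤ ⌊β⌋}) =
      thetaSpan θ w {p | p.1 ≤ ⌈α⌉ - 1} := by
    apply le_antisymm
    · refine iSup₂_le fun β hβ => thetaSpan_mono θ w fun p (hp : p.1 ≤ ⌊β⌋) => ?_
      have h1 : ⌊β⌋ < ⌈α⌉ := by
        rw [Int.lt_ceil]
        exact lt_of_le_of_lt (Int.floor_le β) hβ
      change p.1 ≤ ⌈α⌉ - 1
      omega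
    · refine le_trans ?_ (le_iSup₂ ((⌈α⌉ - 1 : ℤ) : ℚ) (by
        have := Int.ceil_lt_add_one α
        push_cast
        linarith))
      rw [Int.floor_intCast]
  rw [hsup]
  refine gradedDim_thetaSpan θ w hv a α _ _ (fun p => ?_) (fun p (hp : p.1 ≤ ⌈α⌉ - 1) => ?_)
  · simp only [Set.mem_ofPred_eq, not_le, Int.le_floor]
    rw [show ⌈α⌉ - 1 < p.1 ↔ ⌈α⌉ ≤ p.1 by omega, Int.ceil_le]
    constructor
    · rintro ⟨h1, h2⟩
      exact le_antisymm h1 h2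
    · intro h
      exact ⟨h.le, h.ge⟩
  · have := Int.ceil_le_floor_add_one α
    change p.1 ≤ ⌊α⌋
    omega

end Spectra

end AbstractSpectrum

end LogBrieskorn

end

noncomputable section

namespace LogBrieskorn

section CommAeval

variable {n : ℕ} {V V' : Type*} [AddCommGroup V] [Module ℂ V] [AddCommGroup V'] [Module ℂ V']

/-! ### Polynomials in commuting operators -/

open scoped IsMulCommutative in
/-- The algebra homomorphism `Xᵢ ↦ Dᵢ` for commuting operators `Dᵢ`. -/
def commAeval (D : Fin n → Module.End ℂ V) (hD : ∀ i j, D i * D j = D j * D i) :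
    MvPolynomial (Fin n) ℂ →ₐ[ℂ] Module.End ℂ V :=
  have : IsMulCommutative (Algebra.adjoin ℂ (Set.range D)) :=
    Algebra.isMulCommutative_adjoin ℂ (by
      rintro _ ⟨i, rfl⟩ _ ⟨j, rfl⟩
      exact hD i j)
  (Algebra.adjoin ℂ (Set.range D)).val.comp
    (MvPolynomial.aeval fun i => ⟨D i, Algebra.subset_adjoin ⟨i, rfl⟩⟩)

theorem commAeval_X (D : Fin n → Module.End ℂ V) (hD : ∀ i j, D i * D j = D j * D i) (i : Fin n) :
    commAeval D hD (MvPolynomial.X i) = D i := by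
  simp [commAeval]

theorem commAeval_mul_X_apply (D : Fin n → Module.End ℂ V) (hD : ∀ i j, D i * D j = D j * D i)
    (g : MvPolynomial (Fin n) ℂ) (i : Fin n) (v : V) :
    commAeval D hD (g * MvPolynomial.X i) v = commAeval D hD g (D i v) := by
  rw [map_mul, commAeval_X, Module.End.mul_apply]

theorem commAeval_C_apply (D : Fin n → Module.End ℂ V) (hD : ∀ i j, D i * D j = D j * D i)
    (z : ℂ) (v : V) : commAeval D hD (MvPolynomial.C z) v = z • v := by
  rw [← MvPolynomial.algebraMap_eq, AlgHom.commutes, Module.algebraMap_end_apply]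

theorem commAeval_mem (D : Fin n → Module.End ℂ V) (hD : ∀ i j, D i * D j = D j * D i)
    (A : Subalgebra ℂ (Module.End ℂ V)) (hA : ∀ i, D i ∈ A) (g : MvPolynomial (Fin n) ℂ) :
    commAeval D hD g ∈ A := by
  induction g using MvPolynomial.induction_on with
  | C z => rw [← MvPolynomial.algebraMap_eq, AlgHom.commutes]; exact A.algebraMap_mem z
  | add p q hp hq => rw [map_add]; exact add_mem hp hq
  | mul_X p i hp => rw [map_mul, commAeval_X]; exact mul_mem hp (hA i)

theorem commAeval_intertwine (D : Fin n → Module.End ℂ V) (hD : ∀ i j, D i * D j = D j * D i)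
    (D' : Fin n → Module.End ℂ V') (hD' : ∀ i j, D' i * D' j = D' j * D' i)
    (L : V →ₗ[ℂ] V') (hL : ∀ i v, L (D i v) = D' i (L v)) (g : MvPolynomial (Fin n) ℂ) (v : V) :
    L (commAeval D hD g v) = commAeval D' hD' g (L v) := by
  induction g using MvPolynomial.induction_on generalizing v with
  | C z => rw [commAeval_C_apply, commAeval_C_apply, map_smul]
  | add p q hp hq => rw [map_add, map_add, LinearMap.add_apply, LinearMap.add_apply, map_add, hp, hq]
  | mul_X p i hp => rw [commAeval_mul_X_apply, commAeval_mul_X_apply, hp, hL]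

/-- The canonical commutation relations extend to `[g(D), xⱼ] = κ (∂ⱼg)(D)`. -/
theorem commAeval_commutator (D : Fin n → Module.End ℂ V) (hD : ∀ i j, D i * D j = D j * D i)
    (x : Module.End ℂ V) (j : Fin n) (κ : ℂ)
    (hx : ∀ i v, D i (x v) = x (D i v) + if i = j then κ • v else 0)
    (g : MvPolynomial (Fin n) ℂ) (v : V) :
    commAeval D hD g (x v) =
      x (commAeval D hD g v) + κ • commAeval D hD (MvPolynomial.pderiv j g) v := by
  induction g using MvPolynomial.induction_on generalizing v with
  | C z => simp
  | add p q hp hq =>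
    simp only [map_add, LinearMap.add_apply, hp, hq, smul_add]
    abel
  | mul_X p i hp =>
    have h1 : MvPolynomial.pderiv j (p * MvPolynomial.X i) =
        MvPolynomial.pderiv j p * MvPolynomial.X i + if i = j then p else 0 := by
      rw [Derivation.leibniz, MvPolynomial.pderiv_X, smul_eq_mul, smul_eq_mul]
      by_cases hij : i = j
      · subst hij
        rw [Pi.single_eq_same, if_pos rfl]
        ring
      · rw [Pi.single_eq_of_ne hij, if_neg hij]
        ring
    rw [commAeval_mul_X_apply, commAeval_mul_X_apply, hx, map_add, hp, h1, map_add,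
      LinearMap.add_apply, commAeval_mul_X_apply, smul_add, add_assoc]
    congr 2
    by_cases hij : i = j
    · rw [if_pos hij, if_pos hij, map_smul]
    · rw [if_neg hij, if_neg hij, map_zero, map_zero, LinearMap.zero_apply, smul_zero]

/-- Induction on homogeneous polynomials. -/
theorem homogeneous_induction {P : ℕ → MvPolynomial (Fin n) ℂ → Prop}
    (hC : ∀ z, P 0 (MvPolynomial.C z)) (hzero : ∀ d, P d 0)
    (hadd : ∀ d p q, P d p → P d q → P d (p + q))
    (hmul : ∀ d p i, p.IsHomogeneous d → P d p → P (d + 1) (p * MvPolynomial.X i))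
    {d : ℕ} {g : MvPolynomial (Fin n) ℂ} (hg : g.IsHomogeneous d) : P d g := by
  have hmon : ∀ (d : ℕ) (m : Fin n →₀ ℕ) (z : ℂ), m.degree = d → P d (MvPolynomial.monomial m z) := by
    intro d
    induction d with
    | zero =>
      intro m z hm
      rw [(Finsupp.degree_eq_zero_iff m).1 hm]
      exact hC z
    | succ d ih =>
      intro m z hm
      have hm0 : m ≠ 0 := by
        rintro rfl
        simp at hm
      obtain ⟨i, hi⟩ := Finsupp.ne_iff.1 hm0
      have hle : Finsupp.single i 1 ≤ m := by
        rw [Finsupp.single_le_iff]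
        exact Nat.one_le_iff_ne_zero.2 hi
      obtain ⟨m', rfl⟩ := exists_add_of_le hle
      have hm' : m'.degree = d := by
        rw [map_add, Finsupp.degree_single] at hm
        omega
      have := hmul d _ i (MvPolynomial.isHomogeneous_monomial z hm') (ih m' z hm')
      rwa [MvPolynomial.X, MvPolynomial.monomial_mul, mul_one, add_comm m'] at this
  rw [g.as_sum]
  refine Finset.sum_induction _ (P d) (hadd d) (hzero d) fun m hm => hmon d m _ ?_
  rw [Finsupp.degree_eq_weight_one]
  exact hg (MvPolynomial.mem_support_iff.1 hm)

theorem commAeval_smul_of_isHomogeneous (D : Fin n → Module.End ℂ V)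
    (hD : ∀ i j, D i * D j = D j * D i) (c : ℂ)
    (hcD : ∀ i j, (c • D i) * (c • D j) = (c • D j) * (c • D i))
    {g : MvPolynomial (Fin n) ℂ} {d : ℕ} (hg : g.IsHomogeneous d) :
    commAeval (fun i => c • D i) hcD g = c ^ d • commAeval D hD g := by
  refine homogeneous_induction (P := fun d g =>
    commAeval (fun i => c • D i) hcD g = c ^ d • commAeval D hD g) ?_ ?_ ?_ ?_ hg
  · intro z
    rw [← MvPolynomial.algebraMap_eq, AlgHom.commutes, AlgHom.commutes, pow_zero, one_smul]
  · intro d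
    rw [map_zero, map_zero, smul_zero]
  · intro d p q hp hq
    rw [map_add, map_add, hp, hq, smul_add]
  · intro d p i _ hp
    rw [map_mul, map_mul, hp, commAeval_X, commAeval_X, smul_mul_smul_comm, pow_succ]

end CommAeval

section TwistedDerivation

open Polynomial

variable {n : ℕ} (h : MvPolynomial (Fin n) ℂ)

/-! ### The operators `∂ᵢ` on `𝒪_V(*D)[s] hˢ` -/

/-- The logarithmic derivative `∂ᵢ(h)/h`. -/
def logDeriv (i : Fin n) : PolarRing h :=
  IsLocalization.Away.invSelf h * algebraMap _ (PolarRing h) (MvPolynomial.pderiv i h)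

theorem algebraMap_mul_invSelf :
    algebraMap _ (PolarRing h) h * IsLocalization.Away.invSelf h = 1 :=
  IsLocalization.Away.mul_invSelf h

theorem twistedPartial_monomial (i : Fin n) (k : ℕ) (r : PolarRing h) :
    twistedPartial h i (monomial k r) =
      monomial k (polarDeriv h i r) + Polynomial.X * C (logDeriv h i) * monomial k r := by
  rw [twistedPartial, LinearMap.add_apply, LinearMap.mulLeft_apply]
  congr 1
  exact sum_monomial_index r (fun k c => monomial k (polarDeriv h i c)) (by simp)

/-- The derivation `∂ᵢ` on `𝒪_V(*D)[s]` acting on the coefficients. -/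
def coeffDeriv (i : Fin n) : Derivation ℂ (PolarRing h)[X] (PolarRing h)[X] :=
  Derivation.mk' (twistedPartial h i - LinearMap.mulLeft ℂ (Polynomial.X * C (logDeriv h i)))
    (by
      have hm : ∀ (k : ℕ) (r : PolarRing h),
          (twistedPartial h i - LinearMap.mulLeft ℂ
            (Polynomial.X * C (logDeriv h i)) : _ →ₗ[ℂ] _) (monomial k r) = monomial k (polarDeriv h i r) := by
        intro k r
        rw [LinearMap.sub_apply, twistedPartial_monomial, LinearMap.mulLeft_apply,
          add_sub_cancel_right]
      intro p q
      induction p using Polynomial.induction_on' with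
      | add p p' hp hp' =>
        rw [add_mul, map_add, hp, hp', map_add]
        simp only [smul_eq_mul]
        ring
      | monomial k r =>
        induction q using Polynomial.induction_on' with
        | add q q' hq hq' =>
          rw [mul_add, map_add, hq, hq', map_add]
          simp only [smul_eq_mul]
          ring
        | monomial l t =>
          rw [monomial_mul_monomial, hm, hm, hm, smul_eq_mul, smul_eq_mul, monomial_mul_monomial,
            monomial_mul_monomial, Derivation.leibniz, smul_eq_mul, smul_eq_mul, map_add,
            add_comm k l])

theorem twistedPartial_eq (i : Fin n) (u : (PolarRing h)[X]) :
    twistedPartial h i u = coeffDeriv h i u + Polynomial.X * C (logDeriv h i) * u := by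
  change _ = (twistedPartial h i u - Polynomial.X * C (logDeriv h i) * u) + _
  rw [sub_add_cancel]

theorem coeffDeriv_monomial (i : Fin n) (k : ℕ) (r : PolarRing h) :
    coeffDeriv h i (monomial k r) = monomial k (polarDeriv h i r) := by
  have := twistedPartial_eq h i (monomial k r)
  rw [twistedPartial_monomial] at this
  exact (add_right_cancel this).symm

theorem coeffDeriv_C (i : Fin n) (r : PolarRing h) :
    coeffDeriv h i (C r) = C (polarDeriv h i r) :=
  coeffDeriv_monomial h i 0 r

theorem coeffDeriv_X (i : Fin n) : coeffDeriv h i Polynomial.X = 0 := by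
  rw [← monomial_one_one_eq_X, coeffDeriv_monomial, Derivation.map_one_eq_zero, map_zero]

/-- A polynomial in `s` with constant coefficients, as an element of `𝒪_V(*D)[s]`. -/
def scalarPoly (p : ℂ[X]) : (PolarRing h)[X] := p.map (algebraMap ℂ (PolarRing h))

theorem coeffDeriv_scalarPoly (i : Fin n) (p : ℂ[X]) : coeffDeriv h i (scalarPoly h p) = 0 := by
  rw [scalarPoly]
  induction p using Polynomial.induction_on' with
  | add p q hp hq => rw [Polynomial.map_add, map_add, hp, hq, add_zero]
  | monomial k c => rw [map_monomial, coeffDeriv_monomial, Derivation.map_algebraMap, map_zero]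

theorem twistedPartial_scalarPoly_mul (i : Fin n) (p : ℂ[X]) (u : (PolarRing h)[X]) :
    twistedPartial h i (scalarPoly h p * u) = scalarPoly h p * twistedPartial h i u := by
  rw [twistedPartial_eq, twistedPartial_eq, Derivation.leibniz, coeffDeriv_scalarPoly, smul_zero,
    add_zero, smul_eq_mul]
  ring

theorem twistedPartial_C_mul (i : Fin n) (r : PolarRing h) (u : (PolarRing h)[X]) :
    twistedPartial h i (C r * u) = C r * twistedPartial h i u + C (polarDeriv h i r) * u := by
  rw [twistedPartial_eq, twistedPartial_eq, Derivation.leibniz, coeffDeriv_C, smul_eq_mul,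
    smul_eq_mul]
  ring

theorem pderiv_comm (i j : Fin n) (g : MvPolynomial (Fin n) ℂ) :
    MvPolynomial.pderiv i (MvPolynomial.pderiv j g) =
      MvPolynomial.pderiv j (MvPolynomial.pderiv i g) := by
  have : ⁅(MvPolynomial.pderiv i : Derivation ℂ (MvPolynomial (Fin n) ℂ) _),
      (MvPolynomial.pderiv j : Derivation ℂ (MvPolynomial (Fin n) ℂ) _)⁆ =
      (0 : Derivation ℂ (MvPolynomial (Fin n) ℂ) (MvPolynomial (Fin n) ℂ)) := by
    refine MvPolynomial.derivation_ext fun k => ?_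
    rw [Derivation.commutator_apply, MvPolynomial.pderiv_X, MvPolynomial.pderiv_X]
    rw [Pi.single_apply, Pi.single_apply]
    split_ifs <;> simp
  have h2 := congrArg (fun d : Derivation ℂ _ _ => d g) this
  simpa [Derivation.commutator_apply, sub_eq_zero] using h2

/-- Every element `x` satisfies `x hᵏ = g` with `g` a polynomial. Applying the derivation leaves `hᵏ
d(x) = 0`, and `hᵏ` is a unit. -/
theorem polarRing_derivation_ext {d : Derivation ℂ (PolarRing h) (PolarRing h)}
    (hd : ∀ g : MvPolynomial (Fin n) ℂ, d (algebraMap _ _ g) = 0) : d = 0 := by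
  ext x
  obtain ⟨k, g, hx⟩ := IsLocalization.Away.surj h x
  have h1 := congrArg d hx
  rw [hd, Derivation.leibniz, ← map_pow, hd, smul_zero, zero_add, map_pow, smul_eq_mul] at h1
  exact ((IsLocalization.Away.algebraMap_pow_isUnit h k).mul_right_eq_zero).1 h1

theorem polarDeriv_comm (i j : Fin n) (x : PolarRing h) :
    polarDeriv h i (polarDeriv h j x) = polarDeriv h j (polarDeriv h i x) := by
  have : ⁅polarDeriv h i, polarDeriv h j⁆ = 0 := by
    refine polarRing_derivation_ext h fun g => ?_
    simp only [Derivation.commutator_apply, polarDeriv_algebraMap]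
    rw [pderiv_comm, sub_self]
  have h2 := congrArg (fun d : Derivation ℂ _ _ => d x) this
  simpa [Derivation.commutator_apply, sub_eq_zero] using h2

theorem polarDeriv_invSelf (i : Fin n) :
    polarDeriv h i (IsLocalization.Away.invSelf h) =
      -(IsLocalization.Away.invSelf h * logDeriv h i) := by
  have h1 := congrArg (polarDeriv h i) (algebraMap_mul_invSelf h)
  rw [Derivation.leibniz, Derivation.map_one_eq_zero, polarDeriv_algebraMap, smul_eq_mul,
    smul_eq_mul] at h1
  rw [logDeriv]
  linear_combination (IsLocalization.Away.invSelf h : PolarRing h) * h1 -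
    (polarDeriv h i (IsLocalization.Away.invSelf h)) * algebraMap_mul_invSelf h

theorem polarDeriv_logDeriv_comm (i j : Fin n) :
    polarDeriv h i (logDeriv h j) = polarDeriv h j (logDeriv h i) := by
  rw [logDeriv, logDeriv, Derivation.leibniz, Derivation.leibniz, polarDeriv_invSelf,
    polarDeriv_invSelf, polarDeriv_algebraMap, polarDeriv_algebraMap, pderiv_comm, logDeriv,
    logDeriv]
  simp only [smul_eq_mul]
  ring

theorem coeffDeriv_comm (i j : Fin n) (u : (PolarRing h)[X]) :
    coeffDeriv h i (coeffDeriv h j u) = coeffDeriv h j (coeffDeriv h i u) := by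
  induction u using Polynomial.induction_on' with
  | add p q hp hq => simp only [map_add, hp, hq]
  | monomial k r => simp only [coeffDeriv_monomial, polarDeriv_comm h i j]

/-- The twist is by the closed form `s dh/h`: the mixed terms agree because `∂ᵢ(∂ⱼh/h)` is symmetric
in `i` and `j`. -/
theorem twistedPartial_comm (i j : Fin n) :
    twistedPartial h i * twistedPartial h j = twistedPartial h j * twistedPartial h i := by
  refine LinearMap.ext fun u => ?_
  simp only [Module.End.mul_apply, twistedPartial_eq, map_add, Derivation.leibniz, coeffDeriv_C,
    coeffDeriv_X, smul_eq_mul, coeffDeriv_comm h i j, polarDeriv_logDeriv_comm h i j]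
  ring

/-- The operator `g(∂)` on `𝒪_V(*D)[s] hˢ`. -/
def diffOp : MvPolynomial (Fin n) ℂ →ₐ[ℂ] Module.End ℂ (PolarRing h)[X] :=
  commAeval (twistedPartial h) (twistedPartial_comm h)

theorem diffOp_mem (g : MvPolynomial (Fin n) ℂ) : diffOp h g ∈ diffOperators h :=
  commAeval_mem _ _ _ (fun i => Algebra.subset_adjoin (Or.inl (Or.inr ⟨i, rfl⟩))) g

theorem diffOp_X (i : Fin n) : diffOp h (MvPolynomial.X i) = twistedPartial h i :=
  commAeval_X _ _ i

theorem diffOp_scalarPoly_mul (g : MvPolynomial (Fin n) ℂ) (p : ℂ[X]) (u : (PolarRing h)[X]) :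
    diffOp h g (scalarPoly h p * u) = scalarPoly h p * diffOp h g u :=
  (commAeval_intertwine _ (twistedPartial_comm h) _ (twistedPartial_comm h)
    (LinearMap.mulLeft ℂ (scalarPoly h p))
    (fun i v => (twistedPartial_scalarPoly_mul h i p v).symm) g u).symm

/-- A polynomial function as an element of `𝒪_V(*D)[s]`. -/
def polyC (g : MvPolynomial (Fin n) ℂ) : (PolarRing h)[X] := C (algebraMap _ (PolarRing h) g)

theorem twistedPartial_polyC_X_mul (i j : Fin n) (u : (PolarRing h)[X]) :
    twistedPartial h i (polyC h (MvPolynomial.X j) * u) =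
      polyC h (MvPolynomial.X j) * twistedPartial h i u + if i = j then u else 0 := by
  rw [polyC, twistedPartial_C_mul, polarDeriv_algebraMap, MvPolynomial.pderiv_X]
  by_cases hij : i = j
  · subst hij; simp
  · rw [Pi.single_eq_of_ne (Ne.symm hij), if_neg hij]; simp

/-- The Euler operator `∑ xᵢ ∂ᵢ` acts on `g(∂) u` as a scalar if it does so on `u`. -/
theorem euler_diffOp {u : (PolarRing h)[X]} {e : ℂ[X]}
    (hu : ∑ i, polyC h (MvPolynomial.X i) * twistedPartial h i u = scalarPoly h e * u)
    {g : MvPolynomial (Fin n) ℂ} {d : ℕ} (hg : g.IsHomogeneous d) :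
    ∑ i, polyC h (MvPolynomial.X i) * twistedPartial h i (diffOp h g u) =
      scalarPoly h (e - C (d : ℂ)) * diffOp h g u := by
  have hx : ∀ (j : Fin n) (v : (PolarRing h)[X]),
      diffOp h g (polyC h (MvPolynomial.X j) * v) =
        polyC h (MvPolynomial.X j) * diffOp h g v + diffOp h (MvPolynomial.pderiv j g) v := by
    intro j v
    have := commAeval_commutator _ (twistedPartial_comm h)
      (LinearMap.mulLeft ℂ (polyC h (MvPolynomial.X j))) j 1 (by
        intro i v
        rw [LinearMap.mulLeft_apply, LinearMap.mulLeft_apply, one_smul]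
        exact twistedPartial_polyC_X_mul h i j v) g v
    rwa [one_smul] at this
  -- Moving `g(∂)` to the left past `xᵢ` costs the commutator `(∂ᵢg)(∂)`. After composition with
  -- `∂ᵢ` and summation, Euler's formula turns the total cost into `d g(∂)`.
  have h1 : ∀ i, polyC h (MvPolynomial.X i) * twistedPartial h i (diffOp h g u) =
      diffOp h g (polyC h (MvPolynomial.X i) * twistedPartial h i u) -
        diffOp h (MvPolynomial.X i * MvPolynomial.pderiv i g) u := by
    intro i
    have h2 : twistedPartial h i (diffOp h g u) = diffOp h g (twistedPartial h i u) := by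
      rw [← diffOp_X, ← Module.End.mul_apply, ← Module.End.mul_apply, ← map_mul, ← map_mul,
        mul_comm]
    rw [hx, h2, mul_comm (MvPolynomial.X i), map_mul, diffOp_X, Module.End.mul_apply,
      add_sub_cancel_right]
  rw [Finset.sum_congr rfl fun i _ => h1 i, Finset.sum_sub_distrib, ← map_sum, hu,
    diffOp_scalarPoly_mul, ← LinearMap.sum_apply, ← map_sum, hg.sum_X_mul_pderiv, scalarPoly,
    scalarPoly, Polynomial.map_sub, map_C, map_nsmul, LinearMap.smul_apply, sub_mul, map_natCast,
    nsmul_eq_mul, map_natCast]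

end TwistedDerivation

end LogBrieskorn

end

noncomputable section

namespace LogBrieskorn

open Polynomial

section Capelli

variable {n : ℕ} (h : MvPolynomial (Fin n) ℂ)

/-! ### Capelli identities and the functionals attached to them -/

/-- The substitution `s ↦ s - 1`. -/
def shiftS : (PolarRing h)[X] →ₐ[ℂ] (PolarRing h)[X] :=
  (Polynomial.aeval (R := PolarRing h) (Polynomial.X - 1 : (PolarRing h)[X])).restrictScalars ℂ

theorem shiftS_C (r : PolarRing h) : shiftS h (C r) = C r :=
  Polynomial.aeval_C (R := PolarRing h) _ r

theorem shiftS_X : shiftS h Polynomial.X = Polynomial.X - 1 :=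
  Polynomial.aeval_X (R := PolarRing h) _

theorem coeffDeriv_shiftS (i : Fin n) (u : (PolarRing h)[X]) :
    coeffDeriv h i (shiftS h u) = shiftS h (coeffDeriv h i u) := by
  induction u using Polynomial.induction_on' with
  | add p q hp hq => simp only [map_add, hp, hq]
  | monomial k r =>
    rw [coeffDeriv_monomial, ← C_mul_X_pow_eq_monomial, ← C_mul_X_pow_eq_monomial,
      map_mul (shiftS h), map_mul (shiftS h), map_pow, shiftS_C, shiftS_C, shiftS_X, Derivation.leibniz, coeffDeriv_C, Derivation.leibniz_pow,
      map_sub, coeffDeriv_X, Derivation.map_one_eq_zero, sub_zero, smul_zero, smul_zero, smul_zero,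
      zero_add, smul_eq_mul, mul_comm]

/-- The map is the substitution `s ↦ s - 1` in the symbol `u hˢ`. It does not involve the
coordinates, so it commutes with differentiation. -/
theorem twistedPartial_invSelf_shiftS (i : Fin n) (u : (PolarRing h)[X]) :
    twistedPartial h i (C (IsLocalization.Away.invSelf h) * shiftS h u) =
      C (IsLocalization.Away.invSelf h) * shiftS h (twistedPartial h i u) := by
  rw [twistedPartial_C_mul, twistedPartial_eq, twistedPartial_eq, coeffDeriv_shiftS, map_add,
    map_mul, map_mul, shiftS_X, shiftS_C, polarDeriv_invSelf, map_neg, map_mul]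
  ring

/-- Multiplication by `h` shifts `s`: here `u hˢ` becomes `u(s-1) h⁻¹ hˢ`. -/
def shiftInv : (PolarRing h)[X] →ₗ[ℂ] (PolarRing h)[X] :=
  LinearMap.mulLeft ℂ (C (IsLocalization.Away.invSelf h)) ∘ₗ (shiftS h).toLinearMap

theorem shiftInv_apply (u : (PolarRing h)[X]) :
    shiftInv h u = C (IsLocalization.Away.invSelf h) * shiftS h u := rfl

theorem shiftInv_polyC : shiftInv h (polyC h h) = 1 := by
  rw [shiftInv_apply, polyC, shiftS_C, ← C_mul, mul_comm, algebraMap_mul_invSelf, C_1]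

variable {h}

/-- The identities `(∂ⱼh)(∂) hˢ⁺¹ = c(s) xⱼ hˢ`, for `h` homogeneous of degree `n`. -/
structure IsCapelli (h : MvPolynomial (Fin n) ℂ) (c : ℂ[X]) : Prop where
  pos : 0 < n
  homogeneous : h.IsHomogeneous n
  degree : c.natDegree + 1 = n
  ne_zero : c ≠ 0
  capelli : ∀ j, diffOp h (MvPolynomial.pderiv j h) (polyC h h) =
    scalarPoly h c * polyC h (MvPolynomial.X j)

theorem scalarPoly_mul (p q : ℂ[X]) : scalarPoly h (p * q) = scalarPoly h p * scalarPoly h q :=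
  Polynomial.map_mul _

/-- The symbol `hˢ` is homogeneous of degree `n s`. -/
theorem euler_one (hh : h.IsHomogeneous n) :
    ∑ i, polyC h (MvPolynomial.X i) * twistedPartial h i 1 =
      scalarPoly h ((n : ℂ[X]) * Polynomial.X) * 1 := by
  have h1 : ∀ i : Fin n, polyC h (MvPolynomial.X i) * twistedPartial h i 1 =
      Polynomial.X * C (IsLocalization.Away.invSelf h *
        algebraMap _ (PolarRing h) (MvPolynomial.X i * MvPolynomial.pderiv i h)) := by
    intro i
    rw [twistedPartial_eq, Derivation.map_one_eq_zero, zero_add, polyC, logDeriv, C_mul, C_mul,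
      map_mul (algebraMap _ (PolarRing h)), C_mul]
    ring
  rw [Finset.sum_congr rfl fun i _ => h1 i, ← Finset.mul_sum, ← map_sum C, ← Finset.mul_sum,
    ← map_sum, hh.sum_X_mul_pderiv, map_nsmul, nsmul_eq_mul, mul_left_comm,
    mul_comm (IsLocalization.Away.invSelf h : PolarRing h), algebraMap_mul_invSelf, mul_one, mul_one,
    scalarPoly, Polynomial.map_mul, Polynomial.map_X, Polynomial.map_natCast, map_natCast, mul_comm]

variable {c : ℂ[X]}

/-- By Euler's formula `n h(∂) = ∑ ∂ⱼ (∂ⱼh)(∂)`, so the Capelli identities reduce the left side to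
`c(s) ∑ ∂ⱼ(xⱼ hˢ)`. The Euler operator makes this sum `(n s + n) hˢ`, which is the origin of the
factor `s + 1`. -/
theorem IsCapelli.diffOp_self (H : IsCapelli h c) :
    diffOp h h (polyC h h) = scalarPoly h (c * (Polynomial.X + 1)) := by
  have hn : (n : ℂ) ≠ 0 := Nat.cast_ne_zero.2 H.pos.ne'
  have h1 : (n : ℂ) • diffOp h h (polyC h h) =
      (n : ℂ) • scalarPoly h (c * (Polynomial.X + 1)) := by
    have e := congrArg (fun g => diffOp h g (polyC h h)) H.homogeneous.sum_X_mul_pderiv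
    simp only [map_sum, LinearMap.sum_apply, map_mul, diffOp_X, Module.End.mul_apply, H.capelli,
      twistedPartial_scalarPoly_mul, map_nsmul, LinearMap.smul_apply] at e
    rw [Nat.cast_smul_eq_nsmul, ← e, ← Finset.mul_sum]
    have h2 : ∀ i : Fin n, twistedPartial h i (polyC h (MvPolynomial.X i)) =
        polyC h (MvPolynomial.X i) * twistedPartial h i 1 + 1 := by
      intro i
      have := twistedPartial_polyC_X_mul h i i 1
      rwa [mul_one, if_pos rfl] at this
    rw [Finset.sum_congr rfl fun i _ => h2 i, Finset.sum_add_distrib, euler_one H.homogeneous,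
      Finset.sum_const, Finset.card_univ, Fintype.card_fin, scalarPoly_mul]
    simp only [scalarPoly, Polynomial.map_mul, Polynomial.map_X, Polynomial.map_natCast,
      Polynomial.map_add, Polynomial.map_one, nsmul_eq_mul, Nat.cast_smul_eq_nsmul]
    ring
  exact smul_right_injective _ hn h1

/-- This is the previous functional equation after the substitution `s ↦ s - 1`. -/
theorem IsCapelli.diffOp_one (H : IsCapelli h c) :
    diffOp h h 1 = shiftInv h (scalarPoly h (c * (Polynomial.X + 1))) := by
  rw [← H.diffOp_self, diffOp, commAeval_intertwine _ (twistedPartial_comm h) _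
    (twistedPartial_comm h) (shiftInv h) (fun i v => (twistedPartial_invSelf_shiftS h i v).symm),
    shiftInv_polyC]

theorem twistedPartial_smul_comm (z : ℂ) (i j : Fin n) :
    (z • twistedPartial h i) * (z • twistedPartial h j) =
      (z • twistedPartial h j) * (z • twistedPartial h i) := by
  rw [smul_mul_smul_comm, smul_mul_smul_comm, twistedPartial_comm]

/-- The operator `g(z∂)` on `𝒪_V(*D)[s] hˢ`. -/
def scaledDiffOp (h : MvPolynomial (Fin n) ℂ) (z : ℂ) :
    MvPolynomial (Fin n) ℂ →ₐ[ℂ] Module.End ℂ (PolarRing h)[X] :=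
  commAeval (fun i => z • twistedPartial h i) (twistedPartial_smul_comm z)

theorem scaledDiffOp_of_isHomogeneous (z : ℂ) {g : MvPolynomial (Fin n) ℂ} {d : ℕ}
    (hg : g.IsHomogeneous d) : scaledDiffOp h z g = z ^ d • diffOp h g :=
  commAeval_smul_of_isHomogeneous _ _ _ _ hg

theorem scaledDiffOp_shiftInv (z : ℂ) (g : MvPolynomial (Fin n) ℂ) (u : (PolarRing h)[X]) :
    scaledDiffOp h z g (shiftInv h u) = shiftInv h (scaledDiffOp h z g u) := by
  refine (commAeval_intertwine _ (twistedPartial_smul_comm z) _ (twistedPartial_smul_comm z)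
    (shiftInv h) (fun i v => ?_) g u).symm
  rw [LinearMap.smul_apply, LinearMap.smul_apply, map_smul]
  exact congrArg _ (twistedPartial_invSelf_shiftS h i v).symm

theorem scaledDiffOp_scalarPoly_mul (z : ℂ) (g : MvPolynomial (Fin n) ℂ) (p : ℂ[X])
    (u : (PolarRing h)[X]) :
    scaledDiffOp h z g (scalarPoly h p * u) = scalarPoly h p * scaledDiffOp h z g u := by
  refine (commAeval_intertwine _ (twistedPartial_smul_comm z) _ (twistedPartial_smul_comm z)
    (LinearMap.mulLeft ℂ (scalarPoly h p)) (fun i v => ?_) g u).symm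
  rw [LinearMap.mulLeft_apply, LinearMap.mulLeft_apply, LinearMap.smul_apply, LinearMap.smul_apply,
    twistedPartial_scalarPoly_mul, mul_smul_comm]

theorem scaledDiffOp_X_mul (z : ℂ) (g : MvPolynomial (Fin n) ℂ) (j : Fin n)
    (v : (PolarRing h)[X]) :
    scaledDiffOp h z g (polyC h (MvPolynomial.X j) * v) =
      polyC h (MvPolynomial.X j) * scaledDiffOp h z g v +
        z • scaledDiffOp h z (MvPolynomial.pderiv j g) v := by
  refine commAeval_commutator _ (twistedPartial_smul_comm z)
    (LinearMap.mulLeft ℂ (polyC h (MvPolynomial.X j))) j z (fun i v => ?_) g v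
  rw [LinearMap.mulLeft_apply, LinearMap.mulLeft_apply, LinearMap.smul_apply, LinearMap.smul_apply,
    twistedPartial_polyC_X_mul, smul_add, mul_smul_comm]
  congr 1
  split_ifs
  · rfl
  · rw [smul_zero]

variable {a : Fin n → ℂ}

/-- Evaluation of rational functions at a point outside of `D`. -/
def evalPolar (h : MvPolynomial (Fin n) ℂ) (a : Fin n → ℂ) (ha : MvPolynomial.eval a h ≠ 0) :
    PolarRing h →ₐ[ℂ] ℂ :=
  IsLocalization.liftAlgHom (M := Submonoid.powers h) (f := MvPolynomial.aeval a) (by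
    rintro ⟨_, k, rfl⟩
    rw [map_pow, MvPolynomial.aeval_eq_eval]
    exact (IsUnit.mk0 _ ha).pow k)

variable (ha : MvPolynomial.eval a h ≠ 0)

theorem evalPolar_algebraMap (g : MvPolynomial (Fin n) ℂ) :
    evalPolar h a ha (algebraMap _ _ g) = MvPolynomial.eval a g := by
  simp [evalPolar]

theorem evalPolar_invSelf :
    evalPolar h a ha (IsLocalization.Away.invSelf h) = (MvPolynomial.eval a h)⁻¹ := by
  have := congrArg (evalPolar h a ha) (algebraMap_mul_invSelf h)
  rw [map_mul, evalPolar_algebraMap, map_one] at this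
  exact eq_inv_of_mul_eq_one_right this

theorem map_evalPolar_scalarPoly (p : ℂ[X]) :
    Polynomial.mapAlgHom (evalPolar h a ha) (scalarPoly h p) = p := by
  rw [coe_mapAlgHom, scalarPoly, Polynomial.map_map]
  convert Polynomial.map_id
  ext z
  simp

theorem map_evalPolar_polyC (g : MvPolynomial (Fin n) ℂ) :
    Polynomial.mapAlgHom (evalPolar h a ha) (polyC h g) = C (MvPolynomial.eval a g) := by
  rw [coe_mapAlgHom, polyC, Polynomial.map_C]
  exact congrArg C (evalPolar_algebraMap ha g)

theorem map_evalPolar_shiftInv (u : (PolarRing h)[X]) :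
    Polynomial.mapAlgHom (evalPolar h a ha) (shiftInv h u) =
      C (MvPolynomial.eval a h)⁻¹ *
        (Polynomial.mapAlgHom (evalPolar h a ha) u).comp (Polynomial.X - 1) := by
  rw [shiftInv_apply, map_mul]
  congr 1
  · rw [coe_mapAlgHom, Polynomial.map_C]
    exact congrArg C (evalPolar_invSelf ha)
  · rw [coe_mapAlgHom]
    change ((u.comp (Polynomial.X - 1)).map _) = _
    rw [Polynomial.map_comp, Polynomial.map_sub, Polynomial.map_X, Polynomial.map_one]

/-- The value at the point `a` of `h⁻ˢ g(-z∂) hˢ`: algebraically, the quotient of the oscillating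
integrals of `g h⁻ˢ⁻¹` and `h⁻ˢ⁻¹` with phase `-f/z`, where `f` is the linear form with
coefficients `a`. -/
def capelliPhi (z : ℂ) : MvPolynomial (Fin n) ℂ →ₗ[ℂ] ℂ[X] :=
  (Polynomial.mapAlgHom (evalPolar h a ha)).toLinearMap ∘ₗ
    LinearMap.applyₗ (1 : (PolarRing h)[X]) ∘ₗ (scaledDiffOp h (-z)).toLinearMap

theorem capelliPhi_apply (z : ℂ) (g : MvPolynomial (Fin n) ℂ) :
    capelliPhi ha z g = Polynomial.mapAlgHom (evalPolar h a ha) (scaledDiffOp h (-z) g 1) := rfl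

theorem capelliPhi_one (z : ℂ) : capelliPhi ha z 1 = 1 := by
  rw [capelliPhi_apply, map_one (scaledDiffOp h (-z)), Module.End.one_apply, map_one]

/-- Substituting `-z∂` in the linear form gives `-z ∑ aᵢ∂ᵢ`, which agrees at the point `a` with `-z`
times the Euler operator. The function `g(∂)hˢ` is homogeneous of degree `n s - d`. -/
theorem capelliPhi_linearForm_mul (hh : h.IsHomogeneous n) (z : ℂ)
    {g : MvPolynomial (Fin n) ℂ} {d : ℕ} (hg : g.IsHomogeneous d) :
    capelliPhi ha z (linearForm a * g) =
      C (-z) * ((C (n : ℂ) * Polynomial.X - C (d : ℂ)) * capelliPhi ha z g) := by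
  have h1 : scaledDiffOp h (-z) (linearForm a * g) 1 =
      ∑ i, a i • ((-z) • twistedPartial h i (scaledDiffOp h (-z) g 1)) := by
    rw [map_mul, linearForm, map_sum, Module.End.mul_apply, LinearMap.sum_apply]
    refine Finset.sum_congr rfl fun i _ => ?_
    rw [scaledDiffOp, map_mul, Module.End.mul_apply, commAeval_X, commAeval_C_apply,
      LinearMap.smul_apply]
  have h2 := congrArg (Polynomial.mapAlgHom (evalPolar h a ha)) (euler_diffOp h (euler_one hh) hg)
  rw [map_sum, map_mul, map_evalPolar_scalarPoly] at h2
  simp only [map_mul, map_evalPolar_polyC, MvPolynomial.eval_X] at h2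
  rw [capelliPhi_apply, capelliPhi_apply, h1, scaledDiffOp_of_isHomogeneous (-z) hg, map_sum]
  simp only [LinearMap.smul_apply, map_smul, Polynomial.smul_eq_C_mul] at h2 ⊢
  have h3 : ((n : ℂ[X])) = C (n : ℂ) := (map_natCast C n).symm
  rw [h3] at h2
  rw [← mul_left_comm (C ((-z) ^ d)), ← mul_left_comm (C ((-z) ^ d)), ← h2, Finset.mul_sum,
    Finset.mul_sum]
  refine Finset.sum_congr rfl fun i _ => ?_
  ring

/-- Apply `h(-z∂)` first: it sends `hˢ` to `(-z)ⁿ b(s - 1) hˢ⁻¹` with `b = c · (s + 1)`. The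
operator `g(-z∂)` commutes with the shift, and evaluation at `a` turns the remaining `h⁻¹` into a
constant. -/
theorem capelliPhi_mul (H : IsCapelli h c) (z : ℂ) (g : MvPolynomial (Fin n) ℂ) :
    capelliPhi ha z (h * g) = C ((-z) ^ n * (MvPolynomial.eval a h)⁻¹) *
      ((c * (Polynomial.X + 1)) * capelliPhi ha z g).comp (Polynomial.X - 1) := by
  rw [capelliPhi_apply, mul_comm h g, map_mul, Module.End.mul_apply,
    scaledDiffOp_of_isHomogeneous (-z) H.homogeneous, LinearMap.smul_apply, H.diffOp_one, map_smul,
    map_smul, scaledDiffOp_shiftInv, map_evalPolar_shiftInv]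
  have := scaledDiffOp_scalarPoly_mul (h := h) (-z) g (c * (Polynomial.X + 1)) 1
  rw [mul_one] at this
  rw [this, map_mul, map_evalPolar_scalarPoly, ← capelliPhi_apply, Polynomial.smul_eq_C_mul, C_mul]
  ring

theorem isDomain_polarRing (hh : h ≠ 0) : IsDomain (PolarRing h) :=
  IsLocalization.Away.isDomain (S := PolarRing h) hh

/-- This is integration by parts for the oscillating integral, along fields tangent to the fibres of
`h`. The Capelli identities convert the polynomial relation `∑ ξⱼ ∂ⱼh = 0` into the vanishing of `∑
ξⱼ(-z∂)(xⱼ hˢ)`. -/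
theorem capelliPhi_divergence (H : IsCapelli h c) {z : ℂ} (hz : z ≠ 0)
    (ξ : Fin n → MvPolynomial (Fin n) ℂ) (hξ : ∑ j, ξ j * MvPolynomial.pderiv j h = 0) :
    capelliPhi ha z (∑ j, (MvPolynomial.C z * MvPolynomial.pderiv j (ξ j) -
      MvPolynomial.C (a j) * ξ j)) = 0 := by
  have hh : h ≠ 0 := by
    rintro rfl
    simp at ha
  have := isDomain_polarRing hh
  set W : (PolarRing h)[X] := ∑ j, scaledDiffOp h (-z) (ξ j) (polyC h (MvPolynomial.X j)) with hW
  have hcap : ∀ j, scaledDiffOp h (-z) (MvPolynomial.pderiv j h) (polyC h h) =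
      (-z) ^ (n - 1) • (scalarPoly h c * polyC h (MvPolynomial.X j)) := by
    intro j
    rw [scaledDiffOp_of_isHomogeneous (-z) H.homogeneous.pderiv, LinearMap.smul_apply, H.capelli]
  -- Substitute `-z∂` in `∑ ξⱼ ∂ⱼh = 0` and apply the result to `hˢ⁺¹`. The factor `c(s)` that
  -- appears may be cancelled, since the ring is a domain.
  have hW0 : (-z) ^ (n - 1) • (scalarPoly h c * W) = 0 := by
    have h1 := congrArg (fun g => scaledDiffOp h (-z) g (polyC h h)) hξ
    simp only [map_sum, LinearMap.sum_apply, map_mul, Module.End.mul_apply, hcap, map_zero,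
      LinearMap.zero_apply, map_smul, scaledDiffOp_scalarPoly_mul] at h1
    rw [hW, Finset.mul_sum, Finset.smul_sum]
    exact h1
  have hc : scalarPoly h c ≠ 0 := by
    rw [scalarPoly, Ne, Polynomial.map_eq_zero_iff (algebraMap ℂ (PolarRing h)).injective]
    exact H.ne_zero
  have hW1 : W = 0 := by
    rcases smul_eq_zero.1 hW0 with h1 | h1
    · exact absurd h1 (pow_ne_zero _ (neg_ne_zero.2 hz))
    · exact (mul_eq_zero.1 h1).resolve_left hc
  -- Moving `xⱼ` out of `ξⱼ(-z∂)` creates the divergence term, and evaluation at `a` replaces `xⱼ`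
  -- by `aⱼ`.
  have h3 : ∀ j, scaledDiffOp h (-z) (ξ j) (polyC h (MvPolynomial.X j)) =
      polyC h (MvPolynomial.X j) * scaledDiffOp h (-z) (ξ j) 1 -
        z • scaledDiffOp h (-z) (MvPolynomial.pderiv j (ξ j)) 1 := by
    intro j
    have := scaledDiffOp_X_mul (h := h) (-z) (ξ j) j 1
    rw [mul_one] at this
    rw [this, neg_smul, sub_eq_add_neg]
  have h4 := congrArg (Polynomial.mapAlgHom (evalPolar h a ha)) hW1
  rw [hW, Finset.sum_congr rfl fun j _ => h3 j, map_sum, map_zero] at h4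
  simp only [map_sub, map_mul, map_evalPolar_polyC, MvPolynomial.eval_X, map_smul,
    ← capelliPhi_apply] at h4
  rw [map_sum, ← neg_eq_zero, ← Finset.sum_neg_distrib, ← h4]
  refine Finset.sum_congr rfl fun j _ => ?_
  rw [map_sub, ← MvPolynomial.smul_eq_C_mul, ← MvPolynomial.smul_eq_C_mul, map_smul, map_smul,
    neg_sub, Polynomial.smul_eq_C_mul]

end Capelli

end LogBrieskorn

end

noncomputable section

namespace LogBrieskorn

open Polynomial

section BernsteinPolynomial

variable {n : ℕ} {h : MvPolynomial (Fin n) ℂ}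

/-! ### The Bernstein polynomial from a Capelli identity -/

theorem pderiv_end_comm (i j : Fin n) :
    ((MvPolynomial.pderiv i : Derivation ℂ (MvPolynomial (Fin n) ℂ) _) :
        Module.End ℂ (MvPolynomial (Fin n) ℂ)) * (MvPolynomial.pderiv j).toLinearMap =
      (MvPolynomial.pderiv j).toLinearMap * (MvPolynomial.pderiv i).toLinearMap :=
  LinearMap.ext fun g => pderiv_comm i j g

/-- The constant coefficient differential operator `p(∂)` on polynomials. -/
def constDiffOp : MvPolynomial (Fin n) ℂ →ₐ[ℂ] Module.End ℂ (MvPolynomial (Fin n) ℂ) :=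
  commAeval (fun i => (MvPolynomial.pderiv i).toLinearMap) pderiv_end_comm

/-- The apolar pairing `⟨p, q⟩ = (p(∂) q)(0)` on polynomials. -/
def apolar : MvPolynomial (Fin n) ℂ →ₗ[ℂ] MvPolynomial (Fin n) ℂ →ₗ[ℂ] ℂ :=
  LinearMap.mk₂ ℂ (fun p q => MvPolynomial.aeval (0 : Fin n → ℂ) (constDiffOp p q))
    (fun p p' q => by rw [map_add, LinearMap.add_apply, map_add])
    (fun z p q => by rw [map_smul, LinearMap.smul_apply, map_smul])
    (fun p q q' => by rw [map_add, map_add])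
    (fun z p q => by rw [map_smul, map_smul])

theorem apolar_apply (p q : MvPolynomial (Fin n) ℂ) :
    apolar p q = MvPolynomial.aeval (0 : Fin n → ℂ) (constDiffOp p q) :=
  LinearMap.mk₂_apply _ _ _ _

theorem apolar_mul_X (i : Fin n) (p q : MvPolynomial (Fin n) ℂ) :
    apolar (p * MvPolynomial.X i) q = apolar p (MvPolynomial.pderiv i q) := by
  rw [apolar_apply, apolar_apply, constDiffOp, commAeval_mul_X_apply]
  rfl

theorem apolar_pderiv (i : Fin n) (p q : MvPolynomial (Fin n) ℂ) :
    apolar (MvPolynomial.pderiv i p) q = apolar p (MvPolynomial.X i * q) := by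
  have hx : ∀ (j : Fin n) (v : MvPolynomial (Fin n) ℂ),
      MvPolynomial.pderiv j (MvPolynomial.X i * v) =
        MvPolynomial.X i * MvPolynomial.pderiv j v + if j = i then (1 : ℂ) • v else 0 := by
    intro j v
    rw [Derivation.leibniz, MvPolynomial.pderiv_X, smul_eq_mul, smul_eq_mul, one_smul]
    congr 1
    by_cases hij : j = i
    · subst hij
      rw [Pi.single_eq_same, if_pos rfl, mul_one]
    · rw [Pi.single_eq_of_ne (Ne.symm hij), if_neg hij, mul_zero]
  have := commAeval_commutator (fun i : Fin n => (MvPolynomial.pderiv i).toLinearMap)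
    pderiv_end_comm (LinearMap.mulLeft ℂ (MvPolynomial.X i)) i 1 hx p q
  rw [LinearMap.mulLeft_apply, one_smul] at this
  rw [apolar_apply, apolar_apply, constDiffOp, this, LinearMap.mulLeft_apply, map_add, map_mul,
    MvPolynomial.aeval_X, Pi.zero_apply, zero_mul, zero_add]

theorem apolar_constDiffOp (g p q : MvPolynomial (Fin n) ℂ) :
    apolar (constDiffOp g p) q = apolar p (g * q) := by
  induction g using MvPolynomial.induction_on generalizing p with
  | C z =>
    rw [constDiffOp, commAeval_C_apply, map_smul, LinearMap.smul_apply, ← MvPolynomial.smul_eq_C_mul,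
      map_smul]
  | add g g' hg hg' =>
    rw [map_add, LinearMap.add_apply, map_add, LinearMap.add_apply, hg, hg', add_mul, map_add]
  | mul_X g i hg =>
    rw [constDiffOp, commAeval_mul_X_apply, ← constDiffOp, hg]
    change apolar (MvPolynomial.pderiv i p) _ = _
    rw [apolar_pderiv]
    congr 1
    ring

/-- The specialization `u(s) hˢ ↦ u(m) hᵐ`. -/
def specialize (h : MvPolynomial (Fin n) ℂ) (m : ℕ) : (PolarRing h)[X] →ₗ[ℂ] PolarRing h :=
  LinearMap.mulLeft ℂ (algebraMap _ (PolarRing h) h ^ m) ∘ₗ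
    ((Polynomial.aeval (R := PolarRing h) (m : PolarRing h)).restrictScalars ℂ).toLinearMap

theorem specialize_apply (m : ℕ) (u : (PolarRing h)[X]) :
    specialize h m u = algebraMap _ (PolarRing h) h ^ m * u.eval (m : PolarRing h) := by
  change _ * Polynomial.aeval (R := PolarRing h) (m : PolarRing h) u = _
  rw [Polynomial.coe_aeval_eq_eval]

/-- At `s = m` the symbol `hˢ` becomes an actual power of `h`, and the twisted derivative becomes
the ordinary one by the Leibniz rule. -/
theorem specialize_twistedPartial (m : ℕ) (i : Fin n) (u : (PolarRing h)[X]) :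
    specialize h m (twistedPartial h i u) = polarDeriv h i (specialize h m u) := by
  have h1 : (coeffDeriv h i u).eval (m : PolarRing h) =
      polarDeriv h i (u.eval (m : PolarRing h)) := by
    induction u using Polynomial.induction_on' with
    | add p q hp hq => simp only [map_add, eval_add, hp, hq]
    | monomial k r =>
      rw [coeffDeriv_monomial, eval_monomial, eval_monomial, Derivation.leibniz, ← Nat.cast_pow,
        Derivation.map_natCast, smul_zero, zero_add, smul_eq_mul, mul_comm]
  have h2 : polarDeriv h i (algebraMap _ (PolarRing h) h ^ m) =
      algebraMap _ (PolarRing h) h ^ m * (m * logDeriv h i) := by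
    rw [Derivation.leibniz_pow, polarDeriv_algebraMap, smul_eq_mul, nsmul_eq_mul, logDeriv]
    cases m with
    | zero => simp
    | succ m =>
      rw [Nat.add_sub_cancel, pow_succ]
      linear_combination -((m + 1 : ℕ) : PolarRing h) * algebraMap _ (PolarRing h) h ^ m *
        algebraMap _ (PolarRing h) (MvPolynomial.pderiv i h) * algebraMap_mul_invSelf h
  rw [specialize_apply, specialize_apply, twistedPartial_eq, eval_add, h1, eval_mul, eval_mul, eval_X,
    eval_C, Derivation.leibniz, h2, smul_eq_mul, smul_eq_mul]
  ring

theorem specialize_C_mul (m : ℕ) (r : PolarRing h) (u : (PolarRing h)[X]) :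
    specialize h m (C r * u) = r * specialize h m u := by
  rw [specialize_apply, specialize_apply, eval_mul, eval_C]
  ring

theorem specialize_X_mul (m : ℕ) (u : (PolarRing h)[X]) :
    specialize h m (Polynomial.X * u) = (m : ℂ) • specialize h m u := by
  rw [specialize_apply, specialize_apply, eval_mul, eval_X, Nat.cast_smul_eq_nsmul, nsmul_eq_mul]
  ring

theorem specialize_scalarPoly (m : ℕ) (p : ℂ[X]) :
    specialize h m (scalarPoly h p) =
      algebraMap _ (PolarRing h) (MvPolynomial.C (p.eval (m : ℂ)) * h ^ m) := by
  rw [specialize_apply, scalarPoly, map_mul, algebraMap_C, mul_comm, map_pow]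
  congr 1
  rw [show (m : PolarRing h) = algebraMap ℂ (PolarRing h) m by simp, eval_map_algebraMap,
    aeval_algebraMap_apply, coe_aeval_eq_eval]

theorem algebraMap_polarRing_injective (hh : h ≠ 0) :
    Function.Injective (algebraMap (MvPolynomial (Fin n) ℂ) (PolarRing h)) :=
  IsLocalization.injective _ (powers_le_nonZeroDivisors_of_noZeroDivisors hh)

/-- `Q` is adjoint to `P` for the apolar pairing, whenever `s` is specialized to a natural number. -/
def IsApolarAdjoint (h : MvPolynomial (Fin n) ℂ) (P Q : Module.End ℂ (PolarRing h)[X]) : Prop :=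
  ∀ (m : ℕ) (u v : (PolarRing h)[X]) (p q : MvPolynomial (Fin n) ℂ),
    algebraMap _ _ p = specialize h m u → algebraMap _ _ q = specialize h m v →
    ∃ p' q', algebraMap _ _ p' = specialize h m (P u) ∧ algebraMap _ _ q' = specialize h m (Q v) ∧
      apolar p' q = apolar p q'

/-- On generators, `xᵢ` and `∂ᵢ` are exchanged and `s` is its own adjoint; products reverse the
order. The definition also carries the existence of polynomial representatives, since the pairing
makes sense only for polynomials. -/
theorem exists_isApolarAdjoint (hh : h ≠ 0) {P : Module.End ℂ (PolarRing h)[X]}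
    (hP : P ∈ diffOperators h) : ∃ Q, IsApolarAdjoint h P Q := by
  induction hP using Algebra.adjoin_induction with
  | mem P hP =>
    rcases hP with (⟨i, rfl⟩ | ⟨i, rfl⟩) | hP
    · refine ⟨twistedPartial h i, fun m u v p q hp hq =>
        ⟨p * MvPolynomial.X i, MvPolynomial.pderiv i q, ?_, ?_, apolar_mul_X i p q⟩⟩
      · rw [LinearMap.mulLeft_apply, specialize_C_mul, map_mul, hp, mul_comm]
      · rw [specialize_twistedPartial, ← hq, polarDeriv_algebraMap]
    · refine ⟨LinearMap.mulLeft ℂ (polyC h (MvPolynomial.X i)), fun m u v p q hp hq =>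
        ⟨MvPolynomial.pderiv i p, MvPolynomial.X i * q, ?_, ?_, apolar_pderiv i p q⟩⟩
      · rw [specialize_twistedPartial, ← hp, polarDeriv_algebraMap]
      · rw [LinearMap.mulLeft_apply, polyC, specialize_C_mul, map_mul, hq]
    · rw [Set.mem_singleton_iff] at hP
      subst hP
      refine ⟨LinearMap.mulLeft ℂ Polynomial.X, fun m u v p q hp hq =>
        ⟨MvPolynomial.C (m : ℂ) * p, MvPolynomial.C (m : ℂ) * q, ?_, ?_, ?_⟩⟩
      · rw [LinearMap.mulLeft_apply, specialize_X_mul, map_mul, hp, algebraMap_C, Algebra.smul_def]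
      · rw [LinearMap.mulLeft_apply, specialize_X_mul, map_mul, hq, algebraMap_C, Algebra.smul_def]
      · rw [← MvPolynomial.smul_eq_C_mul, ← MvPolynomial.smul_eq_C_mul, map_smul, map_smul,
          LinearMap.smul_apply]
  | algebraMap z =>
    refine ⟨algebraMap ℂ _ z, fun m u v p q hp hq =>
        ⟨MvPolynomial.C z * p, MvPolynomial.C z * q, ?_, ?_, ?_⟩⟩
    · rw [Module.algebraMap_end_apply, map_smul, map_mul, hp, algebraMap_C, Algebra.smul_def]
    · rw [Module.algebraMap_end_apply, map_smul, map_mul, hq, algebraMap_C, Algebra.smul_def]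
    · rw [← MvPolynomial.smul_eq_C_mul, ← MvPolynomial.smul_eq_C_mul, map_smul, map_smul,
        LinearMap.smul_apply]
  | add P P' _ _ hP hP' =>
    obtain ⟨Q, hQ⟩ := hP
    obtain ⟨Q', hQ'⟩ := hP'
    refine ⟨Q + Q', fun m u v p q hp hq => ?_⟩
    obtain ⟨p₁, q₁, h1, h2, h3⟩ := hQ m u v p q hp hq
    obtain ⟨p₂, q₂, h4, h5, h6⟩ := hQ' m u v p q hp hq
    refine ⟨p₁ + p₂, q₁ + q₂, ?_, ?_, ?_⟩
    · rw [LinearMap.add_apply, map_add, map_add, h1, h4]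
    · rw [LinearMap.add_apply, map_add, map_add, h2, h5]
    · rw [map_add, map_add, LinearMap.add_apply, h3, h6]
  | mul P P' _ _ hP hP' =>
    obtain ⟨Q, hQ⟩ := hP
    obtain ⟨Q', hQ'⟩ := hP'
    refine ⟨Q' * Q, fun m u v p q hp hq => ?_⟩
    have hinj := algebraMap_polarRing_injective hh
    obtain ⟨p₁, -, h1, -, -⟩ := hQ' m u v p q hp hq
    obtain ⟨p₂, q₂, h4, h5, h6⟩ := hQ m (P' u) v p₁ q h1 hq
    obtain ⟨p₃, q₃, h7, h8, h9⟩ := hQ' m u (Q v) p q₂ hp h5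
    refine ⟨p₂, q₃, h4, h8, ?_⟩
    -- The two representatives of `P' u` produced by the induction hypothesis agree because
    -- polynomials embed in the localization.
    rw [h6, ← h9, hinj (h1.trans h7.symm)]

/-- The identity with formal `s` is specialized at `s = m`. Both sides are then compared inside the
localization, where polynomials embed. -/
theorem constDiffOp_pow {b : ℂ[X]} (hh : h ≠ 0)
    (hb : diffOp h h (polyC h h) = scalarPoly h b) (m : ℕ) :
    constDiffOp h (h ^ (m + 1)) = MvPolynomial.C (b.eval (m : ℂ)) * h ^ m := by
  apply algebraMap_polarRing_injective hh
  have hcomm : ∀ i j : Fin n, ((polarDeriv h i).toLinearMap : Module.End ℂ (PolarRing h)) *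
      (polarDeriv h j).toLinearMap = (polarDeriv h j).toLinearMap * (polarDeriv h i).toLinearMap :=
    fun i j => LinearMap.ext fun x => polarDeriv_comm h i j x
  have h1 := commAeval_intertwine _ (twistedPartial_comm h) _ hcomm (specialize h m)
    (fun i v => specialize_twistedPartial m i v) h (polyC h h)
  have h2 := commAeval_intertwine _ pderiv_end_comm _ hcomm
    (IsScalarTower.toAlgHom ℂ (MvPolynomial (Fin n) ℂ) (PolarRing h)).toLinearMap
    (fun i v => (polarDeriv_algebraMap h i v).symm) h (h ^ (m + 1))
  have h3 : specialize h m (polyC h h) = algebraMap _ (PolarRing h) (h ^ (m + 1)) := by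
    rw [specialize_apply, polyC, eval_C, map_pow, pow_succ]
  rw [h3] at h1
  refine Eq.trans h2 (Eq.trans h1.symm ?_)
  change specialize h m (diffOp h h (polyC h h)) = _
  rw [hb, specialize_scalarPoly]

/-- For large integers `l`, `B(l)⟨hˡ, hˡ⟩ = ⟨P hˡ⁺¹, hˡ⟩ = ⟨hˡ⁺¹, Q hˡ⟩`, with `Q` adjoint to `P`.
The last pairing is `⟨hˡ⁺¹, hˡ⁺¹⟩ = b(l)⟨hˡ, hˡ⟩` times a polynomial in `l`. So `b` divides `B` at
infinitely many integers with a polynomial quotient, hence as polynomials. -/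
theorem dvd_of_hasFunctionalEquation {b : ℂ[X]} (hh : h ≠ 0)
    (hb : diffOp h h (polyC h h) = scalarPoly h b) (hb0 : ∀ m : ℕ, b.eval (m : ℂ) ≠ 0)
    {B : ℂ[X]} (hB : HasFunctionalEquation h B) : b ∣ B := by
  obtain ⟨P, hP, hPB⟩ := hB
  obtain ⟨Q, hQ⟩ := exists_isApolarAdjoint hh hP
  have hinj := algebraMap_polarRing_injective hh
  have hcC : ∀ (z : ℂ) (p q : MvPolynomial (Fin n) ℂ),
      apolar (MvPolynomial.C z * p) q = z * apolar p q := by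
    intro z p q
    rw [← MvPolynomial.smul_eq_C_mul, map_smul, LinearMap.smul_apply, smul_eq_mul]
  have hrec : ∀ (m : ℕ) (q : MvPolynomial (Fin n) ℂ),
      apolar (h ^ (m + 1)) (h * q) = b.eval (m : ℂ) * apolar (h ^ m) q := by
    intro m q
    rw [← apolar_constDiffOp, constDiffOp_pow hh hb, hcC]
  have hnorm : ∀ m : ℕ, apolar (h ^ m) (h ^ m) ≠ 0 := by
    intro m
    induction m with
    | zero =>
      rw [pow_zero, apolar_apply, map_one (constDiffOp (n := n)), Module.End.one_apply, map_one]
      exact one_ne_zero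
    | succ m ih =>
      nth_rewrite 2 [pow_succ']
      rw [hrec]
      exact mul_ne_zero (hb0 m) ih
  -- Increasing `m` by one multiplies both pairings by the same value `b(m₀ + m)`. The ratio at `m =
  -- 0` therefore persists.
  have hprop : ∀ (m₀ : ℕ) (q : MvPolynomial (Fin n) ℂ), ∃ κ : ℂ, ∀ m : ℕ,
      apolar (h ^ (m₀ + m)) (h ^ m * q) = κ * apolar (h ^ (m₀ + m)) (h ^ (m₀ + m)) := by
    intro m₀ q
    refine ⟨apolar (h ^ m₀) q / apolar (h ^ m₀) (h ^ m₀), fun m => ?_⟩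
    induction m with
    | zero => simp [hnorm m₀]
    | succ m ih =>
      rw [← add_assoc]
      nth_rewrite 4 [pow_succ']
      rw [hrec, pow_succ' h m, mul_assoc, hrec, ih]
      ring
  set v := Q 1 with hv
  -- A common denominator for the coefficients in `s` of the adjoint applied to `hˢ`. For `l = m₀ +
  -- m` the adjoint then sends `hˡ` to `∑ lᵏ hᵐ qₖ`, a polynomial.
  have hden : ∃ (m₀ : ℕ) (q : ℕ → MvPolynomial (Fin n) ℂ), ∀ k,
      algebraMap _ (PolarRing h) (q k) = algebraMap _ (PolarRing h) h ^ m₀ * v.coeff k := by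
    choose e g hg using fun k => IsLocalization.Away.surj h (v.coeff k)
    refine ⟨∑ k ∈ v.support, e k, fun k => if k ∈ v.support then
      h ^ (∑ k ∈ v.support, e k - e k) * g k else 0, fun k => ?_⟩
    beta_reduce
    by_cases hk : k ∈ v.support
    · rw [if_pos hk, map_mul, map_pow, ← hg, mul_comm (v.coeff k), ← mul_assoc, ← pow_add,
        Nat.sub_add_cancel (Finset.single_le_sum (fun _ _ => Nat.zero_le _) hk)]
    · rw [if_neg hk, notMem_support_iff.1 hk, map_zero, mul_zero]
  obtain ⟨m₀, q, hq⟩ := hden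
  choose κ hκ using fun k => hprop (m₀ + 1) (q k)
  -- The candidate quotient `B / b`; its coefficients are the ratios just found, which do not depend
  -- on `m`.
  set K : ℂ[X] := ∑ k ∈ v.support, monomial k (κ k) with hK
  have hval : ∀ m : ℕ, B.eval ((m₀ + m : ℕ) : ℂ) = (b * K).eval ((m₀ + m : ℕ) : ℂ) := by
    intro m
    set l := m₀ + m with hl
    obtain ⟨p', q', h1, h2, h3⟩ := hQ l (C (algebraMap _ (PolarRing h) h)) 1 (h ^ (l + 1)) (h ^ l)
      (by rw [specialize_apply, eval_C, map_pow, pow_succ])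
      (by rw [specialize_apply, eval_one, mul_one, map_pow])
    rw [hPB] at h1
    have h1' : p' = MvPolynomial.C (B.eval (l : ℂ)) * h ^ l :=
      hinj (h1.trans (specialize_scalarPoly l B))
    have h2' : q' = ∑ k ∈ v.support, MvPolynomial.C ((l : ℂ) ^ k) * (h ^ m * q k) := by
      apply hinj
      rw [h2, specialize_apply, eval_eq_sum, sum_def, Finset.mul_sum, map_sum]
      refine Finset.sum_congr rfl fun k _ => ?_
      rw [map_mul, map_mul, hq, algebraMap_C, map_pow, map_pow, map_natCast, hl, pow_add, ← hv]
      ring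
    have h4 : B.eval (l : ℂ) * apolar (h ^ l) (h ^ l) =
        (b * K).eval (l : ℂ) * apolar (h ^ l) (h ^ l) := by
      rw [← hcC, ← h1', h3, h2', map_sum, eval_mul, hK, eval_finsetSum, Finset.mul_sum,
        Finset.sum_mul]
      refine Finset.sum_congr rfl fun k _ => ?_
      have h6 : apolar (h ^ (l + 1)) (h ^ m * q k) =
          b.eval (l : ℂ) * (κ k * apolar (h ^ l) (h ^ l)) := by
        have h5 := hκ k m
        rw [show m₀ + 1 + m = l + 1 by omega] at h5
        nth_rewrite 3 [pow_succ'] at h5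
        rw [h5, hrec]
        ring
      rw [← MvPolynomial.smul_eq_C_mul, map_smul, smul_eq_mul, h6, eval_monomial]
      ring
    exact mul_right_cancel₀ (hnorm l) h4
  refine ⟨K, Polynomial.eq_of_infinite_eval_eq _ _ ?_⟩
  refine Set.infinite_of_injective_forall_mem (f := fun m : ℕ => ((m₀ + m : ℕ) : ℂ)) ?_ hval
  intro m m' hmm
  have := Nat.cast_injective (R := ℂ) hmm
  omega

theorem mulLeft_scalarPoly_mem (p : ℂ[X]) :
    LinearMap.mulLeft ℂ (scalarPoly h p) ∈ diffOperators h := by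
  have h1 : LinearMap.mulLeft ℂ (scalarPoly h p) =
      Polynomial.aeval (LinearMap.mulLeft ℂ (Polynomial.X : (PolarRing h)[X])) p := by
    induction p using Polynomial.induction_on' with
    | add p q hp hq =>
      rw [map_add, ← hp, ← hq, scalarPoly, Polynomial.map_add]
      exact LinearMap.ext fun u => add_mul _ _ u
    | monomial k z =>
      rw [aeval_monomial, LinearMap.pow_mulLeft]
      refine LinearMap.ext fun u => ?_
      rw [LinearMap.mulLeft_apply, Module.End.mul_apply, LinearMap.mulLeft_apply,
        Module.algebraMap_end_apply, scalarPoly, map_monomial, ← C_mul_X_pow_eq_monomial, mul_assoc,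
        Algebra.smul_def]
      rfl
  rw [h1]
  have hX : LinearMap.mulLeft ℂ (Polynomial.X : (PolarRing h)[X]) ∈ diffOperators h :=
    Algebra.subset_adjoin (Or.inr rfl)
  exact (Algebra.adjoin_le (Set.singleton_subset_iff.2 hX)) (aeval_mem_adjoin_singleton ℂ _)

theorem IsCapelli.isBernsteinPolynomial {c : ℂ[X]} (H : IsCapelli h c) (hh : h ≠ 0) {b : ℂ[X]} (hb : b.Monic)
    {κ : ℂ} (hκ : κ ≠ 0) (hbc : c * (Polynomial.X + 1) = C κ * b)
    (hb0 : ∀ m : ℕ, b.eval (m : ℂ) ≠ 0) : IsBernsteinPolynomial h b := by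
  have hP : diffOp h h (polyC h h) = scalarPoly h (C κ * b) := by rw [H.diffOp_self, hbc]
  refine ⟨hb, fun B => ⟨fun hB => ?_, ?_⟩⟩
  · have h1 := dvd_of_hasFunctionalEquation hh hP (fun m => by
      rw [eval_mul, eval_C]
      exact mul_ne_zero hκ (hb0 m)) hB
    exact (dvd_mul_left b (C κ)).trans h1
  · rintro ⟨B, rfl⟩
    refine ⟨LinearMap.mulLeft ℂ (scalarPoly h (C κ⁻¹ * B)) * diffOp h h,
      mul_mem (mulLeft_scalarPoly_mem _) (diffOp_mem h h), ?_⟩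
    rw [Module.End.mul_apply]
    refine (congrArg _ hP).trans ?_
    rw [LinearMap.mulLeft_apply, ← scalarPoly_mul, scalarPoly]
    congr 1
    have : C κ⁻¹ * C κ = 1 := by rw [← C_mul, inv_mul_cancel₀ hκ, C_1]
    linear_combination B * b * this

end BernsteinPolynomial

end LogBrieskorn

end

noncomputable section

namespace LogBrieskorn

open Polynomial

section Representation

variable {n : ℕ} {h : MvPolynomial (Fin n) ℂ} {c : ℂ[X]} {a : Fin n → ℂ}

/-! ### Representing classes of polynomials by polynomials in `θ∇_θ` -/

/-- Linear vector fields without divergence annihilating `h`. -/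
structure IsAdmissible (h : MvPolynomial (Fin n) ℂ) (ξ : Fin n → MvPolynomial (Fin n) ℂ) : Prop where
  linear : ∀ j, (ξ j).IsHomogeneous 1
  annihilates : ∑ j, ξ j * MvPolynomial.pderiv j h = 0
  divergence : ∑ j, MvPolynomial.pderiv j (ξ j) = 0

/-- The derivative of `g` along the vector field `ξ`. -/
def lieDeriv (ξ : Fin n → MvPolynomial (Fin n) ℂ) (g : MvPolynomial (Fin n) ℂ) :
    MvPolynomial (Fin n) ℂ :=
  ∑ j, ξ j * MvPolynomial.pderiv j g

/-- Every coordinate is a combination of the linear form with coefficients `a` and of its derivatives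
along admissible vector fields. -/
def IsSpanningForm (h : MvPolynomial (Fin n) ℂ) (a : Fin n → ℂ) : Prop :=
  ∀ i, ∃ (κ : ℂ) (ξ : Fin n → MvPolynomial (Fin n) ℂ), IsAdmissible h ξ ∧
    MvPolynomial.X i = MvPolynomial.C κ * linearForm a + lieDeriv ξ (linearForm a)

theorem pderiv_linearForm (a : Fin n → ℂ) (j : Fin n) :
    MvPolynomial.pderiv j (linearForm a) = MvPolynomial.C (a j) := by
  rw [linearForm, map_sum, Finset.sum_eq_single j]
  · rw [MvPolynomial.pderiv_C_mul, MvPolynomial.pderiv_X_self, mul_one]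
  · intro i _ hij
    rw [MvPolynomial.pderiv_C_mul, MvPolynomial.pderiv_X_of_ne hij, mul_zero]
  · intro hj
    exact absurd (Finset.mem_univ j) hj

theorem linearForm_isHomogeneous (a : Fin n → ℂ) : (linearForm a).IsHomogeneous 1 := by
  refine MvPolynomial.IsHomogeneous.sum _ _ _ fun i _ => ?_
  have := (MvPolynomial.isHomogeneous_C (Fin n) (a i)).mul (MvPolynomial.isHomogeneous_X ℂ i)
  rwa [zero_add] at this

theorem IsAdmissible.lieDeriv_isHomogeneous {ξ : Fin n → MvPolynomial (Fin n) ℂ}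
    (hξ : IsAdmissible h ξ) {g : MvPolynomial (Fin n) ℂ} {d : ℕ} (hg : g.IsHomogeneous d) :
    (lieDeriv ξ g).IsHomogeneous d := by
  refine MvPolynomial.IsHomogeneous.sum _ _ _ fun j _ => ?_
  cases d with
  | zero =>
    rw [← MvPolynomial.totalDegree_zero_iff_isHomogeneous,
      MvPolynomial.totalDegree_eq_zero_iff_eq_C] at hg
    rw [hg, MvPolynomial.pderiv_C, mul_zero]
    exact MvPolynomial.isHomogeneous_zero _ _ _
  | succ d =>
    have := (hξ.linear j).mul (hg.pderiv (i := j))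
    rwa [Nat.add_sub_cancel, add_comm] at this

/-- Integration by parts along `g ξ`, whose divergence is `ξ(g)` because `ξ` has divergence zero.
The functional thus obeys the same relation as the classes of forms. -/
theorem IsCapelli.capelliPhi_lieDeriv (H : IsCapelli h c) (ha : MvPolynomial.eval a h ≠ 0)
    {ξ : Fin n → MvPolynomial (Fin n) ℂ} (hξ : IsAdmissible h ξ) {z : ℂ} (hz : z ≠ 0)
    (g : MvPolynomial (Fin n) ℂ) :
    capelliPhi ha z (lieDeriv ξ (linearForm a) * g) = C z * capelliPhi ha z (lieDeriv ξ g) := by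
  have h1 := capelliPhi_divergence ha H hz (fun j => ξ j * g) (by
    rw [← zero_mul g, ← hξ.annihilates, Finset.sum_mul]
    exact Finset.sum_congr rfl fun j _ => by ring)
  have h2 : ∑ j, (MvPolynomial.C z * MvPolynomial.pderiv j (ξ j * g) -
      MvPolynomial.C (a j) * (ξ j * g)) =
      z • lieDeriv ξ g - lieDeriv ξ (linearForm a) * g := by
    have h3 := congrArg (fun p => MvPolynomial.C z * p * g) hξ.divergence
    simp only [Finset.mul_sum, Finset.sum_mul, mul_zero, zero_mul] at h3
    rw [MvPolynomial.smul_eq_C_mul, lieDeriv, lieDeriv, Finset.mul_sum, Finset.sum_mul,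
      ← Finset.sum_sub_distrib, ← sub_eq_zero, ← Finset.sum_sub_distrib, ← h3]
    refine Finset.sum_congr rfl fun j _ => ?_
    rw [Derivation.leibniz, pderiv_linearForm, smul_eq_mul, smul_eq_mul]
    ring
  rw [h2, map_sub, map_smul, sub_eq_zero] at h1
  rw [← h1, Polynomial.smul_eq_C_mul]

/-- The polynomial `P` with `[g] = θᵈ P(θ∇_θ)[1]`, for `g` homogeneous of degree `d`. -/
def nablaPoly (ha : MvPolynomial.eval a h ≠ 0) (g : MvPolynomial (Fin n) ℂ) : ℂ[X] :=
  -- For `z = 1` and `d = 0`, multiplication by `f` acts on the functional as `-n X`, while `[f] =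
  -- θN[1]`. So `N` corresponds to `-n s`, which explains the substitution `X ↦ -X/n`.
  (capelliPhi ha 1 g).comp (C (-(n : ℂ)⁻¹) * Polynomial.X)

variable {Y : Type} [AddCommGroup Y] [Module ℂ Y]

/-- If classes `e g` of polynomials satisfy the relations given by admissible vector fields, then
all of them are obtained from `e 1` by the operators `θ` and `θ∇_θ`. -/
theorem IsCapelli.class_eq (H : IsCapelli h c) (ha : MvPolynomial.eval a h ≠ 0)
    (hspan : IsSpanningForm h a) (θ : Y ≃ₗ[ℂ] Y) (N : Y →ₗ[ℂ] Y)
    (hcomm : ∀ x, N (θ x) = θ (N x) + θ x) (e : MvPolynomial (Fin n) ℂ →ₗ[ℂ] Y)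
    (hN : ∀ g, θ (N (e g)) = e (linearForm a * g))
    (hξ : ∀ ξ, IsAdmissible h ξ → ∀ g,
      θ (e (lieDeriv ξ g)) = e (lieDeriv ξ (linearForm a) * g))
    {d : ℕ} {g : MvPolynomial (Fin n) ℂ} (hg : g.IsHomogeneous d) :
    e g = (θ ^ (d : ℤ)) (aeval N (nablaPoly ha g) (e 1)) := by
  have hn : (n : ℂ) ≠ 0 := Nat.cast_ne_zero.2 H.pos.ne'
  induction d generalizing g with
  | zero =>
    rw [← MvPolynomial.totalDegree_zero_iff_isHomogeneous,
      MvPolynomial.totalDegree_eq_zero_iff_eq_C] at hg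
    rw [hg, ← mul_one (MvPolynomial.C _), ← MvPolynomial.smul_eq_C_mul, nablaPoly, map_smul,
      map_smul, capelliPhi_one, smul_comp, one_comp, map_smul,
      map_one (aeval N), Nat.cast_zero, zpow_zero]
    rfl
  | succ d ih =>
    refine homogeneous_induction (P := fun d' g => d' = d + 1 → e g =
      (θ ^ (d' : ℤ)) (aeval N (nablaPoly ha g) (e 1))) ?_ ?_ ?_ ?_ hg rfl
    · intro z hz
      omega
    · intro d' _
      simp [nablaPoly]
    · intro d' p q hp hq hd
      rw [map_add, hp hd, hq hd, nablaPoly, nablaPoly, nablaPoly, map_add, add_comp, map_add,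
        LinearMap.add_apply, map_add]
    · intro d' p i hp _ hd
      obtain rfl : d' = d := by omega
      -- The last coordinate is traded for `κ f + ξ(f)`. Multiplication by `f` is `θN`, and
      -- multiplication by `ξ(f)` is `θ` applied to the class of `ξ(p)`, which has the same degree
      -- as `p`; both reduce to degree `d'`.
      obtain ⟨κ, ξ, hadm, hX⟩ := hspan i
      have hpX : p * MvPolynomial.X i =
          κ • (linearForm a * p) + lieDeriv ξ (linearForm a) * p := by
        rw [hX, MvPolynomial.smul_eq_C_mul]
        ring
      have hθ : ∀ x, (θ ^ ((d' + 1 : ℕ) : ℤ)) x = θ ((θ ^ (d' : ℤ)) x) := fun x => by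
        rw [Nat.cast_succ, add_comm, zpow_add, zpow_one]
        rfl
      have h1 : e (linearForm a * p) =
          (θ ^ ((d' + 1 : ℕ) : ℤ)) (aeval N (nablaPoly ha (linearForm a * p)) (e 1)) := by
        have hpoly : nablaPoly ha (linearForm a * p) =
            Polynomial.X * nablaPoly ha p + (d' : ℂ) • nablaPoly ha p := by
          rw [nablaPoly, capelliPhi_linearForm_mul ha H.homogeneous 1 hp, nablaPoly]
          simp only [mul_comp, sub_comp, C_comp, X_comp]
          rw [Polynomial.smul_eq_C_mul, ← mul_assoc (C (n : ℂ)), ← C_mul, mul_neg,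
            mul_inv_cancel₀ hn, C_neg, C_neg, C_1]
          ring
        rw [← hN, ih hp, nabla_zpow hcomm, hθ, hpoly, map_add (aeval N), map_smul (aeval N),
          LinearMap.add_apply, LinearMap.smul_apply, map_mul, aeval_X, Module.End.mul_apply, map_add,
          map_smul, map_add, map_add, map_smul, map_smul, Int.cast_natCast]
      have h2 : e (lieDeriv ξ (linearForm a) * p) =
          (θ ^ ((d' + 1 : ℕ) : ℤ))
            (aeval N (nablaPoly ha (lieDeriv ξ (linearForm a) * p)) (e 1)) := by
        rw [← hξ ξ hadm, ih (hadm.lieDeriv_isHomogeneous hp), nablaPoly, nablaPoly,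
          H.capelliPhi_lieDeriv ha hadm one_ne_zero, C_1, one_mul, hθ]
      rw [hpX, map_add, map_smul, h1, h2]
      simp only [nablaPoly, map_add, map_smul, add_comp, smul_comp, LinearMap.add_apply,
        LinearMap.smul_apply]

/-- The operator induced on the functionals by multiplication with `h - t₀`. -/
def fibreOp (h : MvPolynomial (Fin n) ℂ) (a : Fin n → ℂ) (c : ℂ[X]) (t₀ z : ℂ) (p : ℂ[X]) : ℂ[X] :=
  C ((-z) ^ n * (MvPolynomial.eval a h)⁻¹) * ((c * (Polynomial.X + 1)) * p).comp (Polynomial.X - 1) -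
    C t₀ * p

/-- The first term multiplies by a polynomial of degree `n` and the second one by a constant. So a
nonzero `p` has image of degree `n + deg p`, and nothing nonzero of degree less than `n` is reached.
-/
theorem IsCapelli.degree_fibreOp (H : IsCapelli h c) (ha : MvPolynomial.eval a h ≠ 0) (t₀ : ℂ)
    {z : ℂ} (hz : z ≠ 0) (p : ℂ[X]) (hp : (fibreOp h a c t₀ z p).degree < n) :
    fibreOp h a c t₀ z p = 0 := by
  by_cases hp0 : p = 0
  · subst hp0
    simp [fibreOp]
  exfalso
  have hκ : (-z) ^ n * (MvPolynomial.eval a h)⁻¹ ≠ 0 :=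
    mul_ne_zero (pow_ne_zero _ (neg_ne_zero.2 hz)) (inv_ne_zero ha)
  have hX1 : (Polynomial.X + 1 : ℂ[X]) ≠ 0 := X_add_C_ne_zero (1 : ℂ)
  have hdeg1 : (Polynomial.X + 1 : ℂ[X]).natDegree = 1 := natDegree_X_add_C (1 : ℂ)
  have hdegX : (Polynomial.X - 1 : ℂ[X]).natDegree = 1 := natDegree_X_sub_C (1 : ℂ)
  have hbig : (C ((-z) ^ n * (MvPolynomial.eval a h)⁻¹) *
      ((c * (Polynomial.X + 1)) * p).comp (Polynomial.X - 1)).natDegree = n + p.natDegree := by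
    rw [natDegree_C_mul hκ, natDegree_comp, hdegX, mul_one,
      natDegree_mul (mul_ne_zero H.ne_zero hX1) hp0, natDegree_mul H.ne_zero hX1, hdeg1, H.degree]
  have hlt : (C t₀ * p).natDegree < (C ((-z) ^ n * (MvPolynomial.eval a h)⁻¹) *
      ((c * (Polynomial.X + 1)) * p).comp (Polynomial.X - 1)).natDegree := by
    rw [hbig]
    have := natDegree_C_mul_le t₀ p
    have := H.pos
    omega
  have h1 : (fibreOp h a c t₀ z p).natDegree = n + p.natDegree := by
    rw [fibreOp, natDegree_sub_eq_left_of_natDegree_lt hlt, hbig]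
  have h2 : fibreOp h a c t₀ z p ≠ 0 := by
    intro h0
    rw [h0, natDegree_zero] at h1
    have := H.pos
    omega
  rw [degree_eq_natDegree h2, h1, Nat.cast_lt] at hp
  omega

theorem IsCapelli.capelliPhi_fibre (H : IsCapelli h c) (ha : MvPolynomial.eval a h ≠ 0) (t₀ z : ℂ)
    (g : MvPolynomial (Fin n) ℂ) :
    capelliPhi ha z ((h - MvPolynomial.C t₀) * g) = fibreOp h a c t₀ z (capelliPhi ha z g) := by
  rw [sub_mul, map_sub, capelliPhi_mul ha H, ← MvPolynomial.smul_eq_C_mul, map_smul, fibreOp,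
    Polynomial.smul_eq_C_mul]

theorem fibreOp_smul_add (t₀ z κ : ℂ) (p q : ℂ[X]) :
    fibreOp h a c t₀ z (C κ * p + q) = C κ * fibreOp h a c t₀ z p + fibreOp h a c t₀ z q := by
  simp only [fibreOp, mul_add, mul_comp, add_comp, C_comp]
  ring

/-- A root `λ` of `b = c · (X + 1)` corresponds to the root `-n(λ + 1)` of this polynomial. This is
the passage from the functional equation to the exponents of the connection. -/
theorem nablaPoly_self (H : IsCapelli h c) (ha : MvPolynomial.eval a h ≠ 0) :
    nablaPoly ha h = C ((-1) ^ n * (MvPolynomial.eval a h)⁻¹) *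
      (c * (Polynomial.X + 1)).comp (C (-(n : ℂ)⁻¹) * Polynomial.X - 1) := by
  have h1 := capelliPhi_mul ha H 1 1
  rw [mul_one] at h1
  rw [nablaPoly, h1, capelliPhi_one, mul_one, mul_comp, C_comp, comp_assoc, sub_comp, X_comp, one_comp]

end Representation

end LogBrieskorn

end

noncomputable section

namespace LogBrieskorn

section FormCalculus

variable {n : ℕ} {h : MvPolynomial (Fin n) ℂ}

/-! ### Calculus of forms: exterior and interior multiplication -/

/-- The sign of moving `dxᵢ` to its place in `dx_I`. -/
def wedgeSign (h : MvPolynomial (Fin n) ℂ) (i : Fin n) (I : Finset (Fin n)) : PolarRing h :=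
  (-1) ^ (I.filter (· < i)).card

theorem wedgeSign_mul_self (i : Fin n) (I : Finset (Fin n)) :
    wedgeSign h i I * wedgeSign h i I = 1 := by
  rw [wedgeSign, ← pow_add, ← two_mul, pow_mul, neg_one_sq, one_pow]

theorem wedgeSign_insert {i : Fin n} (j : Fin n) {I : Finset (Fin n)} (hi : i ∉ I) :
    wedgeSign h j (insert i I) = (if i < j then -1 else 1) * wedgeSign h j I := by
  rw [wedgeSign, wedgeSign, Finset.filter_insert]
  by_cases hij : i < j
  · rw [if_pos hij, if_pos hij, Finset.card_insert_of_notMem (by simp [hi]), pow_succ, mul_comm]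
  · rw [if_neg hij, if_neg hij, one_mul]

theorem wedgeSign_erase {i : Fin n} (j : Fin n) {I : Finset (Fin n)} (hi : i ∈ I) :
    wedgeSign h j (I.erase i) = (if i < j then -1 else 1) * wedgeSign h j I := by
  conv_rhs => rw [← Finset.insert_erase hi, wedgeSign_insert j (Finset.notMem_erase i I)]
  split_ifs <;> simp

theorem dxWedge_apply (i : Fin n) (ω : Form h) (I : Finset (Fin n)) :
    dxWedge h i ω I = if i ∈ I then wedgeSign h i I * ω (I.erase i) else 0 := rfl

/-- The contraction with `∂ᵢ`. -/
def contract (h : MvPolynomial (Fin n) ℂ) (i : Fin n) : Form h →ₗ[PolarRing h] Form h where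
  toFun ω I := if i ∈ I then 0 else wedgeSign h i I * ω (insert i I)
  map_add' ω η := by
    funext I
    by_cases hi : i ∈ I <;> simp [hi, mul_add]
  map_smul' c ω := by
    funext I
    by_cases hi : i ∈ I
    · simp [hi]
    · simp only [hi, if_false, Pi.smul_apply, smul_eq_mul, RingHom.id_apply]
      ring

theorem contract_apply (i : Fin n) (ω : Form h) (I : Finset (Fin n)) :
    contract h i ω I = if i ∈ I then 0 else wedgeSign h i I * ω (insert i I) := rfl

theorem dxWedge_anticomm (i j : Fin n) (ω : Form h) :
    dxWedge h i (dxWedge h j ω) = -dxWedge h j (dxWedge h i ω) := by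
  funext I
  simp only [Pi.neg_apply, dxWedge_apply]
  by_cases hij : i = j
  · subst hij
    simp
  by_cases hi : i ∈ I
  · by_cases hj : j ∈ I
    · rw [if_pos hi, if_pos hj, if_pos (Finset.mem_erase.2 ⟨Ne.symm hij, hj⟩),
        if_pos (Finset.mem_erase.2 ⟨hij, hi⟩), wedgeSign_erase j hi, wedgeSign_erase i hj,
        Finset.erase_right_comm]
      rcases lt_or_gt_of_ne hij with hlt | hlt
      · rw [if_pos hlt, if_neg hlt.not_gt]; ring
      · rw [if_neg hlt.not_gt, if_pos hlt]; ring
    · rw [if_neg hj, if_neg (fun hj' => hj (Finset.mem_of_mem_erase hj'))]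
      simp
  · rw [if_neg hi, if_neg (fun hi' => hi (Finset.mem_of_mem_erase hi'))]
    simp

theorem contract_dxWedge (i j : Fin n) (ω : Form h) :
    contract h i (dxWedge h j ω) + dxWedge h j (contract h i ω) = if i = j then ω else 0 := by
  funext I
  by_cases hij : i = j
  · subst hij
    rw [if_pos rfl, Pi.add_apply, contract_apply, dxWedge_apply]
    by_cases hi : i ∈ I
    · rw [if_pos hi, zero_add, dxWedge_apply, if_pos hi, contract_apply,
        if_neg (Finset.notMem_erase i I),
        Finset.insert_erase hi, wedgeSign_erase i hi, if_neg (lt_irrefl i), one_mul,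
        ← mul_assoc, wedgeSign_mul_self, one_mul]
    · rw [if_neg hi, if_pos (Finset.mem_insert_self i I), dxWedge_apply, if_neg hi,
        Finset.erase_insert hi, wedgeSign_insert i hi, if_neg (lt_irrefl i), one_mul, add_zero,
        ← mul_assoc, wedgeSign_mul_self, one_mul]
  · rw [if_neg hij, Pi.add_apply, Pi.zero_apply, contract_apply, dxWedge_apply]
    by_cases hi : i ∈ I
    · rw [if_pos hi, zero_add, dxWedge_apply, contract_apply,
        if_pos (Finset.mem_erase.2 ⟨hij, hi⟩)]
      simp
    · rw [if_neg hi, dxWedge_apply, contract_apply]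
      by_cases hj : j ∈ I
      · rw [if_pos (Finset.mem_insert_of_mem hj), if_pos hj,
          if_neg (fun hi' => hi (Finset.mem_of_mem_erase hi')), wedgeSign_insert j hi,
          wedgeSign_erase i hj, Finset.erase_insert_of_ne hij]
        rcases lt_or_gt_of_ne hij with hlt | hlt
        · rw [if_pos hlt, if_neg hlt.not_gt]; ring
        · rw [if_neg hlt.not_gt, if_pos hlt]; ring
      · rw [if_neg hj, if_neg (fun hj' => hj (Finset.mem_of_mem_insert_of_ne hj' (Ne.symm hij)))]
        simp

/-- The operator `ω ↦ (∑ vᵢ dxᵢ) ∧ ω`. -/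
def wedgeV (v : Fin n → PolarRing h) : Form h →ₗ[PolarRing h] Form h := ∑ i, v i • dxWedge h i

/-- The contraction with the vector field `∑ vᵢ ∂ᵢ`. -/
def contractV (v : Fin n → PolarRing h) : Form h →ₗ[PolarRing h] Form h :=
  ∑ i, v i • contract h i

theorem wedgeV_apply (v : Fin n → PolarRing h) (ω : Form h) :
    wedgeV v ω = ∑ i, v i • dxWedge h i ω := by
  simp [wedgeV]

theorem contractV_apply (v : Fin n → PolarRing h) (ω : Form h) :
    contractV v ω = ∑ i, v i • contract h i ω := by
  simp [contractV]

theorem dWedge_eq (g : MvPolynomial (Fin n) ℂ) :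
    dWedge h g = wedgeV fun i => algebraMap _ (PolarRing h) (MvPolynomial.pderiv i g) := rfl

theorem wedgeV_anticomm (v w : Fin n → PolarRing h) (ω : Form h) :
    wedgeV v (wedgeV w ω) = -wedgeV w (wedgeV v ω) := by
  simp only [wedgeV_apply, map_sum, map_smul, Finset.smul_sum]
  rw [Finset.sum_comm, ← Finset.sum_neg_distrib]
  refine Finset.sum_congr rfl fun j _ => ?_
  rw [← Finset.sum_neg_distrib]
  refine Finset.sum_congr rfl fun i _ => ?_
  rw [dxWedge_anticomm, smul_neg, smul_neg, smul_comm]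

theorem form_eq_zero_of_eq_neg {ω : Form h} (hω : ω = -ω) : ω = 0 := by
  have h2 : (2 : ℂ) • ω = 0 := by
    rw [two_smul]
    nth_rewrite 1 [hω]
    exact neg_add_cancel ω
  exact (smul_eq_zero.1 h2).resolve_left two_ne_zero

theorem wedgeV_self (v : Fin n → PolarRing h) (ω : Form h) : wedgeV v (wedgeV v ω) = 0 :=
  form_eq_zero_of_eq_neg (wedgeV_anticomm v v ω)

/-- This Clifford relation is the source of the later form identities: applied to the volume form,
or to a form killed by `dh ∧`, one of its two terms drops out. -/
theorem contractV_wedgeV (v w : Fin n → PolarRing h) (ω : Form h) :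
    contractV v (wedgeV w ω) + wedgeV w (contractV v ω) = (∑ i, v i * w i) • ω := by
  simp only [wedgeV_apply, contractV_apply, map_sum, map_smul, Finset.smul_sum]
  rw [Finset.sum_comm (f := fun j i => w j • v i • contract h i (dxWedge h j ω)),
    ← Finset.sum_add_distrib,
    Finset.sum_smul]
  refine Finset.sum_congr rfl fun i _ => ?_
  rw [← Finset.sum_add_distrib, Finset.sum_eq_single i]
  · rw [smul_comm (w i) (v i), ← smul_add, ← smul_add, contract_dxWedge, if_pos rfl, smul_smul]
  · intro j _ hj
    rw [smul_comm (w j) (v i), ← smul_add, ← smul_add, contract_dxWedge, if_neg (Ne.symm hj),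
      smul_zero, smul_zero]
  · intro hi
    exact absurd (Finset.mem_univ i) hi

/-- The partial derivative of the coefficients of a form. -/
def formDeriv (h : MvPolynomial (Fin n) ℂ) (i : Fin n) : Form h →ₗ[ℂ] Form h :=
  (polarDeriv h i : PolarRing h →ₗ[ℂ] PolarRing h).compLeft (Finset (Fin n))

theorem formDeriv_apply (i : Fin n) (ω : Form h) (I : Finset (Fin n)) :
    formDeriv h i ω I = polarDeriv h i (ω I) := rfl

theorem extDeriv_apply (ω : Form h) : extDeriv h ω = ∑ i, dxWedge h i (formDeriv h i ω) := by
  rw [extDeriv, LinearMap.sum_apply]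
  rfl

theorem formDeriv_smul (i : Fin n) (r : PolarRing h) (ω : Form h) :
    formDeriv h i (r • ω) = polarDeriv h i r • ω + r • formDeriv h i ω := by
  funext I
  simp only [formDeriv_apply, Pi.smul_apply, Pi.add_apply, Derivation.leibniz, smul_eq_mul]
  ring

theorem formDeriv_dxWedge (i j : Fin n) (ω : Form h) :
    formDeriv h i (dxWedge h j ω) = dxWedge h j (formDeriv h i ω) := by
  funext I
  rw [formDeriv_apply, dxWedge_apply, dxWedge_apply]
  by_cases hj : j ∈ I
  · rw [if_pos hj, if_pos hj, wedgeSign]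
    rcases neg_one_pow_eq_or (PolarRing h) (I.filter (· < j)).card with hs | hs
    · rw [hs, one_mul, one_mul, formDeriv_apply]
    · rw [hs, neg_one_mul, neg_one_mul, map_neg, formDeriv_apply]
  · rw [if_neg hj, if_neg hj, map_zero]

/-- The terms with second derivatives of `g` are symmetric against an antisymmetric product and
cancel, which is `d(dg) = 0`. In the other terms only the order of two factors `dxᵢ`, `dxⱼ` changes.
-/
theorem extDeriv_dWedge (g : MvPolynomial (Fin n) ℂ) (ω : Form h) :
    extDeriv h (dWedge h g ω) = -dWedge h g (extDeriv h ω) := by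
  have h1 : extDeriv h (dWedge h g ω) =
      ∑ i, ∑ j, algebraMap _ (PolarRing h) (MvPolynomial.pderiv i (MvPolynomial.pderiv j g)) •
        dxWedge h i (dxWedge h j ω) +
      ∑ i, ∑ j, algebraMap _ (PolarRing h) (MvPolynomial.pderiv j g) •
        dxWedge h i (dxWedge h j (formDeriv h i ω)) := by
    rw [extDeriv_apply, ← Finset.sum_add_distrib]
    refine Finset.sum_congr rfl fun i _ => ?_
    rw [dWedge_eq, wedgeV_apply, map_sum, map_sum, ← Finset.sum_add_distrib]
    refine Finset.sum_congr rfl fun j _ => ?_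
    rw [formDeriv_smul, polarDeriv_algebraMap, formDeriv_dxWedge, map_add, map_smul, map_smul]
  have h2 : ∑ i, ∑ j, algebraMap _ (PolarRing h)
      (MvPolynomial.pderiv i (MvPolynomial.pderiv j g)) • dxWedge h i (dxWedge h j ω) = 0 := by
    apply form_eq_zero_of_eq_neg
    conv_lhs => rw [Finset.sum_comm]
    rw [← Finset.sum_neg_distrib]
    refine Finset.sum_congr rfl fun i _ => ?_
    rw [← Finset.sum_neg_distrib]
    refine Finset.sum_congr rfl fun j _ => ?_
    rw [dxWedge_anticomm, pderiv_comm, smul_neg]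
  rw [h1, h2, zero_add]
  rw [extDeriv_apply, map_sum, ← Finset.sum_neg_distrib]
  refine Finset.sum_congr rfl fun i _ => ?_
  rw [dWedge_eq, wedgeV_apply, ← Finset.sum_neg_distrib]
  refine Finset.sum_congr rfl fun j _ => ?_
  rw [dxWedge_anticomm, smul_neg]

/-! ### Degrees -/

theorem dxWedge_mem_polarForms (i : Fin n) {q : ℕ} {ω : Form h} (hω : ω ∈ polarForms h (q + 1)) :
    dxWedge h i ω ∈ polarForms h q := by
  intro I hI
  rw [dxWedge_apply] at hI
  by_cases hi : i ∈ I
  · rw [if_pos hi] at hI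
    have := hω _ (right_ne_zero_of_mul hI)
    have := Finset.card_erase_add_one hi
    omega
  · exact absurd (if_neg hi) hI

theorem contract_mem_polarForms (i : Fin n) {q : ℕ} {ω : Form h} (hω : ω ∈ polarForms h q) :
    contract h i ω ∈ polarForms h (q + 1) := by
  intro I hI
  rw [contract_apply] at hI
  by_cases hi : i ∈ I
  · exact absurd (if_pos hi) hI
  · rw [if_neg hi] at hI
    have := hω _ (right_ne_zero_of_mul hI)
    have := Finset.card_insert_of_notMem hi
    omega

theorem polar_smul_mem_polarForms {q : ℕ} (r : PolarRing h) {ω : Form h}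
    (hω : ω ∈ polarForms h q) : r • ω ∈ polarForms h q := by
  intro I hI
  exact hω I (right_ne_zero_of_mul hI)

theorem wedgeV_mem_polarForms (v : Fin n → PolarRing h) {q : ℕ} {ω : Form h}
    (hω : ω ∈ polarForms h (q + 1)) : wedgeV v ω ∈ polarForms h q := by
  rw [wedgeV_apply]
  exact sum_mem fun i _ => polar_smul_mem_polarForms _ (dxWedge_mem_polarForms i hω)

theorem contractV_mem_polarForms (v : Fin n → PolarRing h) {q : ℕ} {ω : Form h}
    (hω : ω ∈ polarForms h q) : contractV v ω ∈ polarForms h (q + 1) := by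
  rw [contractV_apply]
  exact sum_mem fun i _ => polar_smul_mem_polarForms _ (contract_mem_polarForms i hω)

theorem extDeriv_mem_polarForms {q : ℕ} {ω : Form h} (hω : ω ∈ polarForms h (q + 1)) :
    extDeriv h ω ∈ polarForms h q := by
  rw [extDeriv_apply]
  refine sum_mem fun i _ => dxWedge_mem_polarForms i fun I hI => hω I fun h0 => hI ?_
  rw [formDeriv_apply, h0, map_zero]

/-- The volume form `dx₁ ∧ ⋯ ∧ dxₙ`. -/
def volForm (h : MvPolynomial (Fin n) ℂ) : Form h := Pi.single Finset.univ 1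

theorem volForm_mem_polarForms : volForm h ∈ polarForms h 0 := by
  intro I hI
  by_cases hI' : I = Finset.univ
  · rw [hI', Finset.card_univ, Fintype.card_fin, add_zero]
  · exact absurd (Pi.single_eq_of_ne hI' 1) hI

theorem eq_smul_volForm {ω : Form h} (hω : ω ∈ polarForms h 0) :
    ω = ω Finset.univ • volForm h := by
  funext I
  by_cases hI' : I = Finset.univ
  · subst hI'
    rw [Pi.smul_apply, volForm, Pi.single_eq_same, smul_eq_mul, mul_one]
  · rw [Pi.smul_apply, volForm, Pi.single_eq_of_ne hI', smul_zero]
    by_contra hne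
    have := hω I hne
    exact hI' ((Finset.card_eq_iff_eq_univ I).1 (by rw [Fintype.card_fin]; omega))

theorem wedgeV_volForm (v : Fin n → PolarRing h) : wedgeV v (volForm h) = 0 := by
  rw [wedgeV_apply]
  refine Finset.sum_eq_zero fun i _ => ?_
  have : dxWedge h i (volForm h) = 0 := by
    funext I
    rw [dxWedge_apply]
    by_cases hi : i ∈ I
    · rw [if_pos hi, volForm, Pi.single_eq_of_ne, mul_zero, Pi.zero_apply]
      intro he
      exact Finset.notMem_erase i I (he ▸ Finset.mem_univ i)
    · rw [if_neg hi, Pi.zero_apply]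
  rw [this, smul_zero]

theorem dxWedge_contractV_volForm (i : Fin n) (v : Fin n → PolarRing h) :
    dxWedge h i (contractV v (volForm h)) = v i • volForm h := by
  have h1 := contractV_wedgeV v (Pi.single i 1) (volForm h)
  rw [wedgeV_volForm, map_zero, zero_add] at h1
  have h2 : ∀ ω : Form h, wedgeV (Pi.single i 1) ω = dxWedge h i ω := by
    intro ω
    rw [wedgeV_apply, Finset.sum_eq_single i]
    · rw [Pi.single_eq_same, one_smul]
    · intro j _ hj
      rw [Pi.single_eq_of_ne hj, zero_smul]
    · intro hi
      exact absurd (Finset.mem_univ i) hi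
  rw [h2] at h1
  rw [h1, Finset.sum_eq_single i]
  · rw [Pi.single_eq_same, mul_one]
  · intro j _ hj
    rw [Pi.single_eq_of_ne hj, mul_zero]
  · intro hi
    exact absurd (Finset.mem_univ i) hi

theorem wedgeV_contractV_volForm (v w : Fin n → PolarRing h) :
    wedgeV w (contractV v (volForm h)) = (∑ i, v i * w i) • volForm h := by
  have h1 := contractV_wedgeV v w (volForm h)
  rwa [wedgeV_volForm, map_zero, zero_add] at h1

/-! ### Regular and logarithmic forms -/

/-- The functions in the image of the polynomial ring. -/
abbrev polyRange (h : MvPolynomial (Fin n) ℂ) : Subring (PolarRing h) :=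
  (algebraMap (MvPolynomial (Fin n) ℂ) (PolarRing h)).range

theorem wedgeSign_mem (i : Fin n) (I : Finset (Fin n)) : wedgeSign h i I ∈ polyRange h :=
  pow_mem (neg_mem (one_mem _)) _

theorem polarDeriv_mem {r : PolarRing h} (hr : r ∈ polyRange h) (i : Fin n) :
    polarDeriv h i r ∈ polyRange h := by
  obtain ⟨g, rfl⟩ := hr
  exact ⟨_, (polarDeriv_algebraMap h i g).symm⟩

theorem smul_mem_regularForms {r : PolarRing h} (hr : r ∈ polyRange h) {ω : Form h}
    (hω : ω ∈ regularForms h) : r • ω ∈ regularForms h :=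
  fun I => mul_mem hr (hω I)

theorem dxWedge_mem_regularForms (i : Fin n) {ω : Form h} (hω : ω ∈ regularForms h) :
    dxWedge h i ω ∈ regularForms h := by
  intro I
  rw [dxWedge_apply]
  split_ifs
  · exact mul_mem (wedgeSign_mem i I) (hω _)
  · exact zero_mem _

theorem contractV_mem_regularForms {v : Fin n → PolarRing h} (hv : ∀ i, v i ∈ polyRange h)
    {ω : Form h} (hω : ω ∈ regularForms h) : contractV v ω ∈ regularForms h := by
  rw [contractV_apply]
  refine sum_mem fun i _ => smul_mem_regularForms (hv i) fun I => ?_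
  rw [contract_apply]
  split_ifs
  · exact zero_mem _
  · exact mul_mem (wedgeSign_mem i I) (hω _)

theorem extDeriv_mem_regularForms {ω : Form h} (hω : ω ∈ regularForms h) :
    extDeriv h ω ∈ regularForms h := by
  rw [extDeriv_apply]
  exact sum_mem fun i _ => dxWedge_mem_regularForms i fun I => polarDeriv_mem (hω I) i

theorem volForm_mem_regularForms : volForm h ∈ regularForms h := by
  intro I
  by_cases hI : I = Finset.univ
  · subst hI
    rw [volForm, Pi.single_eq_same]
    exact one_mem _
  · rw [volForm, Pi.single_eq_of_ne hI]
    exact zero_mem _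

/-- Since `d(hω) = dh ∧ ω + h dω` and the left side is regular once `hω` is, the condition on `h dω`
may be replaced by the condition on `dh ∧ ω`. The latter involves no derivatives of `ω`. -/
theorem mem_logForms_iff {q : ℕ} {ω : Form h} :
    ω ∈ logForms h q ↔
      ω ∈ polarForms h q ∧ h • ω ∈ regularForms h ∧ dWedge h h ω ∈ regularForms h := by
  have h1 := extDeriv_smul h h ω
  constructor
  · rintro ⟨hp, hr, hd⟩
    refine ⟨hp, hr, ?_⟩
    rw [← add_sub_cancel_right (dWedge h h ω) (h • extDeriv h ω), ← h1]
    exact sub_mem (extDeriv_mem_regularForms hr) hd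
  · rintro ⟨hp, hr, hd⟩
    refine ⟨hp, hr, ?_⟩
    rw [← add_sub_cancel_left (dWedge h h ω) (h • extDeriv h ω), ← h1]
    exact sub_mem (extDeriv_mem_regularForms hr) hd

theorem logForms_le_polarForms (q : ℕ) : logForms h q ≤ polarForms h q := fun _ hω => hω.1

theorem smul_eq_algebraMap_smul (g : MvPolynomial (Fin n) ℂ) (ω : Form h) :
    g • ω = algebraMap _ (PolarRing h) g • ω := by
  funext I
  rw [Pi.smul_apply, Pi.smul_apply, Algebra.smul_def, smul_eq_mul]

theorem extDeriv_mem_logForms {q : ℕ} {ω : Form h} (hω : ω ∈ logForms h (q + 1)) :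
    extDeriv h ω ∈ logForms h q := by
  refine mem_logForms_iff.2 ⟨extDeriv_mem_polarForms hω.1, hω.2.2, ?_⟩
  rw [← neg_neg (dWedge h h (extDeriv h ω)), ← extDeriv_dWedge]
  exact neg_mem (extDeriv_mem_regularForms (mem_logForms_iff.1 hω).2.2)

theorem dWedge_mem_logForms {q : ℕ} (g : MvPolynomial (Fin n) ℂ) {ω : Form h}
    (hω : ω ∈ logForms h (q + 1)) : dWedge h g ω ∈ logForms h q := by
  refine mem_logForms_iff.2 ⟨wedgeV_mem_polarForms _ hω.1, ?_, ?_⟩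
  · rw [← dWedge_smul]
    exact dWedge_mem_regularForms _ _ _ hω.2.1
  · rw [dWedge_eq, dWedge_eq, wedgeV_anticomm]
    exact neg_mem (dWedge_mem_regularForms h g _ (mem_logForms_iff.1 hω).2.2)

end FormCalculus

end LogBrieskorn

end

noncomputable section

namespace LogBrieskorn

section ResidueForms

variable {n : ℕ} {h : MvPolynomial (Fin n) ℂ}

/-! ### The generator of the top relative logarithmic forms -/

/-- The coordinate functions, which are the components of the Euler field. -/
def coordinates (h : MvPolynomial (Fin n) ℂ) (i : Fin n) : PolarRing h :=
  algebraMap (MvPolynomial (Fin n) ℂ) (PolarRing h) (MvPolynomial.X i)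

theorem sum_coordinates_mul (hh : h.IsHomogeneous n) :
    ∑ i, coordinates h i * algebraMap _ (PolarRing h) (MvPolynomial.pderiv i h) =
      algebraMap ℂ (PolarRing h) n * algebraMap _ (PolarRing h) h := by
  have h1 := congrArg (algebraMap _ (PolarRing h)) hh.sum_X_mul_pderiv
  rw [map_sum] at h1
  simp only [map_mul, map_nsmul] at h1
  rw [map_natCast, ← nsmul_eq_mul]
  exact h1

/-- The form `ι_E vol / (n h)`, for `E` the Euler field. -/
def alphaForm (h : MvPolynomial (Fin n) ℂ) : Form h :=
  (algebraMap ℂ (PolarRing h) (n : ℂ)⁻¹ * IsLocalization.Away.invSelf h) •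
    contractV (coordinates h) (volForm h)

theorem algebraMap_natCast_inv_mul (hn : 0 < n) :
    algebraMap ℂ (PolarRing h) (n : ℂ)⁻¹ * algebraMap ℂ (PolarRing h) n = 1 := by
  rw [← map_mul, inv_mul_cancel₀ (Nat.cast_ne_zero.2 hn.ne'), map_one]

/-- One has `dh ∧ ι_E vol = E(h) vol`, and `E(h) = n h` by homogeneity. -/
theorem dWedge_alphaForm (hn : 0 < n) (hh : h.IsHomogeneous n) :
    dWedge h h (alphaForm h) = volForm h := by
  rw [alphaForm, map_smul, dWedge_eq, wedgeV_contractV_volForm, sum_coordinates_mul hh, smul_smul]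
  have : algebraMap ℂ (PolarRing h) (n : ℂ)⁻¹ * IsLocalization.Away.invSelf h *
      (algebraMap ℂ (PolarRing h) n * algebraMap _ (PolarRing h) h) =
      (algebraMap ℂ (PolarRing h) (n : ℂ)⁻¹ * algebraMap ℂ (PolarRing h) n) *
        (algebraMap _ (PolarRing h) h * IsLocalization.Away.invSelf h) := by ring
  rw [this, algebraMap_natCast_inv_mul hn, algebraMap_mul_invSelf, one_mul, one_smul]

theorem algebraMap_complex_mem (z : ℂ) : algebraMap ℂ (PolarRing h) z ∈ polyRange h :=
  ⟨MvPolynomial.C z, algebraMap_C h z⟩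

theorem coordinates_mem (i : Fin n) : coordinates h i ∈ polyRange h := ⟨_, rfl⟩

theorem smul_alphaForm_mem : h • alphaForm h ∈ regularForms h := by
  have h1 : h • alphaForm h =
      algebraMap ℂ (PolarRing h) (n : ℂ)⁻¹ • contractV (coordinates h) (volForm h) := by
    rw [smul_eq_algebraMap_smul, alphaForm, smul_smul, mul_left_comm, algebraMap_mul_invSelf,
      mul_one]
  rw [h1]
  exact smul_mem_regularForms (algebraMap_complex_mem _)
    (contractV_mem_regularForms coordinates_mem volForm_mem_regularForms)

theorem alphaForm_mem_logForms (hn : 0 < n) (hh : h.IsHomogeneous n) :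
    alphaForm h ∈ logForms h 1 := by
  refine mem_logForms_iff.2 ⟨polar_smul_mem_polarForms _
    (contractV_mem_polarForms _ volForm_mem_polarForms), smul_alphaForm_mem, ?_⟩
  rw [dWedge_alphaForm hn hh]
  exact volForm_mem_regularForms

/-- The coefficient of `dh ∧ ω` at the volume form. -/
def topCoeff (h : MvPolynomial (Fin n) ℂ) : Form h →ₗ[PolarRing h] PolarRing h :=
  LinearMap.proj Finset.univ ∘ₗ dWedge h h

theorem topCoeff_apply (ω : Form h) : topCoeff h ω = dWedge h h ω Finset.univ := rfl

theorem volForm_univ : volForm h Finset.univ = 1 := Pi.single_eq_same _ _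

theorem topCoeff_alphaForm (hn : 0 < n) (hh : h.IsHomogeneous n) :
    topCoeff h (alphaForm h) = 1 := by
  rw [topCoeff_apply, dWedge_alphaForm hn hh, volForm_univ]

theorem topCoeff_smul_alphaForm (hn : 0 < n) (hh : h.IsHomogeneous n)
    (g : MvPolynomial (Fin n) ℂ) :
    topCoeff h (g • alphaForm h) = algebraMap _ (PolarRing h) g := by
  rw [smul_eq_algebraMap_smul, map_smul, topCoeff_alphaForm hn hh, smul_eq_mul, mul_one]

theorem topCoeff_mem {ω : Form h} (hω : ω ∈ logForms h 1) : topCoeff h ω ∈ polyRange h :=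
  (mem_logForms_iff.1 hω).2.2 _

/-- The systems of forms defining the Brieskorn lattice and the Gauß–Manin system. -/
structure IsFormSystem (h : MvPolynomial (Fin n) ℂ)
    (Ω : ℕ → Submodule (MvPolynomial (Fin n) ℂ) (Form h)) : Prop where
  log_le : ∀ q, logForms h q ≤ Ω q
  dlog : ∀ ω ∈ Ω 1, topCoeff h ω = 0 → ∃ η ∈ Ω 2, dlogWedge h η = ω

/-- When `dh ∧ ω = 0`, the Clifford relation for the Euler field reads `dh ∧ ι_E ω = n h ω`. It
shows that a relative top form is determined by its coefficient under `dh ∧`. -/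
theorem dlogWedge_contractV (hn : 0 < n) (hh : h.IsHomogeneous n) {ω : Form h}
    (hω : ω ∈ polarForms h 1) (h0 : topCoeff h ω = 0) :
    dWedge h h (algebraMap ℂ (PolarRing h) (n : ℂ)⁻¹ • contractV (coordinates h) ω) = h • ω := by
  have h1 : dWedge h h ω = 0 := by
    have h3 : dWedge h h ω ∈ polarForms h 0 := wedgeV_mem_polarForms _ hω
    rw [eq_smul_volForm h3, ← topCoeff_apply, h0, zero_smul]
  have h2 := contractV_wedgeV (coordinates h)
    (fun i => algebraMap _ (PolarRing h) (MvPolynomial.pderiv i h)) ω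
  rw [← dWedge_eq, h1, map_zero, zero_add, sum_coordinates_mul hh] at h2
  rw [map_smul, h2, smul_smul, ← mul_assoc, algebraMap_natCast_inv_mul hn, one_mul,
    smul_eq_algebraMap_smul]

theorem dlogWedge_apply (ω : Form h) :
    dlogWedge h ω = (IsLocalization.Away.invSelf h : PolarRing h) • dWedge h h ω := rfl

theorem dlogWedge_eq {η ω : Form h} (hη : dWedge h h η = h • ω) : dlogWedge h η = ω := by
  rw [dlogWedge_apply, hη, smul_eq_algebraMap_smul, smul_smul, mul_comm, algebraMap_mul_invSelf,
    one_smul]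

theorem isFormSystem_polarForms (hn : 0 < n) (hh : h.IsHomogeneous n) :
    IsFormSystem h (polarForms h) where
  log_le := logForms_le_polarForms
  dlog _ hω h0 := ⟨_, polar_smul_mem_polarForms _ (contractV_mem_polarForms _ hω),
    dlogWedge_eq (dlogWedge_contractV hn hh hω h0)⟩

theorem polar_smul_smul_comm (g : MvPolynomial (Fin n) ℂ) (r : PolarRing h) (ω : Form h) :
    g • r • ω = r • g • ω := by
  rw [smul_eq_algebraMap_smul, smul_eq_algebraMap_smul, smul_comm]

theorem linearMap_smul (T : Form h →ₗ[PolarRing h] Form h) (g : MvPolynomial (Fin n) ℂ)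
    (ω : Form h) : T (g • ω) = g • T ω := by
  rw [smul_eq_algebraMap_smul, smul_eq_algebraMap_smul, map_smul]

theorem isFormSystem_logForms (hn : 0 < n) (hh : h.IsHomogeneous n) :
    IsFormSystem h (logForms h) where
  log_le _ := le_rfl
  dlog ω hω h0 := by
    have h1 := dlogWedge_contractV hn hh hω.1 h0
    refine ⟨_, mem_logForms_iff.2 ⟨polar_smul_mem_polarForms _ (contractV_mem_polarForms _ hω.1),
      ?_, ?_⟩, dlogWedge_eq h1⟩
    · rw [polar_smul_smul_comm, ← linearMap_smul]
      exact smul_mem_regularForms (algebraMap_complex_mem _)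
        (contractV_mem_regularForms coordinates_mem hω.2.1)
    · rw [h1]
      exact hω.2.1

/-! ### The relations given by admissible vector fields -/

/-- A polynomial vector field as a vector field with polar coefficients. -/
def polarField (h : MvPolynomial (Fin n) ℂ) (ξ : Fin n → MvPolynomial (Fin n) ℂ) (i : Fin n) :
    PolarRing h := algebraMap _ (PolarRing h) (ξ i)

theorem sum_polarField_mul (ξ : Fin n → MvPolynomial (Fin n) ℂ) (g : MvPolynomial (Fin n) ℂ) :
    ∑ i, polarField h ξ i * algebraMap _ (PolarRing h) (MvPolynomial.pderiv i g) =
      algebraMap _ (PolarRing h) (lieDeriv ξ g) := by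
  rw [lieDeriv, map_sum]
  exact Finset.sum_congr rfl fun i _ => (map_mul _ _ _).symm

variable {ξ : Fin n → MvPolynomial (Fin n) ℂ}

/-- The Clifford relation for `ξ` has zero right side because `ξ(h) = 0`, and `dh ∧ α = vol`. -/
theorem dWedge_contractV_alphaForm (hn : 0 < n) (hh : h.IsHomogeneous n)
    (hξ : IsAdmissible h ξ) :
    dWedge h h (contractV (polarField h ξ) (alphaForm h)) =
      -contractV (polarField h ξ) (volForm h) := by
  have h1 := contractV_wedgeV (polarField h ξ)
    (fun i => algebraMap _ (PolarRing h) (MvPolynomial.pderiv i h)) (alphaForm h)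
  have h0 : lieDeriv ξ h = 0 := hξ.annihilates
  rw [← dWedge_eq, dWedge_alphaForm hn hh, sum_polarField_mul, h0, map_zero, zero_smul] at h1
  exact eq_neg_of_add_eq_zero_right h1

theorem contractV_alphaForm_mem_logForms (hn : 0 < n) (hh : h.IsHomogeneous n)
    (hξ : IsAdmissible h ξ) : contractV (polarField h ξ) (alphaForm h) ∈ logForms h 2 := by
  refine mem_logForms_iff.2
    ⟨contractV_mem_polarForms _ (alphaForm_mem_logForms hn hh).1, ?_, ?_⟩
  · rw [← linearMap_smul]
    exact contractV_mem_regularForms (fun i => ⟨ξ i, rfl⟩) smul_alphaForm_mem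
  · rw [dWedge_contractV_alphaForm hn hh hξ]
    exact neg_mem (contractV_mem_regularForms (fun i => ⟨ξ i, rfl⟩) volForm_mem_regularForms)

theorem extDeriv_univ (ζ : Form h) :
    extDeriv h ζ Finset.univ = ∑ j, polarDeriv h j (dxWedge h j ζ Finset.univ) := by
  rw [extDeriv_apply, Finset.sum_apply]
  refine Finset.sum_congr rfl fun j _ => ?_
  rw [← formDeriv_dxWedge, formDeriv_apply]

theorem dxWedge_contractV_volForm_univ (i : Fin n) (v : Fin n → PolarRing h) :
    dxWedge h i (contractV v (volForm h)) Finset.univ = v i := by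
  rw [dxWedge_contractV_volForm, Pi.smul_apply, volForm_univ, smul_eq_mul, mul_one]

/-- Exchanging `dh` and `df` gives a sign, which cancels the one in `dh ∧ ι_ξ α = -ι_ξ vol`. What
remains is `df ∧ g ι_ξ vol = g ξ(f) vol`. -/
theorem topCoeff_dWedge_contractV (hn : 0 < n) (hh : h.IsHomogeneous n)
    (hξ : IsAdmissible h ξ) (f g : MvPolynomial (Fin n) ℂ) :
    topCoeff h (dWedge h f (g • contractV (polarField h ξ) (alphaForm h))) =
      algebraMap _ (PolarRing h) (lieDeriv ξ f * g) := by
  rw [topCoeff_apply, dWedge_eq, dWedge_eq, wedgeV_anticomm, ← dWedge_eq, ← dWedge_eq,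
    linearMap_smul (dWedge h h), dWedge_contractV_alphaForm hn hh hξ, smul_neg, map_neg, neg_neg,
    linearMap_smul, dWedge_eq, wedgeV_contractV_volForm, sum_polarField_mul,
    smul_eq_algebraMap_smul, Pi.smul_apply, Pi.smul_apply, volForm_univ, smul_eq_mul, smul_eq_mul,
    mul_one, map_mul, mul_comm]

/-- Moving `dh ∧` past `d` leaves `d(g ι_ξ vol)`, the divergence of `g ξ`, which is `ξ(g)`. Together
with the formula for `df ∧` this shows that the twisted differential of `g ι_ξ α` encodes `θ ξ(g) -
ξ(f) g`. -/
theorem topCoeff_extDeriv_contractV (hn : 0 < n) (hh : h.IsHomogeneous n)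
    (hξ : IsAdmissible h ξ) (g : MvPolynomial (Fin n) ℂ) :
    topCoeff h (extDeriv h (g • contractV (polarField h ξ) (alphaForm h))) =
      algebraMap _ (PolarRing h) (lieDeriv ξ g) := by
  have h1 : dWedge h h (extDeriv h (g • contractV (polarField h ξ) (alphaForm h))) =
      extDeriv h (g • contractV (polarField h ξ) (volForm h)) := by
    rw [← neg_inj, ← extDeriv_dWedge, linearMap_smul, dWedge_contractV_alphaForm hn hh hξ, smul_neg,
      map_neg]
  rw [topCoeff_apply, h1, extDeriv_univ]
  have h2 : ∀ j, polarDeriv h j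
      (dxWedge h j (g • contractV (polarField h ξ) (volForm h)) Finset.univ) =
      algebraMap _ (PolarRing h) (ξ j * MvPolynomial.pderiv j g + g * MvPolynomial.pderiv j (ξ j)) := by
    intro j
    rw [linearMap_smul, smul_eq_algebraMap_smul, Pi.smul_apply, dxWedge_contractV_volForm_univ,
      polarField, smul_eq_mul, ← map_mul, polarDeriv_algebraMap, Derivation.leibniz, smul_eq_mul,
      smul_eq_mul, add_comm]
  rw [Finset.sum_congr rfl fun j _ => h2 j, ← map_sum, Finset.sum_add_distrib, ← Finset.mul_sum,
    hξ.divergence, mul_zero, add_zero, lieDeriv]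

/-! ### The image of the relations under `dh ∧` -/

/-- The value at `θ = z` of a Laurent polynomial. -/
def evalTheta (h : MvPolynomial (Fin n) ℂ) (z : ℂ) : LaurentForm h →ₗ[ℂ] Form h :=
  Finsupp.lsum ℂ fun k : ℤ => z ^ k • LinearMap.id

theorem evalTheta_single (z : ℂ) (k : ℤ) (ω : Form h) :
    evalTheta h z (Finsupp.single k ω) = z ^ k • ω := by
  simp [evalTheta]

theorem evalTheta_coeffwise (z : ℂ) (T : Form h →ₗ[ℂ] Form h) (c : LaurentForm h) :
    evalTheta h z (coeffwise h T c) = T (evalTheta h z c) := by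
  induction c using Finsupp.induction_linear with
  | zero => simp
  | add a b ha hb => rw [map_add, map_add, ha, hb, map_add, map_add]
  | single k ω =>
    rw [coeffwise, Finsupp.mapRange.linearMap_apply, Finsupp.mapRange_single, evalTheta_single,
      evalTheta_single, map_smul]

theorem thetaEquiv_single (k : ℤ) (ω : Form h) :
    thetaEquiv h (Finsupp.single k ω) = Finsupp.single (k + 1) ω := by
  simp [thetaEquiv, Finsupp.domLCongr_apply]

theorem evalTheta_thetaEquiv {z : ℂ} (hz : z ≠ 0) (c : LaurentForm h) :
    evalTheta h z (thetaEquiv h c) = z • evalTheta h z c := by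
  induction c using Finsupp.induction_linear with
  | zero => simp
  | add a b ha hb => rw [map_add, map_add, ha, hb, map_add, smul_add]
  | single k ω =>
    rw [thetaEquiv_single, evalTheta_single, evalTheta_single, smul_smul, zpow_add_one₀ hz, mul_comm]

theorem evalTheta_twistedDiff {z : ℂ} (hz : z ≠ 0) (f : MvPolynomial (Fin n) ℂ)
    (c : LaurentForm h) :
    evalTheta h z (twistedDiff h f c) =
      z • extDeriv h (evalTheta h z c) - dWedge h f (evalTheta h z c) := by
  rw [twistedDiff, LinearMap.sub_apply, map_sub, LinearMap.comp_apply, LinearEquiv.coe_coe,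
    evalTheta_thetaEquiv hz, evalTheta_coeffwise, evalTheta_coeffwise,
    LinearMap.restrictScalars_apply]

theorem evalTheta_mem {A : Submodule (MvPolynomial (Fin n) ℂ) (Form h)} {c : LaurentForm h}
    (hc : c ∈ laurent h A) (z : ℂ) : evalTheta h z c ∈ A := by
  have : evalTheta h z c ∈ A.restrictScalars ℂ := by
    rw [evalTheta, Finsupp.lsum_apply]
    exact sum_mem fun k _ => Submodule.smul_mem _ _ (hc k)
  exact this

theorem dWedge_univ (g : MvPolynomial (Fin n) ℂ) (ζ : Form h) :
    dWedge h g ζ Finset.univ =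
      ∑ j, algebraMap _ (PolarRing h) (MvPolynomial.pderiv j g) * dxWedge h j ζ Finset.univ := by
  rw [dWedge_eq, wedgeV_apply, Finset.sum_apply]
  rfl

/-- Wedging with `dh` anticommutes with both `d` and `df ∧`. It remains to differentiate the form
`dh ∧ η` of degree `n - 1`, which is a vector field with components `dxⱼ ∧ dh ∧ η`, and the result
is its twisted divergence. -/
theorem topCoeff_twisted (z : ℂ) (f : MvPolynomial (Fin n) ℂ) (η : Form h) :
    topCoeff h (z • extDeriv h η - dWedge h f η) =
      -∑ j, (z • polarDeriv h j (dxWedge h j (dWedge h h η) Finset.univ) -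
        algebraMap _ (PolarRing h) (MvPolynomial.pderiv j f) *
          dxWedge h j (dWedge h h η) Finset.univ) := by
  have h1 : dWedge h h (z • extDeriv h η - dWedge h f η) =
      -(z • extDeriv h (dWedge h h η) - dWedge h f (dWedge h h η)) := by
    rw [map_sub, extDeriv_dWedge, smul_neg, dWedge_eq, dWedge_eq,
      wedgeV_anticomm (fun i => algebraMap _ (PolarRing h) (MvPolynomial.pderiv i h))]
    have h2 : dWedge h h (z • extDeriv h η) = z • dWedge h h (extDeriv h η) :=
      ((dWedge h h).restrictScalars ℂ).map_smul z _
    rw [← dWedge_eq, ← dWedge_eq, h2]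
    abel
  rw [topCoeff_apply, h1, Pi.neg_apply, Pi.sub_apply, Pi.smul_apply, extDeriv_univ, dWedge_univ,
    Finset.smul_sum, Finset.sum_sub_distrib]

theorem topCoeff_dlogWedge (η : Form h) : topCoeff h (dlogWedge h η) = 0 := by
  rw [topCoeff_apply, dlogWedge_apply, map_smul, dWedge_eq, wedgeV_self, smul_zero, Pi.zero_apply]

/-- The image of a relation under `dh ∧` is a twisted divergence modulo `h - t₀`. -/
theorem exists_of_mem_relations {Ω : ℕ → Submodule (MvPolynomial (Fin n) ℂ) (Form h)} {t₀ : ℂ}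
    {f : MvPolynomial (Fin n) ℂ} {x : LaurentForm h} (hx : x ∈ relations h f Ω t₀) {z : ℂ}
    (hz : z ≠ 0) :
    ∃ η ∈ Ω 2, ∃ ω ∈ Ω 1, topCoeff h (evalTheta h z x) =
      -∑ j, (z • polarDeriv h j (dxWedge h j (dWedge h h η) Finset.univ) -
        algebraMap _ (PolarRing h) (MvPolynomial.pderiv j f) *
          dxWedge h j (dWedge h h η) Finset.univ) +
      algebraMap _ (PolarRing h) (h - MvPolynomial.C t₀) * topCoeff h ω := by
  obtain ⟨x', hx', _, ⟨c₃, hc₃, rfl⟩, rfl⟩ := Submodule.mem_sup.1 hx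
  obtain ⟨_, ⟨c₁, hc₁, rfl⟩, _, ⟨c₂, hc₂, rfl⟩, rfl⟩ := Submodule.mem_sup.1 hx'
  refine ⟨_, evalTheta_mem hc₁ z, _, evalTheta_mem hc₃ z, ?_⟩
  rw [map_add, map_add, map_add, map_add, evalTheta_twistedDiff hz, topCoeff_twisted,
    evalTheta_coeffwise, topCoeff_dlogWedge, add_zero, evalTheta_coeffwise]
  congr 1
  change topCoeff h ((h - MvPolynomial.C t₀) • evalTheta h z c₃) = _
  rw [smul_eq_algebraMap_smul, map_smul, smul_eq_mul]

end ResidueForms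

end LogBrieskorn

end

noncomputable section

namespace LogBrieskorn

open Polynomial

section Fibre

variable {n : ℕ} {h : MvPolynomial (Fin n) ℂ} {c : ℂ[X]} {a : Fin n → ℂ}
  {Ω : ℕ → Submodule (MvPolynomial (Fin n) ℂ) (Form h)} {t₀ : ℂ}

/-- The two fibres considered: that of the logarithmic lattice at `0`, and those of the
Gauß–Manin system outside `0`. -/
def IsFibre (h : MvPolynomial (Fin n) ℂ)
    (Ω : ℕ → Submodule (MvPolynomial (Fin n) ℂ) (Form h)) (t₀ : ℂ) : Prop :=
  (Ω = logForms h ∧ t₀ = 0) ∨ (Ω = polarForms h ∧ t₀ ≠ 0)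

theorem IsFibre.isFormSystem (hΩ : IsFibre h Ω t₀) (hn : 0 < n) (hh : h.IsHomogeneous n) :
    IsFormSystem h Ω := by
  rcases hΩ with ⟨rfl, _⟩ | ⟨rfl, _⟩
  · exact isFormSystem_logForms hn hh
  · exact isFormSystem_polarForms hn hh

/-! ### The relations are mapped into the image of `fibreOp` -/

/-- The vector field attached to `dh ∧ η` annihilates `h`, because `dh ∧ dh = 0`. -/
theorem sum_deriv_mul_dxWedge (η : Form h) :
    ∑ j, algebraMap _ (PolarRing h) (MvPolynomial.pderiv j h) *
      dxWedge h j (dWedge h h η) Finset.univ = 0 := by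
  rw [← dWedge_univ, dWedge_eq, wedgeV_self, Pi.zero_apply]

/-- Logarithmic forms need no denominator, so `r = 0` there, and `0 ^ 0 = 1` satisfies the
nonvanishing condition although `t₀ = 0`. For polar forms a common power of `h` is cleared, and `t₀
^ r ≠ 0` since `t₀ ≠ 0`. -/
theorem IsFibre.exists_denominator (hΩ : IsFibre h Ω t₀) {η ω : Form h} (hη : η ∈ Ω 2)
    (hω : ω ∈ Ω 1) :
    ∃ (r : ℕ) (ξ : Fin n → MvPolynomial (Fin n) ℂ) (w : MvPolynomial (Fin n) ℂ), t₀ ^ r ≠ 0 ∧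
      (∀ j, algebraMap _ (PolarRing h) (ξ j) =
        algebraMap _ (PolarRing h) h ^ r * dxWedge h j (dWedge h h η) Finset.univ) ∧
      algebraMap _ (PolarRing h) w = algebraMap _ (PolarRing h) h ^ r * topCoeff h ω := by
  rcases hΩ with ⟨rfl, rfl⟩ | ⟨rfl, ht⟩
  · have h1 : ∀ j, dxWedge h j (dWedge h h η) Finset.univ ∈ polyRange h := fun j =>
      dxWedge_mem_regularForms j (mem_logForms_iff.1 hη).2.2 _
    choose ξ hξ using h1
    obtain ⟨w, hw⟩ := topCoeff_mem hω
    refine ⟨0, ξ, w, by simp, fun j => ?_, ?_⟩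
    · rw [hξ, pow_zero, one_mul]
    · rw [hw, pow_zero, one_mul]
  · obtain ⟨⟨_, r, rfl⟩, hb⟩ := IsLocalization.exist_integer_multiples_of_finite
      (Submonoid.powers h) (fun o : Option (Fin n) => o.elim (topCoeff h ω)
        fun j => dxWedge h j (dWedge h h η) Finset.univ)
    choose ξ hξ using fun j => hb (some j)
    obtain ⟨w, hw⟩ := hb none
    refine ⟨r, ξ, w, pow_ne_zero _ ht, fun j => ?_, ?_⟩
    · rw [hξ, Algebra.smul_def, ← map_pow]
      rfl
    · rw [hw, Algebra.smul_def, ← map_pow]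
      rfl

/-- Under `dh ∧` a relation becomes a twisted divergence of a field annihilating `h`, plus a
multiple of `h - t₀`. The functional kills the divergence and turns multiplication by `h - t₀` into
`fibreOp`. -/
theorem exists_fibreOp (H : IsCapelli h c) (ha : MvPolynomial.eval a h ≠ 0)
    (hΩ : IsFibre h Ω t₀) {x : LaurentForm h} (hx : x ∈ relations h (linearForm a) Ω t₀) {z : ℂ}
    (hz : z ≠ 0) {g : MvPolynomial (Fin n) ℂ}
    (hg : topCoeff h (evalTheta h z x) = algebraMap _ (PolarRing h) g) :
    ∃ p, capelliPhi ha z g = fibreOp h a c t₀ z p := by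
  have hh0 : h ≠ 0 := by
    rintro rfl
    simp at ha
  have hinj := algebraMap_polarRing_injective hh0
  obtain ⟨η, hη, ω, hω, hx⟩ := exists_of_mem_relations hx hz
  obtain ⟨r, ξ, w, hr, hξ, hw⟩ := hΩ.exists_denominator hη hω
  set v : Fin n → PolarRing h := fun j => dxWedge h j (dWedge h h η) Finset.univ with hv
  have hv0 : ∑ j, algebraMap _ (PolarRing h) (MvPolynomial.pderiv j h) * v j = 0 :=
    sum_deriv_mul_dxWedge η
  have hξ0 : ∑ j, ξ j * MvPolynomial.pderiv j h = 0 := by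
    apply hinj
    rw [map_sum, map_zero, ← mul_zero (algebraMap _ (PolarRing h) h ^ r), ← hv0, Finset.mul_sum]
    refine Finset.sum_congr rfl fun j _ => ?_
    rw [map_mul, hξ]
    ring
  -- Multiplying the field `v` by `hʳ` adds only a multiple of `v(h) = 0` to its divergence, so
  -- denominators may be cleared.
  have hdiv : algebraMap _ (PolarRing h)
      (∑ j, (MvPolynomial.C z * MvPolynomial.pderiv j (ξ j) - MvPolynomial.C (a j) * ξ j)) =
      algebraMap _ (PolarRing h) h ^ r *
        ∑ j, (z • polarDeriv h j (v j) -
          algebraMap _ (PolarRing h) (MvPolynomial.pderiv j (linearForm a)) * v j) := by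
    have h1 : ∀ j, algebraMap _ (PolarRing h)
        (MvPolynomial.C z * MvPolynomial.pderiv j (ξ j) - MvPolynomial.C (a j) * ξ j) =
        algebraMap _ (PolarRing h) h ^ r * (z • polarDeriv h j (v j) -
          algebraMap _ (PolarRing h) (MvPolynomial.pderiv j (linearForm a)) * v j) +
        algebraMap ℂ (PolarRing h) z * (r * algebraMap _ (PolarRing h) h ^ (r - 1)) *
          (algebraMap _ (PolarRing h) (MvPolynomial.pderiv j h) * v j) := by
      intro j
      rw [map_sub, map_mul, map_mul, ← polarDeriv_algebraMap, hξ, Derivation.leibniz,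
        Derivation.leibniz_pow, polarDeriv_algebraMap, pderiv_linearForm, algebraMap_C,
        Algebra.smul_def z, smul_eq_mul, smul_eq_mul, smul_eq_mul, nsmul_eq_mul]
      ring
    rw [map_sum, Finset.sum_congr rfl fun j _ => h1 j, Finset.sum_add_distrib, ← Finset.mul_sum,
      ← Finset.mul_sum, hv0, mul_zero, add_zero]
  have hgr : h ^ r * g = -∑ j, (MvPolynomial.C z * MvPolynomial.pderiv j (ξ j) -
      MvPolynomial.C (a j) * ξ j) + (h - MvPolynomial.C t₀) * w := by
    apply hinj
    rw [map_add, map_neg, hdiv, map_mul, map_mul, hw, ← hg, hx, map_pow]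
    ring
  -- Modulo `h - t₀` the factor `hʳ` on the left is the scalar `t₀ʳ`, which is nonzero and is
  -- divided out at the end.
  obtain ⟨w', hw'⟩ := sub_dvd_pow_sub_pow h (MvPolynomial.C t₀) r
  have hg' : t₀ ^ r • g = -∑ j, (MvPolynomial.C z * MvPolynomial.pderiv j (ξ j) -
      MvPolynomial.C (a j) * ξ j) + (h - MvPolynomial.C t₀) * (w - w' * g) := by
    rw [MvPolynomial.smul_eq_C_mul, map_pow]
    linear_combination hgr - g * hw'
  have hΦ := congrArg (capelliPhi ha z) hg'
  rw [map_smul, map_add, map_neg, capelliPhi_divergence ha H hz ξ hξ0, neg_zero, zero_add,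
    H.capelliPhi_fibre ha] at hΦ
  refine ⟨(t₀ ^ r)⁻¹ • capelliPhi ha z (w - w' * g), ?_⟩
  have h2 := fibreOp_smul_add (h := h) (a := a) (c := c) t₀ z (t₀ ^ r)⁻¹
    (capelliPhi ha z (w - w' * g)) 0
  have h3 : fibreOp h a c t₀ z 0 = 0 := by simp [fibreOp]
  rw [add_zero, h3, add_zero] at h2
  rw [Polynomial.smul_eq_C_mul, h2, ← hΦ, ← Polynomial.smul_eq_C_mul, smul_smul,
    inv_mul_cancel₀ hr, one_smul]

/-! ### Classes of forms -/

variable {f : MvPolynomial (Fin n) ℂ}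

theorem thetaEquiv_zpow_single (m k : ℤ) (ω : Form h) :
    (thetaEquiv h ^ m) (Finsupp.single k ω) = Finsupp.single (k + m) ω := by
  have hs : ∀ k : ℤ, (thetaEquiv h).symm (Finsupp.single k ω) = Finsupp.single (k - 1) ω := by
    intro k
    rw [LinearEquiv.symm_apply_eq, thetaEquiv_single, sub_add_cancel]
  induction m generalizing k with
  | zero => rw [zpow_zero, add_zero]; rfl
  | succ m ih =>
    rw [zpow_add, zpow_one, LinearEquiv.mul_apply, thetaEquiv_single, ih]
    congr 1
    ring
  | pred m ih =>
    rw [zpow_sub, zpow_one, LinearEquiv.mul_apply]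
    change (thetaEquiv h ^ (-(m : ℤ))) ((thetaEquiv h).symm _) = _
    rw [hs, ih]
    congr 1
    ring

theorem nablaForm_single (k : ℤ) (ω : Form h) :
    nablaForm h f (Finsupp.single k ω) =
      (k : ℂ) • Finsupp.single k ω + Finsupp.single (k - 1) (f • ω) := by
  refine Finsupp.ext fun l => ?_
  rw [nablaForm_apply, Finsupp.add_apply, Finsupp.smul_apply, Finsupp.single_apply,
    Finsupp.single_apply, Finsupp.single_apply]
  congr 1
  · by_cases hkl : k = l
    · rw [if_pos hkl, hkl]
    · rw [if_neg hkl, smul_zero, smul_zero]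
  · by_cases hkl : k = l + 1
    · rw [if_pos hkl, if_pos (by omega)]
    · rw [if_neg hkl, if_neg (by omega), smul_zero]

theorem theta_mkQ (x : LaurentForm h) :
    theta h f Ω t₀ ((relations h f Ω t₀).mkQ x) = (relations h f Ω t₀).mkQ (thetaEquiv h x) := rfl

theorem nabla_mkQ (x : LaurentForm h) :
    nabla h f Ω t₀ ((relations h f Ω t₀).mkQ x) = (relations h f Ω t₀).mkQ (nablaForm h f x) := rfl

theorem theta_zpow_mkQ (m : ℤ) (x : LaurentForm h) :
    (theta h f Ω t₀ ^ m) ((relations h f Ω t₀).mkQ x) =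
      (relations h f Ω t₀).mkQ ((thetaEquiv h ^ m) x) := by
  induction m generalizing x with
  | zero => rfl
  | succ m ih =>
    rw [zpow_add, zpow_add, zpow_one, zpow_one, LinearEquiv.mul_apply, theta_mkQ, ih]
    rfl
  | pred m ih =>
    rw [zpow_sub, zpow_sub, zpow_one, zpow_one, LinearEquiv.mul_apply, LinearEquiv.mul_apply]
    change (theta h f Ω t₀ ^ (-(m : ℤ))) ((theta h f Ω t₀).symm _) =
      (relations h f Ω t₀).mkQ ((thetaEquiv h ^ (-(m : ℤ))) ((thetaEquiv h).symm x))
    rw [← ih]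
    rfl

theorem aeval_nabla_mkQ (p : ℂ[X]) (x : LaurentForm h) :
    aeval (nabla h f Ω t₀) p ((relations h f Ω t₀).mkQ x) =
      (relations h f Ω t₀).mkQ (aeval (nablaForm h f) p x) := by
  induction p using Polynomial.induction_on' with
  | add p q hp hq => rw [map_add, map_add, LinearMap.add_apply, LinearMap.add_apply, hp, hq, map_add]
  | monomial k r =>
    rw [aeval_monomial, aeval_monomial, ← Algebra.smul_def, ← Algebra.smul_def,
      LinearMap.smul_apply, LinearMap.smul_apply, map_smul]
    congr 1
    induction k generalizing x with
    | zero => rfl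
    | succ k ih =>
      rw [pow_succ, pow_succ, Module.End.mul_apply, Module.End.mul_apply, nabla_mkQ, ih]

theorem nabla_theta (x : GaussManin h f Ω t₀) :
    nabla h f Ω t₀ (theta h f Ω t₀ x) =
      theta h f Ω t₀ (nabla h f Ω t₀ x) + theta h f Ω t₀ x := by
  obtain ⟨y, rfl⟩ := (relations h f Ω t₀).mkQ_surjective x
  rw [theta_mkQ, nabla_mkQ, nabla_mkQ, theta_mkQ, ← map_add]
  congr 1
  refine Finsupp.ext fun k => ?_
  rw [nablaForm_apply, Finsupp.add_apply, thetaEquiv_apply, thetaEquiv_apply, thetaEquiv_apply,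
    nablaForm_apply, add_sub_cancel_right, sub_add_cancel, Int.cast_sub, Int.cast_one, sub_smul,
    one_smul]
  abel

/-- The class of `g α`, where `α = ι_E vol / (n h)`. -/
def alphaClass (h f : MvPolynomial (Fin n) ℂ)
    (Ω : ℕ → Submodule (MvPolynomial (Fin n) ℂ) (Form h)) (t₀ : ℂ) :
    MvPolynomial (Fin n) ℂ →ₗ[ℂ] GaussManin h f Ω t₀ :=
  (relations h f Ω t₀).mkQ ∘ₗ Finsupp.lsingle 0 ∘ₗ
    (LinearMap.toSpanSingleton (MvPolynomial (Fin n) ℂ) (Form h) (alphaForm h)).restrictScalars ℂ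

theorem alphaClass_apply (g : MvPolynomial (Fin n) ℂ) :
    alphaClass h f Ω t₀ g = (relations h f Ω t₀).mkQ (Finsupp.single 0 (g • alphaForm h)) := rfl

theorem theta_zpow_alphaClass (m : ℤ) (g : MvPolynomial (Fin n) ℂ) :
    (theta h f Ω t₀ ^ m) (alphaClass h f Ω t₀ g) =
      (relations h f Ω t₀).mkQ (Finsupp.single m (g • alphaForm h)) := by
  rw [alphaClass_apply, theta_zpow_mkQ, thetaEquiv_zpow_single, zero_add]

theorem theta_nabla_alphaClass (g : MvPolynomial (Fin n) ℂ) :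
    theta h f Ω t₀ (nabla h f Ω t₀ (alphaClass h f Ω t₀ g)) = alphaClass h f Ω t₀ (f * g) := by
  rw [alphaClass_apply, nabla_mkQ, nablaForm_single, Int.cast_zero, zero_smul, zero_add, theta_mkQ,
    thetaEquiv_single, smul_smul, alphaClass_apply]
  rfl

theorem single_mem_laurent {A : Submodule (MvPolynomial (Fin n) ℂ) (Form h)} {ω : Form h}
    (hω : ω ∈ A) (k : ℤ) : Finsupp.single k ω ∈ laurent h A := by
  intro l
  rw [Finsupp.single_apply]
  split_ifs
  · exact hω
  · exact zero_mem _

theorem coeffwise_single (T : Form h →ₗ[ℂ] Form h) (k : ℤ) (ω : Form h) :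
    coeffwise h T (Finsupp.single k ω) = Finsupp.single k (T ω) := by
  rw [coeffwise, Finsupp.mapRange.linearMap_apply, Finsupp.mapRange_single]

theorem IsFormSystem.single_mem_relations (hS : IsFormSystem h Ω) {ω : Form h} (hω : ω ∈ Ω 1)
    (h0 : topCoeff h ω = 0) (k : ℤ) : Finsupp.single k ω ∈ relations h f Ω t₀ := by
  obtain ⟨η, hη, rfl⟩ := hS.dlog ω hω h0
  refine Submodule.mem_sup_left (Submodule.mem_sup_right
    ⟨Finsupp.single k η, single_mem_laurent hη k, coeffwise_single _ _ _⟩)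

theorem IsFormSystem.mkQ_single_eq (hS : IsFormSystem h Ω) {ω ω' : Form h} (hω : ω ∈ Ω 1)
    (hω' : ω' ∈ Ω 1) (h0 : topCoeff h ω = topCoeff h ω') (k : ℤ) :
    (relations h f Ω t₀).mkQ (Finsupp.single k ω) =
      (relations h f Ω t₀).mkQ (Finsupp.single k ω') := by
  rw [← sub_eq_zero, ← map_sub, ← Finsupp.single_sub, ← LinearMap.mem_ker, Submodule.ker_mkQ]
  exact hS.single_mem_relations (sub_mem hω hω') (by rw [map_sub, h0, sub_self]) k

theorem mkQ_single_mul {ω : Form h} (hω : ω ∈ Ω 1) (k : ℤ) :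
    (relations h f Ω t₀).mkQ (Finsupp.single k (h • ω)) =
      t₀ • (relations h f Ω t₀).mkQ (Finsupp.single k ω) := by
  rw [← map_smul, ← sub_eq_zero, ← map_sub, Finsupp.smul_single, ← Finsupp.single_sub,
    ← LinearMap.mem_ker, Submodule.ker_mkQ]
  refine Submodule.mem_sup_right ⟨Finsupp.single k ω, single_mem_laurent hω k, ?_⟩
  rw [coeffwise_single]
  change Finsupp.single k ((h - MvPolynomial.C t₀) • ω) = _
  rw [sub_smul, ← MvPolynomial.algebraMap_eq, algebraMap_smul]

theorem mkQ_single_pow {ω : Form h} (hω : ω ∈ Ω 1) (k : ℤ) (r : ℕ) :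
    (relations h f Ω t₀).mkQ (Finsupp.single k (h ^ r • ω)) =
      t₀ ^ r • (relations h f Ω t₀).mkQ (Finsupp.single k ω) := by
  induction r with
  | zero => rw [pow_zero, pow_zero, one_smul, one_smul]
  | succ r ih =>
    rw [pow_succ', mul_smul, mkQ_single_mul (Submodule.smul_mem _ _ hω), ih, smul_smul, pow_succ']

theorem IsFormSystem.smul_alphaForm_mem (hS : IsFormSystem h Ω) (hn : 0 < n)
    (hh : h.IsHomogeneous n) (g : MvPolynomial (Fin n) ℂ) : g • alphaForm h ∈ Ω 1 :=
  Submodule.smul_mem _ _ (hS.log_le 1 (alphaForm_mem_logForms hn hh))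

/-- Every class is the class of a polynomial multiple of `α`. -/
theorem IsFibre.exists_mkQ_single_eq (hΩ : IsFibre h Ω t₀) (hn : 0 < n) (hh : h.IsHomogeneous n)
    {ω : Form h} (hω : ω ∈ Ω 1) : ∃ g : MvPolynomial (Fin n) ℂ, ∀ k : ℤ,
      (relations h f Ω t₀).mkQ (Finsupp.single k ω) =
        (relations h f Ω t₀).mkQ (Finsupp.single k (g • alphaForm h)) := by
  have hS := hΩ.isFormSystem hn hh
  rcases hΩ with ⟨rfl, rfl⟩ | ⟨rfl, ht⟩
  · obtain ⟨g, hg⟩ := topCoeff_mem hω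
    exact ⟨g, fun k => hS.mkQ_single_eq hω (hS.smul_alphaForm_mem hn hh g)
      (by rw [topCoeff_smul_alphaForm hn hh, hg]) k⟩
  · obtain ⟨r, g, hr⟩ := IsLocalization.Away.surj h (topCoeff h ω)
    refine ⟨(t₀ ^ r)⁻¹ • g, fun k => ?_⟩
    have h1 := hS.mkQ_single_eq (f := f) (t₀ := t₀) (Submodule.smul_mem _ (h ^ r) hω)
      (hS.smul_alphaForm_mem hn hh g) (by
        rw [topCoeff_smul_alphaForm hn hh, smul_eq_algebraMap_smul, map_smul, ← hr, map_pow,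
          smul_eq_mul, mul_comm]) k
    rw [mkQ_single_pow hω] at h1
    rw [smul_assoc, ← Finsupp.smul_single, map_smul, ← h1, smul_smul,
      inv_mul_cancel₀ (pow_ne_zero r ht), one_smul]

theorem alphaClass_self (hS : IsFormSystem h Ω) (hn : 0 < n) (hh : h.IsHomogeneous n) :
    alphaClass h f Ω t₀ h = t₀ • alphaClass h f Ω t₀ 1 := by
  rw [alphaClass_apply, alphaClass_apply, one_smul,
    mkQ_single_mul (hS.log_le 1 (alphaForm_mem_logForms hn hh))]

/-- The relation used is the twisted differential of the logarithmic form `g ι_ξ α`. Its two terms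
are replaced by multiples of `α` with the same coefficient under `dh ∧`. -/
theorem theta_alphaClass_lieDeriv (hS : IsFormSystem h Ω) (hn : 0 < n) (hh : h.IsHomogeneous n)
    {ξ : Fin n → MvPolynomial (Fin n) ℂ} (hξ : IsAdmissible h ξ) (g : MvPolynomial (Fin n) ℂ) :
    theta h f Ω t₀ (alphaClass h f Ω t₀ (lieDeriv ξ g)) =
      alphaClass h f Ω t₀ (lieDeriv ξ f * g) := by
  set η : Form h := g • contractV (polarField h ξ) (alphaForm h) with hη
  have hη2 : η ∈ logForms h 2 :=
    Submodule.smul_mem _ _ (contractV_alphaForm_mem_logForms hn hh hξ)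
  have h1 := hS.mkQ_single_eq (f := f) (t₀ := t₀) (hS.log_le 1 (extDeriv_mem_logForms hη2))
    (hS.smul_alphaForm_mem hn hh (lieDeriv ξ g)) (by
      rw [topCoeff_smul_alphaForm hn hh, topCoeff_extDeriv_contractV hn hh hξ]) 1
  have h2 := hS.mkQ_single_eq (f := f) (t₀ := t₀) (hS.log_le 1 (dWedge_mem_logForms f hη2))
    (hS.smul_alphaForm_mem hn hh (lieDeriv ξ f * g)) (by
      rw [topCoeff_smul_alphaForm hn hh, topCoeff_dWedge_contractV hn hh hξ]) 0
  rw [alphaClass_apply, alphaClass_apply, theta_mkQ, thetaEquiv_single, zero_add, ← h1, ← h2,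
    ← sub_eq_zero, ← map_sub, ← LinearMap.mem_ker, Submodule.ker_mkQ]
  refine Submodule.mem_sup_left (Submodule.mem_sup_left
    ⟨Finsupp.single 0 η, single_mem_laurent (hS.log_le 2 hη2) 0, ?_⟩)
  rw [twistedDiff, LinearMap.sub_apply, LinearMap.comp_apply, LinearEquiv.coe_coe, coeffwise_single,
    coeffwise_single, thetaEquiv_single, zero_add]
  rfl

/-- The fibre of the Brieskorn lattice is spanned by the classes of polynomial multiples of `α`. -/
theorem brieskorn_eq_span (hΩ : IsFibre h Ω t₀) (hn : 0 < n) (hh : h.IsHomogeneous n) :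
    brieskorn h f Ω t₀ = Submodule.span ℂ
      {x | ∃ (k : ℕ) (g : MvPolynomial (Fin n) ℂ),
        x = (theta h f Ω t₀ ^ (k : ℤ)) (alphaClass h f Ω t₀ g)} := by
  apply le_antisymm
  · rintro _ ⟨x, ⟨hx, hneg⟩, rfl⟩
    rw [← Finsupp.sum_single x, Finsupp.sum, map_sum]
    refine sum_mem fun k hk => ?_
    have hk0 : 0 ≤ k := by
      by_contra hk0
      exact Finsupp.mem_support_iff.1 hk (hneg k (not_le.1 hk0))
    obtain ⟨m, rfl⟩ := Int.eq_ofNat_of_zero_le hk0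
    obtain ⟨g, hg⟩ := hΩ.exists_mkQ_single_eq (f := f) hn hh (hx m)
    refine Submodule.subset_span ⟨m, g, ?_⟩
    rw [hg, theta_zpow_alphaClass]
  · refine Submodule.span_le.2 ?_
    rintro _ ⟨k, g, rfl⟩
    refine ⟨Finsupp.single (k : ℤ) (g • alphaForm h),
      ⟨single_mem_laurent ((hΩ.isFormSystem hn hh).smul_alphaForm_mem hn hh g) k, fun l hl => ?_⟩,
      (theta_zpow_alphaClass _ _).symm⟩
    rw [Finsupp.single_apply, if_neg (by omega)]

end Fibre

end LogBrieskorn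

end

noncomputable section

namespace LogBrieskorn

open Polynomial

section Independence

variable {n : ℕ} {h : MvPolynomial (Fin n) ℂ} {c : ℂ[X]} {a : Fin n → ℂ}
  {Ω : ℕ → Submodule (MvPolynomial (Fin n) ℂ) (Form h)} {t₀ : ℂ}

/-! ### Independence of the classes -/

/-- The functions `z ↦ zᵏ` are distinct characters of `ℂˣ`, as the point `2` shows, hence linearly
independent by Dedekind. -/
theorem eq_zero_of_laurent_eval_eq_zero (u : ℤ →₀ ℂ)
    (hu : ∀ z : ℂ, z ≠ 0 → (u.sum fun k r => r * z ^ k) = 0) : u = 0 := by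
  have hinj : Function.Injective fun k : ℤ => (Units.coeHom ℂ).comp (zpowGroupHom (α := ℂˣ) k) := by
    intro k l hkl
    have h1 := DFunLike.congr_fun hkl (Units.mk0 (2 : ℂ) two_ne_zero)
    have h2 : (2 : ℂ) ^ k = 2 ^ l := by simpa using h1
    have h3 : (2 : ℝ) ^ k = 2 ^ l := Complex.ofReal_injective (by push_cast; exact h2)
    exact zpow_right_injective₀ two_pos (by norm_num) h3
  have hli := (linearIndependent_monoidHom ℂˣ ℂ).comp _ hinj
  refine (linearIndependent_iff.1 hli) u (funext fun z => ?_)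
  rw [Finsupp.linearCombination_apply, Finsupp.sum_apply', Pi.zero_apply, ← hu z z.ne_zero]
  exact Finsupp.sum_congr fun k _ => by simp

/-- The pairs formed by a homogeneous class of degree `0` and its value. -/
def valuePairs (ha : MvPolynomial.eval a h ≠ 0) (z : ℂ) : Submodule ℂ (LaurentForm h × ℂ[X]) :=
  Submodule.span ℂ {x | ∃ (d : ℕ) (g : MvPolynomial (Fin n) ℂ), g.IsHomogeneous d ∧
    x = (Finsupp.single (-(d : ℤ)) (g • alphaForm h), C (z ^ (-(d : ℤ))) * capelliPhi ha z g)}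

/-- For a homogeneous `g` of degree `d` placed at `θ⁻ᵈ`, the term `-d` from `θ∂_θ` cancels the `d`
produced by multiplication by `f`. Only `-n X` survives, independently of `d`; this is why
degree-zero classes are paired with their values. -/
theorem nablaForm_mem_valuePairs (ha : MvPolynomial.eval a h ≠ 0) (hh : h.IsHomogeneous n) {z : ℂ}
    (hz : z ≠ 0) {x : LaurentForm h × ℂ[X]} (hx : x ∈ valuePairs ha z) :
    (nablaForm h (linearForm a) x.1, -(n : ℂ) • (Polynomial.X * x.2)) ∈ valuePairs ha z := by
  induction hx using Submodule.span_induction with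
  | mem x hx =>
    obtain ⟨d, g, hg, rfl⟩ := hx
    have h1 := Submodule.smul_mem (valuePairs ha z) (-(d : ℂ))
      (Submodule.subset_span ⟨d, g, hg, rfl⟩)
    have h2 : (Finsupp.single (-((d + 1 : ℕ) : ℤ)) ((linearForm a * g) • alphaForm h),
        C (z ^ (-((d + 1 : ℕ) : ℤ))) * capelliPhi ha z (linearForm a * g)) ∈ valuePairs ha z :=
      Submodule.subset_span
        ⟨d + 1, _, by rw [add_comm]; exact (linearForm_isHomogeneous a).mul hg, rfl⟩
    convert add_mem h1 h2 using 1
    refine Prod.ext ?_ ?_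
    · rw [Prod.fst_add, Prod.smul_fst, nablaForm_single, Int.cast_neg, Int.cast_natCast, smul_smul,
        Nat.cast_succ, neg_add, sub_eq_add_neg]
    · rw [Prod.snd_add, Prod.smul_snd, capelliPhi_linearForm_mul ha hh z hg]
      have h3 : C (z ^ (-((d + 1 : ℕ) : ℤ))) * C (-z) = -C (z ^ (-(d : ℤ))) := by
        rw [← C_mul, ← C_neg, Nat.cast_succ, neg_add, zpow_add₀ hz, zpow_neg_one]
        field_simp
      rw [Polynomial.smul_eq_C_mul, Polynomial.smul_eq_C_mul, C_neg (a := (n : ℂ)),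
        C_neg (a := (d : ℂ))]
      linear_combination (-((C (n : ℂ) * Polynomial.X - C (d : ℂ)) * capelliPhi ha z g)) * h3
  | zero =>
    convert zero_mem (valuePairs ha z) using 1
    simp
  | add x y _ _ hx hy =>
    convert add_mem hx hy using 1
    refine Prod.ext ?_ ?_
    · rw [Prod.fst_add, Prod.fst_add, map_add]
    · rw [Prod.snd_add, Prod.snd_add, mul_add, smul_add]
  | smul r x _ hx =>
    convert Submodule.smul_mem _ r hx using 1
    refine Prod.ext ?_ ?_
    · rw [Prod.smul_fst, Prod.smul_fst, map_smul]
    · rw [Prod.smul_snd, Prod.smul_snd, mul_smul_comm, smul_comm]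

theorem aeval_mem_valuePairs (ha : MvPolynomial.eval a h ≠ 0) (hh : h.IsHomogeneous n) {z : ℂ}
    (hz : z ≠ 0) (p : ℂ[X]) :
    (aeval (nablaForm h (linearForm a)) p (Finsupp.single 0 (alphaForm h)),
      p.comp (C (-(n : ℂ)) * Polynomial.X)) ∈ valuePairs ha z := by
  induction p using Polynomial.induction_on with
  | C r =>
    have h0 : (Finsupp.single 0 (alphaForm h), (1 : ℂ[X])) ∈ valuePairs ha z :=
      Submodule.subset_span ⟨0, 1, MvPolynomial.isHomogeneous_one _ _, by simp [capelliPhi_one]⟩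
    convert Submodule.smul_mem _ r h0 using 1
    refine Prod.ext ?_ ?_
    · rw [aeval_C, Module.algebraMap_end_apply, Prod.smul_fst]
    · rw [C_comp, Prod.smul_snd, Polynomial.smul_eq_C_mul, mul_one]
  | add p q hp hq =>
    convert add_mem hp hq using 1
    refine Prod.ext ?_ ?_
    · rw [Prod.fst_add, map_add, LinearMap.add_apply]
    · rw [Prod.snd_add, add_comp]
  | monomial k r ih =>
    convert nablaForm_mem_valuePairs ha hh hz ih using 1
    refine Prod.ext ?_ ?_
    · rw [pow_succ, ← mul_assoc, mul_comm, map_mul, aeval_X, Module.End.mul_apply]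
    · simp only [mul_comp, C_comp, pow_comp, X_comp, Polynomial.smul_eq_C_mul]
      ring

theorem exists_of_mem_valuePairs (ha : MvPolynomial.eval a h ≠ 0) (hn : 0 < n)
    (hh : h.IsHomogeneous n) {z : ℂ} {x : LaurentForm h × ℂ[X]} (hx : x ∈ valuePairs ha z) :
    ∃ g, topCoeff h (evalTheta h z x.1) = algebraMap _ (PolarRing h) g ∧
      capelliPhi ha z g = x.2 := by
  have hsmul : ∀ (r : ℂ) (ω : Form h), topCoeff h (r • ω) = r • topCoeff h ω := fun r ω =>
    ((topCoeff h).restrictScalars ℂ).map_smul r ω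
  have hg : ∀ (r : ℂ) (g : MvPolynomial (Fin n) ℂ), r • algebraMap _ (PolarRing h) g =
      algebraMap _ (PolarRing h) (r • g) := fun r g => by
    rw [MvPolynomial.smul_eq_C_mul, map_mul, algebraMap_C, Algebra.smul_def]
  induction hx using Submodule.span_induction with
  | mem x hx =>
    obtain ⟨d, g, hg', rfl⟩ := hx
    refine ⟨z ^ (-(d : ℤ)) • g, ?_, ?_⟩
    · rw [evalTheta_single, hsmul, topCoeff_smul_alphaForm hn hh, hg]
    · rw [map_smul, Polynomial.smul_eq_C_mul]
  | zero => exact ⟨0, by simp, by simp⟩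
  | add x y _ _ hx hy =>
    obtain ⟨g, hg1, hg2⟩ := hx
    obtain ⟨g', hg1', hg2'⟩ := hy
    exact ⟨g + g', by rw [Prod.fst_add, map_add, map_add, hg1, hg1', map_add],
      by rw [map_add, hg2, hg2', Prod.snd_add]⟩
  | smul r x _ hx =>
    obtain ⟨g, hg1, hg2⟩ := hx
    exact ⟨r • g, by rw [Prod.smul_fst, map_smul, hsmul, hg1, hg],
      by rw [map_smul, hg2, Prod.smul_snd]⟩

theorem evalTheta_thetaEquiv_zpow {z : ℂ} (hz : z ≠ 0) (k : ℤ) (x : LaurentForm h) :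
    evalTheta h z ((thetaEquiv h ^ k) x) = z ^ k • evalTheta h z x := by
  induction x using Finsupp.induction_linear with
  | zero => simp
  | add a b ha hb => rw [map_add, map_add, ha, hb, map_add, smul_add]
  | single l ω =>
    rw [thetaEquiv_zpow_single, evalTheta_single, evalTheta_single, smul_smul, add_comm,
      zpow_add₀ hz]

/-- The map sending a Laurent polynomial `∑ θᵏ pₖ` with coefficients in `ℂ[X]` to
`∑ θᵏ pₖ(θ∇_θ) e`. -/
def laurentEval {Y : Type} [AddCommGroup Y] [Module ℂ Y] (θ : Y ≃ₗ[ℂ] Y) (N : Y →ₗ[ℂ] Y) (e : Y) :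
    (ℤ →₀ ℂ[X]) →ₗ[ℂ] Y :=
  Finsupp.lsum ℂ fun k : ℤ => ((θ ^ k : Y ≃ₗ[ℂ] Y) : Y →ₗ[ℂ] Y) ∘ₗ
    LinearMap.applyₗ e ∘ₗ (aeval N).toLinearMap

theorem laurentEval_single {Y : Type} [AddCommGroup Y] [Module ℂ Y] (θ : Y ≃ₗ[ℂ] Y)
    (N : Y →ₗ[ℂ] Y) (e : Y) (k : ℤ) (p : ℂ[X]) :
    laurentEval θ N e (Finsupp.single k p) = (θ ^ k) (aeval N p e) := by
  simp [laurentEval]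

theorem comp_linear_eq_zero {r : ℂ} (hr : r ≠ 0) {p : ℂ[X]}
    (hp : p.comp (C r * Polynomial.X) = 0) : p = 0 := by
  have h1 : (p.comp (C r * Polynomial.X)).comp (C r⁻¹ * Polynomial.X) = p := by
    rw [comp_assoc, mul_comp, C_comp, X_comp, ← mul_assoc, ← C_mul, mul_inv_cancel₀ hr, C_1, one_mul,
      comp_X]
  rw [← h1, hp, zero_comp]

/-- Lift the vanishing combination to a relation among forms and evaluate at `θ = z`. The functional
gives `∑ zᵏ pₖ(-n X)`, of degree less than `n`, and also a value of `fibreOp`; so it vanishes for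
every `z ≠ 0`, and the characters `zᵏ` separate the `pₖ`. -/
theorem eq_zero_of_laurentEval_eq_zero (H : IsCapelli h c) (ha : MvPolynomial.eval a h ≠ 0)
    (hΩ : IsFibre h Ω t₀) (P : ℤ →₀ ℂ[X]) (hP : ∀ k, (P k).degree < n)
    (hP0 : laurentEval (theta h (linearForm a) Ω t₀) (nabla h (linearForm a) Ω t₀)
      (alphaClass h (linearForm a) Ω t₀ 1) P = 0) : P = 0 := by
  have hn : (n : ℂ) ≠ 0 := Nat.cast_ne_zero.2 H.pos.ne'
  set N := nablaForm h (linearForm a) with hN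
  set x : LaurentForm h := P.sum fun k p =>
    (thetaEquiv h ^ k) (aeval N p (Finsupp.single 0 (alphaForm h))) with hx
  have hxr : x ∈ relations h (linearForm a) Ω t₀ := by
    rw [← Submodule.ker_mkQ (relations h (linearForm a) Ω t₀), LinearMap.mem_ker, ← hP0, laurentEval,
      Finsupp.lsum_apply, hx, Finsupp.sum, Finsupp.sum, map_sum]
    refine Finset.sum_congr rfl fun k _ => ?_
    rw [← theta_zpow_mkQ, ← aeval_nabla_mkQ, alphaClass_apply, one_smul]
    rfl
  have key : ∀ z : ℂ, z ≠ 0 →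
      (P.sum fun k p => C (z ^ k) * p.comp (C (-(n : ℂ)) * Polynomial.X)) = 0 := by
    intro z hz
    choose g hg1 hg2 using fun k => exists_of_mem_valuePairs ha H.pos H.homogeneous
      (aeval_mem_valuePairs ha H.homogeneous hz (P k))
    have h1 : topCoeff h (evalTheta h z x) =
        algebraMap _ (PolarRing h) (∑ k ∈ P.support, z ^ k • g k) := by
      rw [hx, Finsupp.sum, map_sum, map_sum, map_sum]
      refine Finset.sum_congr rfl fun k _ => ?_
      rw [evalTheta_thetaEquiv_zpow hz, MvPolynomial.smul_eq_C_mul, map_mul, algebraMap_C, ← hg1 k,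
        ← Algebra.smul_def]
      exact ((topCoeff h).restrictScalars ℂ).map_smul _ _
    obtain ⟨p, hp⟩ := exists_fibreOp H ha hΩ hxr hz h1
    have h2 : capelliPhi ha z (∑ k ∈ P.support, z ^ k • g k) =
        P.sum fun k p => C (z ^ k) * p.comp (C (-(n : ℂ)) * Polynomial.X) := by
      rw [map_sum, Finsupp.sum]
      refine Finset.sum_congr rfl fun k _ => ?_
      rw [map_smul, hg2, Polynomial.smul_eq_C_mul]
    rw [← h2, hp]
    refine H.degree_fibreOp ha t₀ hz p ?_
    rw [← hp, h2, Finsupp.sum, ← mem_degreeLT]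
    refine sum_mem fun k _ => ?_
    rw [← Polynomial.smul_eq_C_mul]
    refine Submodule.smul_mem _ _ (mem_degreeLT.2 ?_)
    by_cases hk : (P k).comp (C (-(n : ℂ)) * Polynomial.X) = 0
    · rw [hk, degree_zero]
      exact WithBot.bot_lt_coe n
    · rw [← natDegree_lt_iff_degree_lt hk]
      have hk' : P k ≠ 0 := by
        intro h0
        rw [h0, zero_comp] at hk
        exact hk rfl
      have h6 : (C (-(n : ℂ)) * Polynomial.X).natDegree ≤ 1 :=
        (natDegree_C_mul_le _ _).trans natDegree_X_le
      calc _ ≤ (P k).natDegree * (C (-(n : ℂ)) * Polynomial.X).natDegree := natDegree_comp_le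
        _ ≤ (P k).natDegree * 1 := Nat.mul_le_mul_left _ h6
        _ < n := by rw [mul_one]; exact (natDegree_lt_iff_degree_lt hk').2 (hP k)
  ext1 k
  rw [Finsupp.zero_apply]
  refine comp_linear_eq_zero (neg_ne_zero.2 hn) (Polynomial.ext fun i => ?_)
  have h3 := eq_zero_of_laurent_eval_eq_zero
    (P.mapRange (fun p => (p.comp (C (-(n : ℂ)) * Polynomial.X)).coeff i) (by simp)) (by
      intro z hz
      have h4 := congrArg (fun p => p.coeff i) (key z hz)
      rw [Finsupp.sum_mapRange_index (by simp)]
      simp only [Finsupp.sum, finsetSum_coeff, coeff_C_mul, coeff_zero] at h4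
      rw [Finsupp.sum, ← h4]
      exact Finset.sum_congr rfl fun k _ => mul_comm _ _)
  have h5 := DFunLike.congr_fun h3 k
  rwa [Finsupp.mapRange_apply] at h5

end Independence

end LogBrieskorn

end

noncomputable section

namespace LogBrieskorn

open Polynomial

section Lattice

variable {Y : Type} [AddCommGroup Y] [Module ℂ Y] {θ : Y ≃ₗ[ℂ] Y} {N : Y →ₗ[ℂ] Y} {e : Y}

/-! ### The lattice generated by the operators `θ` and `θ²∇_θ` -/

/-- The span of the `θʲ p(θ∇_θ) e` with `deg p ≤ j` and `deg p < n`. -/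
def degreeLattice (θ : Y ≃ₗ[ℂ] Y) (N : Y →ₗ[ℂ] Y) (e : Y) (n : ℕ) : Submodule ℂ Y :=
  Submodule.span ℂ {x | ∃ (j : ℕ) (p : ℂ[X]), p.degree < (j + 1 : ℕ) ∧ p.degree < n ∧
    x = (θ ^ (j : ℤ)) (aeval N p e)}

variable {n : ℕ}

theorem mem_degreeLattice {j : ℕ} {p : ℂ[X]} (hj : p.degree < (j + 1 : ℕ)) (hn : p.degree < n) :
    (θ ^ (j : ℤ)) (aeval N p e) ∈ degreeLattice θ N e n :=
  Submodule.subset_span ⟨j, p, hj, hn, rfl⟩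

theorem theta_zpow_natCast_succ (j : ℕ) (x : Y) :
    θ ((θ ^ (j : ℤ)) x) = (θ ^ ((j + 1 : ℕ) : ℤ)) x := by
  rw [Nat.cast_succ, add_comm, zpow_add, zpow_one]
  rfl

theorem theta_mem_degreeLattice {x : Y} (hx : x ∈ degreeLattice θ N e n) :
    θ x ∈ degreeLattice θ N e n := by
  induction hx using Submodule.span_induction with
  | mem x hx =>
    obtain ⟨j, p, hj, hn, rfl⟩ := hx
    rw [theta_zpow_natCast_succ]
    exact mem_degreeLattice (hj.trans (by exact_mod_cast Nat.lt_succ_self _)) hn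
  | zero => rw [map_zero]; exact zero_mem _
  | add x y _ _ hx hy => rw [map_add]; exact add_mem hx hy
  | smul r x _ hx => rw [map_smul]; exact Submodule.smul_mem _ _ hx

theorem one_mem_degreeLattice (hn : 0 < n) : e ∈ degreeLattice θ N e n := by
  have h1 : (θ ^ ((0 : ℕ) : ℤ)) (aeval N (1 : ℂ[X]) e) ∈ degreeLattice θ N e n :=
    mem_degreeLattice (by rw [degree_one]; norm_num) (by rw [degree_one]; exact_mod_cast hn)
  rwa [map_one (aeval N), Nat.cast_zero, zpow_zero] at h1

/-- The operator `θN` raises both the power of `θ` and the degree of `p` by at most one, which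
preserves `deg p ≤ j`. When the degree reaches `n`, division by `q` and the relation for `q(N)e`
bring it down again. -/
theorem theta_nabla_mem_degreeLattice (hcomm : ∀ x, N (θ x) = θ (N x) + θ x) (hn : 0 < n)
    {q : ℂ[X]} (hq : q.degree = n) {κ : ℂ} (hqe : (θ ^ (n : ℤ)) (aeval N q e) = κ • e) {x : Y}
    (hx : x ∈ degreeLattice θ N e n) : θ (N x) ∈ degreeLattice θ N e n := by
  induction hx using Submodule.span_induction with
  | mem x hx =>
    obtain ⟨j, p, hj, hpn, rfl⟩ := hx
    set r : ℂ[X] := (Polynomial.X + C (j : ℂ)) * p with hr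
    have h1 : θ (N ((θ ^ (j : ℤ)) (aeval N p e))) = (θ ^ ((j + 1 : ℕ) : ℤ)) (aeval N r e) := by
      rw [nabla_zpow hcomm, map_add, theta_zpow_natCast_succ, map_smul, theta_zpow_natCast_succ,
        ← map_smul, ← map_add, hr, add_mul, map_add (aeval N), map_mul, aeval_X, map_mul, aeval_C,
        LinearMap.add_apply, Module.End.mul_apply, Module.End.mul_apply,
        Module.algebraMap_end_apply, Int.cast_natCast]
    have hdeg : r.degree = p.degree + 1 := by
      rw [hr, degree_mul, degree_X_add_C, add_comm]
    have hd : ∀ m : ℕ, p.degree < m → r.degree < (m + 1 : ℕ) := by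
      intro m hm
      by_cases hp0 : p = 0
      · rw [hr, hp0, mul_zero, degree_zero]
        exact WithBot.bot_lt_coe _
      · rw [hdeg]
        rw [degree_eq_natDegree hp0] at hm ⊢
        have : p.natDegree < m := by exact_mod_cast hm
        exact_mod_cast Nat.succ_lt_succ this
    clear_value r
    rw [h1]
    by_cases hrn : r.degree < n
    · exact mem_degreeLattice (hd _ hj) hrn
    · have hr_eq : r.degree = q.degree := by
        rw [hq]
        refine le_antisymm ?_ (not_lt.1 hrn)
        rw [← natDegree_le_iff_degree_le]
        by_cases hr0 : r = 0
        · rw [hr0, natDegree_zero]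
          exact Nat.zero_le _
        · exact Nat.lt_succ_iff.1 ((natDegree_lt_iff_degree_lt hr0).2 (hd n hpn))
      have hr0 : r ≠ 0 := by
        rintro h0
        rw [h0, degree_zero, hq] at hr_eq
        exact absurd hr_eq.symm (by simp)
      have hq0 : q ≠ 0 := by
        rintro h0
        rw [h0, degree_zero] at hq
        exact absurd hq.symm (by simp)
      have hs : r.leadingCoeff / q.leadingCoeff ≠ 0 :=
        div_ne_zero (leadingCoeff_ne_zero.2 hr0) (leadingCoeff_ne_zero.2 hq0)
      set s := r.leadingCoeff / q.leadingCoeff with hs'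
      have hlt : (r - C s * q).degree < r.degree := by
        refine degree_sub_lt_left ?_ hr0 ?_
        · rw [degree_C_mul hs, hr_eq]
        · rw [leadingCoeff_mul (C s), leadingCoeff_C, hs',
            div_mul_cancel₀ _ (leadingCoeff_ne_zero.2 hq0)]
      -- Degree `n` can occur only next to a power `θʲ⁺¹` with `j + 1 ≥ n`. The relation therefore
      -- leaves a nonnegative power of `θ` applied to `e`, still in the lattice.
      have hnj : n ≤ j + 1 := by
        have := hd _ hj
        rw [hr_eq, hq] at this
        have h2 : n < j + 1 + 1 := by exact_mod_cast this
        omega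
      obtain ⟨l, hl⟩ := Nat.exists_eq_add_of_le hnj
      have h2 : (θ ^ ((j + 1 : ℕ) : ℤ)) (aeval N r e) =
          (θ ^ ((j + 1 : ℕ) : ℤ)) (aeval N (r - C s * q) e) +
            (s * κ) • (θ ^ (l : ℤ)) (aeval N (1 : ℂ[X]) e) := by
        have h3 : (θ ^ ((j + 1 : ℕ) : ℤ)) (aeval N q e) = κ • (θ ^ (l : ℤ)) e := by
          rw [← map_smul, ← hqe, hl, Nat.cast_add, add_comm, zpow_add]
          rfl
        rw [map_sub (aeval (R := ℂ) N), LinearMap.sub_apply, map_mul (aeval (R := ℂ) N), aeval_C, Module.End.mul_apply,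
          Module.algebraMap_end_apply, map_sub, map_smul, h3, smul_smul, map_one (aeval N),
          Module.End.one_apply, sub_add_cancel]
      rw [h2]
      refine add_mem (mem_degreeLattice (hlt.trans (hd _ hj)) ?_) (Submodule.smul_mem _ _
        (mem_degreeLattice ?_ ?_))
      · rw [← hq, ← hr_eq]
        exact hlt
      · rw [degree_one]
        exact_mod_cast Nat.succ_pos l
      · rw [degree_one]
        exact_mod_cast hn
  | zero => rw [map_zero, map_zero]; exact zero_mem _
  | add x y _ _ hx hy => rw [map_add, map_add]; exact add_mem hx hy
  | smul r x _ hx => rw [map_smul, map_smul]; exact Submodule.smul_mem _ _ hx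

theorem degreeLattice_le (hcomm : ∀ x, N (θ x) = θ (N x) + θ x) {G : Submodule ℂ Y} (he : e ∈ G)
    (hθ : ∀ x ∈ G, θ x ∈ G) (hN : ∀ x ∈ G, θ (N x) ∈ G) : degreeLattice θ N e n ≤ G := by
  have hpow : ∀ i j : ℕ, i ≤ j → (θ ^ (j : ℤ)) ((N ^ i) e) ∈ G := by
    intro i
    induction i with
    | zero =>
      intro j _
      induction j with
      | zero => simpa using he
      | succ j ih => rw [← theta_zpow_natCast_succ]; exact hθ _ (ih (Nat.zero_le j))
    | succ i ih =>
      intro j hj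
      obtain ⟨j, rfl⟩ : ∃ l, j = l + 1 := ⟨j - 1, by omega⟩
      have h1 := hN _ (ih j (by omega))
      rw [nabla_zpow hcomm, map_add, theta_zpow_natCast_succ, map_smul, theta_zpow_natCast_succ] at h1
      have h2 := sub_mem h1 (G.smul_mem ((j : ℤ) : ℂ) (ih (j + 1) (by omega)))
      rwa [add_sub_cancel_right, ← Module.End.mul_apply, ← pow_succ'] at h2
  refine Submodule.span_le.2 ?_
  rintro _ ⟨j, p, hj, -, rfl⟩
  rw [aeval_eq_sum_range, LinearMap.sum_apply, map_sum]
  refine sum_mem fun i hi => ?_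
  rw [LinearMap.smul_apply, map_smul]
  by_cases hc : p.coeff i = 0
  · rw [hc, zero_smul]
    exact zero_mem _
  · refine G.smul_mem _ (hpow i j ?_)
    have h1 : (i : WithBot ℕ) < (j + 1 : ℕ) := (le_degree_of_ne_zero hc).trans_lt hj
    have h2 : i < j + 1 := by exact_mod_cast h1
    omega

/-- The vectors `θ^{mᵢ} Sᵢ(θ∇_θ) e`. -/
def sequenceVectors (θ : Y ≃ₗ[ℂ] Y) (N : Y →ₗ[ℂ] Y) (e : Y) (S : Polynomial.Sequence ℂ)
    (m : Fin n → ℤ) (i : Fin n) : Y :=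
  (θ ^ m i) (aeval N (S i) e)

theorem theta_zpow_sequenceVectors (S : Polynomial.Sequence ℂ) (m : Fin n → ℤ) (k : ℤ)
    (i : Fin n) :
    (θ ^ k) (sequenceVectors θ N e S m i) = (θ ^ (k + m i)) (aeval N (S i) e) := by
  rw [zpow_add]
  rfl

/-- A sequence with one polynomial in each degree spans every `degreeLT`, so the generators may be
taken as `θʲ Sᵢ(N)e` with `i ≤ j`. In terms of `wᵢ = θ^{mᵢ} Sᵢ(N)e` the power of `θ` is `j - mᵢ`,
whence the bound `i - mᵢ`. -/
theorem degreeLattice_eq_thetaSpan (S : Polynomial.Sequence ℂ) (m : Fin n → ℤ) :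
    degreeLattice θ N e n =
      thetaSpan θ (sequenceVectors θ N e S m) {p | (p.2 : ℤ) - m p.2 ≤ p.1} := by
  apply le_antisymm
  · refine Submodule.span_le.2 ?_
    rintro _ ⟨j, p, hj, hn, rfl⟩
    have hp : p ∈ degreeLT ℂ (min (j + 1) n) := by
      rw [mem_degreeLT]
      rcases min_choice (j + 1) n with h | h <;> rw [h] <;> assumption
    rw [← S.span_degreeLT fun i _ => IsUnit.mk0 _ (leadingCoeff_ne_zero.2 (S.ne_zero i))] at hp
    have key : Submodule.span ℂ (S '' Set.Iio (min (j + 1) n)) ≤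
        (thetaSpan θ (sequenceVectors θ N e S m) {p | (p.2 : ℤ) - m p.2 ≤ p.1}).comap
          (laurentEval θ N e ∘ₗ Finsupp.lsingle (j : ℤ)) := by
      refine Submodule.span_le.2 ?_
      rintro _ ⟨i, hi, rfl⟩
      rw [Set.mem_Iio, lt_min_iff] at hi
      change laurentEval θ N e (Finsupp.single (j : ℤ) (S i)) ∈
        thetaSpan θ (sequenceVectors θ N e S m) {p | (p.2 : ℤ) - m p.2 ≤ p.1}
      have h1 := theta_zpow_sequenceVectors (θ := θ) (N := N) (e := e) S m (j - m ⟨i, hi.2⟩)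
        ⟨i, hi.2⟩
      rw [sub_add_cancel] at h1
      rw [laurentEval_single, ← h1]
      refine mem_thetaSpan θ _ ?_
      change (i : ℤ) - m ⟨i, hi.2⟩ ≤ j - m ⟨i, hi.2⟩
      omega
    have h2 := key hp
    change laurentEval θ N e (Finsupp.single (j : ℤ) p) ∈
      thetaSpan θ (sequenceVectors θ N e S m) {p | (p.2 : ℤ) - m p.2 ≤ p.1} at h2
    rwa [laurentEval_single] at h2
  · refine Submodule.span_le.2 ?_
    rintro _ ⟨⟨k, i⟩, hk, rfl⟩
    change (i : ℤ) - m i ≤ k at hk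
    obtain ⟨j, hj⟩ := Int.eq_ofNat_of_zero_le (show 0 ≤ k + m i by omega)
    change (θ ^ k) (sequenceVectors θ N e S m i) ∈ _
    rw [theta_zpow_sequenceVectors, hj]
    refine mem_degreeLattice ?_ ?_
    · rw [S.degree_eq]
      exact_mod_cast (by omega : (i : ℕ) < j + 1)
    · rw [S.degree_eq]
      exact_mod_cast i.2

theorem linearIndependent_sequenceVectors (S : Polynomial.Sequence ℂ) (m : Fin n → ℤ)
    (hinj : ∀ P : ℤ →₀ ℂ[X], (∀ k, (P k).degree < n) → laurentEval θ N e P = 0 → P = 0) :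
    LinearIndependent ℂ fun p : ℤ × Fin n => (θ ^ p.1) (sequenceVectors θ N e S m p.2) := by
  have h1 : LinearIndependent ℂ fun p : ℤ × Fin n =>
      (Finsupp.single (p.1 + m p.2) (S p.2) : ℤ →₀ ℂ[X]) := by
    have h2 := Finsupp.linearIndependent_single (R := ℂ) (fun (_ : ℤ) (i : ℕ) => S i)
      fun _ => S.linearIndependent
    refine h2.comp (fun p : ℤ × Fin n => (⟨p.1 + m p.2, p.2⟩ : Σ _ : ℤ, ℕ)) ?_
    rintro ⟨k, i⟩ ⟨l, j⟩ hp
    simp only [Sigma.mk.injEq, heq_eq_eq] at hp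
    obtain ⟨hk, hi⟩ := hp
    obtain rfl := Fin.ext hi
    exact Prod.ext (add_right_cancel hk) rfl
  have h3 := h1.map (f := laurentEval θ N e) (by
    rw [Submodule.disjoint_def]
    intro P hP hP0
    refine hinj P (fun k => mem_degreeLT.1 ?_) hP0
    have h4 : Submodule.span ℂ (Set.range fun p : ℤ × Fin n =>
        (Finsupp.single (p.1 + m p.2) (S p.2) : ℤ →₀ ℂ[X])) ≤
        (degreeLT ℂ n).comap (Finsupp.lapply k) := by
      refine Submodule.span_le.2 ?_
      rintro _ ⟨⟨l, i⟩, rfl⟩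
      change (Finsupp.single (l + m i) (S i) : ℤ →₀ ℂ[X]) k ∈ degreeLT ℂ n
      rw [Finsupp.single_apply]
      split_ifs
      · rw [mem_degreeLT, S.degree_eq]
        exact_mod_cast i.2
      · exact zero_mem _
    exact h4 hP)
  have h5 : (fun p : ℤ × Fin n => (θ ^ p.1) (sequenceVectors θ N e S m p.2)) =
      laurentEval θ N e ∘ fun p : ℤ × Fin n =>
        (Finsupp.single (p.1 + m p.2) (S p.2) : ℤ →₀ ℂ[X]) := by
    funext p
    rw [theta_zpow_sequenceVectors]
    exact (laurentEval_single θ N e _ _).symm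
  rw [h5]
  exact h3

end Lattice

/-! ### The Brieskorn lattice in terms of `θ` and `θ²∇_θ` -/

section Spectrum

variable {n : ℕ} {h : MvPolynomial (Fin n) ℂ} {c : ℂ[X]} {a : Fin n → ℂ}
  {Ω : ℕ → Submodule (MvPolynomial (Fin n) ℂ) (Form h)} {t₀ : ℂ}

/-- The induction on the degree used to represent classes, recorded as a containment: a subspace
with `e 1`, stable under `θ` and `θN`, contains all polynomial classes. No negative power of `θ`
arises. -/
theorem mem_of_isSpanningForm {Y : Type} [AddCommGroup Y] [Module ℂ Y]
    (hspan : IsSpanningForm h a) (θ : Y ≃ₗ[ℂ] Y) (N : Y →ₗ[ℂ] Y)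
    (e : MvPolynomial (Fin n) ℂ →ₗ[ℂ] Y) (hN : ∀ g, θ (N (e g)) = e (linearForm a * g))
    (hξ : ∀ ξ, IsAdmissible h ξ → ∀ g,
      θ (e (lieDeriv ξ g)) = e (lieDeriv ξ (linearForm a) * g))
    {G : Submodule ℂ Y} (he : e 1 ∈ G) (hθ : ∀ x ∈ G, θ x ∈ G) (hNG : ∀ x ∈ G, θ (N x) ∈ G)
    (g : MvPolynomial (Fin n) ℂ) : e g ∈ G := by
  have hC : ∀ r : ℂ, e (MvPolynomial.C r) ∈ G := by
    intro r
    rw [← mul_one (MvPolynomial.C r), ← MvPolynomial.smul_eq_C_mul, map_smul]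
    exact G.smul_mem _ he
  have hhom : ∀ (d : ℕ) (g : MvPolynomial (Fin n) ℂ), g.IsHomogeneous d → e g ∈ G := by
    intro d
    induction d with
    | zero =>
      intro g hg
      rw [← MvPolynomial.totalDegree_zero_iff_isHomogeneous,
        MvPolynomial.totalDegree_eq_zero_iff_eq_C] at hg
      rw [hg]
      exact hC _
    | succ d ih =>
      intro g hg
      refine homogeneous_induction (P := fun d' g => d' = d + 1 → e g ∈ G) ?_ ?_ ?_ ?_ hg rfl
      · intro r _
        exact hC r
      · intro _ _
        rw [map_zero]
        exact zero_mem _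
      · intro _ p q hp hq hd
        rw [map_add]
        exact add_mem (hp hd) (hq hd)
      · intro d' p i hp _ hd
        obtain rfl : d' = d := by omega
        obtain ⟨κ, ξ, hadm, hX⟩ := hspan i
        have hpX : p * MvPolynomial.X i =
            κ • (linearForm a * p) + lieDeriv ξ (linearForm a) * p := by
          rw [hX, MvPolynomial.smul_eq_C_mul]
          ring
        rw [hpX, map_add, map_smul, ← hN, ← hξ ξ hadm]
        exact add_mem (G.smul_mem _ (hNG _ (ih p hp)))
          (hθ _ (ih _ (hadm.lieDeriv_isHomogeneous hp)))
  rw [← MvPolynomial.sum_homogeneousComponent g, map_sum]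
  exact sum_mem fun d _ => hhom d _ (MvPolynomial.homogeneousComponent_isHomogeneous d g)

theorem degree_nablaPoly_self (H : IsCapelli h c) (ha : MvPolynomial.eval a h ≠ 0) :
    (nablaPoly ha h).degree = n := by
  have hn : (n : ℂ) ≠ 0 := Nat.cast_ne_zero.2 H.pos.ne'
  have h1 : (C (-(n : ℂ)⁻¹) * Polynomial.X - 1 : ℂ[X]).natDegree = 1 := by
    rw [← C_1, natDegree_sub_C, natDegree_C_mul_X _ (neg_ne_zero.2 (inv_ne_zero hn))]
  have h2 : (Polynomial.X + 1 : ℂ[X]) ≠ 0 := by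
    rw [← C_1]
    exact X_add_C_ne_zero 1
  have h3 : (c * (Polynomial.X + 1)).natDegree = n := by
    rw [natDegree_mul H.ne_zero h2, ← C_1, natDegree_X_add_C, H.degree]
  have h4 : ((c * (Polynomial.X + 1)).comp (C (-(n : ℂ)⁻¹) * Polynomial.X - 1)).natDegree = n := by
    rw [natDegree_comp, h1, h3, mul_one]
  rw [nablaPoly_self H, degree_C_mul (mul_ne_zero (pow_ne_zero _ (neg_ne_zero.2 one_ne_zero))
    (inv_ne_zero ha)), degree_eq_natDegree, h4]
  intro h0
  rw [h0, natDegree_zero] at h4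
  exact H.pos.ne h4

theorem theta_zpow_nablaPoly_self (H : IsCapelli h c) (ha : MvPolynomial.eval a h ≠ 0)
    (hspan : IsSpanningForm h a) (hΩ : IsFibre h Ω t₀) :
    (theta h (linearForm a) Ω t₀ ^ (n : ℤ)) (aeval (nabla h (linearForm a) Ω t₀) (nablaPoly ha h)
      (alphaClass h (linearForm a) Ω t₀ 1)) = t₀ • alphaClass h (linearForm a) Ω t₀ 1 := by
  have hS := hΩ.isFormSystem H.pos H.homogeneous
  rw [← H.class_eq ha hspan _ _ nabla_theta _ theta_nabla_alphaClass
    (fun ξ hξ g => theta_alphaClass_lieDeriv hS H.pos H.homogeneous hξ g) H.homogeneous,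
    alphaClass_self hS H.pos H.homogeneous]

/-- Both sides are the smallest subspace containing `[1]` and stable under `θ` and `θN`. On the
Brieskorn side, stability under `θN` is multiplication by `f`, up to a multiple of `θ`; on the other
side it uses the relation of degree `n` given by `[h] = t₀[1]`. -/
theorem brieskorn_eq_degreeLattice (H : IsCapelli h c) (ha : MvPolynomial.eval a h ≠ 0)
    (hspan : IsSpanningForm h a) (hΩ : IsFibre h Ω t₀) :
    brieskorn h (linearForm a) Ω t₀ = degreeLattice (theta h (linearForm a) Ω t₀)
      (nabla h (linearForm a) Ω t₀) (alphaClass h (linearForm a) Ω t₀ 1) n := by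
  have hS := hΩ.isFormSystem H.pos H.homogeneous
  rw [brieskorn_eq_span hΩ H.pos H.homogeneous]
  apply le_antisymm
  · refine Submodule.span_le.2 ?_
    rintro _ ⟨k, g, rfl⟩
    rw [SetLike.mem_coe]
    induction k with
    | zero =>
      rw [Nat.cast_zero, zpow_zero]
      exact mem_of_isSpanningForm hspan _ _ _ theta_nabla_alphaClass
        (fun ξ hξ g => theta_alphaClass_lieDeriv hS H.pos H.homogeneous hξ g)
        (one_mem_degreeLattice H.pos) (fun _ => theta_mem_degreeLattice)
        (fun _ => theta_nabla_mem_degreeLattice nabla_theta H.pos (degree_nablaPoly_self H ha)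
          (theta_zpow_nablaPoly_self H ha hspan hΩ)) g
    | succ k ih =>
      rw [← theta_zpow_natCast_succ]
      exact theta_mem_degreeLattice ih
  · refine degreeLattice_le nabla_theta (Submodule.subset_span ⟨0, 1, rfl⟩) ?_ ?_
    · intro x hx
      induction hx using Submodule.span_induction with
      | mem x hx =>
        obtain ⟨k, g, rfl⟩ := hx
        exact Submodule.subset_span ⟨k + 1, g, theta_zpow_natCast_succ k _⟩
      | zero => rw [map_zero]; exact zero_mem _
      | add x y _ _ hx hy => rw [map_add]; exact add_mem hx hy
      | smul r x _ hx => rw [map_smul]; exact Submodule.smul_mem _ _ hx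
    · intro x hx
      induction hx using Submodule.span_induction with
      | mem x hx =>
        obtain ⟨k, g, rfl⟩ := hx
        rw [nabla_zpow nabla_theta, map_add, map_smul, theta_zpow_natCast_succ,
          theta_zpow_natCast_succ]
        refine add_mem (Submodule.subset_span ⟨k, linearForm a * g, ?_⟩)
          (Submodule.smul_mem _ _ (Submodule.subset_span ⟨k + 1, g, rfl⟩))
        rw [← theta_nabla_alphaClass, Nat.cast_succ, zpow_add, zpow_one]
        rfl
      | zero => rw [map_zero, map_zero]; exact zero_mem _
      | add x y _ _ hx hy => rw [map_add, map_add]; exact add_mem hx hy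
      | smul r x _ hx => rw [map_smul, map_smul]; exact Submodule.smul_mem _ _ hx

/-- The vectors attached to a sequence of polynomials in a fibre. -/
abbrev fibreVectors (h : MvPolynomial (Fin n) ℂ) (a : Fin n → ℂ)
    (Ω : ℕ → Submodule (MvPolynomial (Fin n) ℂ) (Form h)) (t₀ : ℂ) (S : Polynomial.Sequence ℂ)
    (m : Fin n → ℤ) : Fin n → GaussManin h (linearForm a) Ω t₀ :=
  sequenceVectors (theta h (linearForm a) Ω t₀) (nabla h (linearForm a) Ω t₀)
    (alphaClass h (linearForm a) Ω t₀ 1) S m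

theorem spectrumAtZero_brieskorn (H : IsCapelli h c) (ha : MvPolynomial.eval a h ≠ 0)
    (hspan : IsSpanningForm h a) (hΩ : IsFibre h Ω t₀) (S : Polynomial.Sequence ℂ) (m : Fin n → ℤ)
    (hw : IsNilpotentChain (theta h (linearForm a) Ω t₀) (nabla h (linearForm a) Ω t₀)
      (fibreVectors h a Ω t₀ S m)) :
    spectrumAtZero (theta h (linearForm a) Ω t₀) (nabla h (linearForm a) Ω t₀)
      (brieskorn h (linearForm a) Ω t₀) =
      formalSum (Finset.univ.val.map fun i : Fin n => (((i : ℤ) - m i : ℤ) : ℚ)) := by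
  rw [brieskorn_eq_degreeLattice H ha hspan hΩ, degreeLattice_eq_thetaSpan S m]
  exact spectrumAtZero_eq nabla_theta (linearIndependent_sequenceVectors S m
    (eq_zero_of_laurentEval_eq_zero H ha hΩ)) hw fun i => (i : ℤ) - m i

theorem spectrumAtInfty_brieskorn (H : IsCapelli h c) (ha : MvPolynomial.eval a h ≠ 0)
    (hspan : IsSpanningForm h a) (hΩ : IsFibre h Ω t₀) (S : Polynomial.Sequence ℂ) (m : Fin n → ℤ)
    (hw : IsNilpotentChain (theta h (linearForm a) Ω t₀).symm (-nabla h (linearForm a) Ω t₀)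
      (fibreVectors h a Ω t₀ S m)) :
    spectrumAtInfty (theta h (linearForm a) Ω t₀) (nabla h (linearForm a) Ω t₀)
      (brieskorn h (linearForm a) Ω t₀) =
      formalSum (Finset.univ.val.map fun i : Fin n => (((i : ℤ) - m i : ℤ) : ℚ)) := by
  rw [brieskorn_eq_degreeLattice H ha hspan hΩ, degreeLattice_eq_thetaSpan S m]
  exact spectrumAtInfty_eq nabla_theta (linearIndependent_sequenceVectors S m
    (eq_zero_of_laurentEval_eq_zero H ha hΩ)) hw fun i => (i : ℤ) - m i

end Spectrum

end LogBrieskorn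

end

noncomputable section

namespace LogBrieskorn

open Polynomial

section Chain

variable {Y : Type} [AddCommGroup Y] [Module ℂ Y] {θ : Y ≃ₗ[ℂ] Y} {N : Y →ₗ[ℂ] Y} {e : Y}

/-! ### Chains attached to sequences of integers -/

/-- The polynomials `∏_{j < i} (X + mⱼ)`. -/
def rootSequence (m : ℕ → ℤ) : Polynomial.Sequence ℂ where
  elems' i := ∏ j ∈ Finset.range i, (Polynomial.X + C ((m j : ℤ) : ℂ))
  degree_eq' i := by
    rw [degree_prod, Finset.sum_congr rfl fun j _ => degree_X_add_C _, Finset.sum_const,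
      Finset.card_range, nsmul_one]

theorem rootSequence_apply (m : ℕ → ℤ) (i : ℕ) :
    rootSequence m i = ∏ j ∈ Finset.range i, (Polynomial.X + C ((m j : ℤ) : ℂ)) := rfl

theorem rootSequence_zero (m : ℕ → ℤ) : rootSequence m 0 = 1 := by
  rw [rootSequence_apply, Finset.prod_range_zero]

theorem rootSequence_succ (m : ℕ → ℤ) (i : ℕ) :
    rootSequence m (i + 1) = (Polynomial.X + C ((m i : ℤ) : ℂ)) * rootSequence m i := by
  rw [rootSequence_apply, rootSequence_apply, Finset.prod_range_succ, mul_comm]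

variable {n : ℕ} {m : ℕ → ℤ}

/-- Passing `N` through `θ^{mᵢ}` adds `mᵢ`, which is exactly the next factor `X + mᵢ` of the
sequence. -/
theorem nabla_sequenceVectors (hcomm : ∀ x, N (θ x) = θ (N x) + θ x) (i : Fin n) :
    N (sequenceVectors θ N e (rootSequence m) (fun i : Fin n => m i) i) =
      (θ ^ m i) (aeval N (rootSequence m (i + 1)) e) := by
  rw [sequenceVectors, nabla_zpow hcomm, rootSequence_succ, add_mul, map_add (aeval (R := ℂ) N),
    map_mul, aeval_X, map_mul, aeval_C, LinearMap.add_apply, Module.End.mul_apply,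
    Module.End.mul_apply, Module.algebraMap_end_apply, map_add, map_smul]

theorem nabla_sequenceVectors_of_lt (hcomm : ∀ x, N (θ x) = θ (N x) + θ x) {i : Fin n}
    (hi : (i : ℕ) + 1 < n) :
    N (sequenceVectors θ N e (rootSequence m) (fun i : Fin n => m i) i) =
      (θ ^ (m i - m (i + 1)))
        (sequenceVectors θ N e (rootSequence m) (fun i : Fin n => m i) ⟨i + 1, hi⟩) := by
  rw [nabla_sequenceVectors hcomm, theta_zpow_sequenceVectors, sub_add_cancel]

/-- Here `N wᵢ = θ^{mᵢ - mᵢ₊₁} wᵢ₊₁`. With decreasing `mᵢ` the exponent is zero, giving the next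
basis vector, or positive, giving zero modulo `θ`. -/
theorem isNilpotentChain_rootSequence (hcomm : ∀ x, N (θ x) = θ (N x) + θ x)
    (hm : ∀ i, i + 1 < n → m (i + 1) ≤ m i) (hlast : aeval N (rootSequence m n) e = 0) :
    IsNilpotentChain θ N
      (sequenceVectors θ N e (rootSequence m) (fun i : Fin n => m i)) := by
  intro i
  by_cases hi : (i : ℕ) + 1 < n
  · rw [nabla_sequenceVectors_of_lt hcomm hi]
    rcases (hm i hi).eq_or_lt with h | h
    · rw [h, sub_self, zpow_zero]
      refine Submodule.mem_sup_left (Submodule.subset_span ⟨⟨i + 1, hi⟩, ?_, rfl⟩)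
      exact Fin.mk_lt_mk.2 (Nat.lt_succ_self i)
    · refine Submodule.mem_sup_right (mem_thetaSpan θ _ ?_)
      change 1 ≤ m i - m (i + 1)
      omega
  · have hin : (i : ℕ) + 1 = n := by omega
    rw [nabla_sequenceVectors hcomm, hin, hlast, map_zero]
    exact zero_mem _

theorem symm_zpow_apply (k : ℤ) (x : Y) : (θ.symm ^ k) x = (θ ^ (-k)) x := by
  have h1 : θ.symm = θ⁻¹ := rfl
  rw [h1, inv_zpow']

/-- With increasing `mᵢ` the same formula produces nonnegative powers of `θ⁻¹`. The last vector
returns to `w₀` with exponent `mₙ₋₁ - n - m₀` unless `κ = 0`, so this exponent must be negative. -/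
theorem isNilpotentChain_symm_rootSequence (hcomm : ∀ x, N (θ x) = θ (N x) + θ x) (hn : 0 < n)
    (hm : ∀ i, i + 1 < n → m i ≤ m (i + 1)) {κ : ℂ}
    (hlast : aeval N (rootSequence m n) e = κ • (θ ^ (-(n : ℤ))) e)
    (hκ : κ = 0 ∨ m (n - 1) - m 0 < n) :
    IsNilpotentChain θ.symm (-N)
      (sequenceVectors θ N e (rootSequence m) (fun i : Fin n => m i)) := by
  intro i
  rw [LinearMap.neg_apply]
  refine neg_mem ?_
  by_cases hi : (i : ℕ) + 1 < n
  · rw [nabla_sequenceVectors_of_lt hcomm hi]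
    rcases (hm i hi).eq_or_lt with h | h
    · rw [h, sub_self, zpow_zero]
      refine Submodule.mem_sup_left (Submodule.subset_span ⟨⟨i + 1, hi⟩, ?_, rfl⟩)
      exact Fin.mk_lt_mk.2 (Nat.lt_succ_self i)
    · rw [← neg_neg (m i - m (i + 1)), ← symm_zpow_apply]
      refine Submodule.mem_sup_right (mem_thetaSpan θ.symm _ ?_)
      change 1 ≤ -(m i - m (i + 1))
      omega
  · have hin : (i : ℕ) + 1 = n := by omega
    have hi' : (i : ℕ) = n - 1 := by omega
    rw [nabla_sequenceVectors hcomm, hin, hlast, map_smul]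
    rcases hκ with hκ | hκ
    · rw [hκ, zero_smul]
      exact zero_mem _
    · have h0 := theta_zpow_sequenceVectors (θ := θ) (N := N) (e := e) (rootSequence m)
        (fun i : Fin n => m i) (m i - n - m 0) ⟨0, hn⟩
      have h1 : (θ ^ m i) ((θ ^ (-(n : ℤ))) e) = (θ ^ (m i - n)) e := by
        rw [sub_eq_add_neg, zpow_add]
        rfl
      rw [rootSequence_zero, map_one (aeval (R := ℂ) N), Module.End.one_apply, sub_add_cancel] at h0
      rw [h1, ← h0, ← neg_neg (m i - n - m 0), ← symm_zpow_apply]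
      refine Submodule.mem_sup_right (Submodule.smul_mem _ _ (mem_thetaSpan θ.symm _ ?_))
      change 1 ≤ -(m i - n - m 0)
      rw [hi']
      omega

end Chain

/-! ### Spectra from the roots of the relation of degree `n` -/

section SpectrumOfRoots

variable {n : ℕ} {h : MvPolynomial (Fin n) ℂ} {c : ℂ[X]} {a : Fin n → ℂ}
  {Ω : ℕ → Submodule (MvPolynomial (Fin n) ℂ) (Form h)} {t₀ : ℂ}

theorem aeval_rootSequence (H : IsCapelli h c) (ha : MvPolynomial.eval a h ≠ 0)
    (hspan : IsSpanningForm h a) (hΩ : IsFibre h Ω t₀) {m : ℕ → ℤ} {κ : ℂ} (hκ : κ ≠ 0)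
    (hq : nablaPoly ha h = C κ * rootSequence m n) :
    aeval (nabla h (linearForm a) Ω t₀) (rootSequence m n) (alphaClass h (linearForm a) Ω t₀ 1) =
      (κ⁻¹ * t₀) • (theta h (linearForm a) Ω t₀ ^ (-(n : ℤ)))
        (alphaClass h (linearForm a) Ω t₀ 1) := by
  have h1 := theta_zpow_nablaPoly_self H ha hspan hΩ
  rw [hq, ← Polynomial.smul_eq_C_mul, map_smul, LinearMap.smul_apply, map_smul] at h1
  have h2 := congrArg (fun x => (theta h (linearForm a) Ω t₀ ^ (-(n : ℤ))) (κ⁻¹ • x)) h1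
  rw [smul_smul, inv_mul_cancel₀ hκ, one_smul, smul_smul, map_smul, ← LinearEquiv.mul_apply,
    ← zpow_add, neg_add_cancel, zpow_zero] at h2
  exact h2

/-- If the `-mᵢ` are the roots, in decreasing order of the `mᵢ`, then the spectrum at `0` of the
logarithmic lattice is formed by the `i - mᵢ`. -/
theorem logSpectrumAtZero_eq (H : IsCapelli h c) (ha : MvPolynomial.eval a h ≠ 0)
    (hspan : IsSpanningForm h a) {m : ℕ → ℤ} {κ : ℂ} (hκ : κ ≠ 0)
    (hq : nablaPoly ha h = C κ * rootSequence m n) (hm : ∀ i, i + 1 < n → m (i + 1) ≤ m i) :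
    logSpectrumAtZero h (linearForm a) =
      formalSum (Finset.univ.val.map fun i : Fin n => (((i : ℤ) - m i : ℤ) : ℚ)) := by
  have hΩ : IsFibre h (logForms h) 0 := Or.inl ⟨rfl, rfl⟩
  refine spectrumAtZero_brieskorn H ha hspan hΩ (rootSequence m) (fun i => m i)
    (isNilpotentChain_rootSequence nabla_theta hm ?_)
  rw [aeval_rootSequence H ha hspan hΩ hκ hq, mul_zero, zero_smul]

theorem spectrumAtInfty_brieskorn_eq (H : IsCapelli h c) (ha : MvPolynomial.eval a h ≠ 0)
    (hspan : IsSpanningForm h a) (hΩ : IsFibre h Ω t₀) {m : ℕ → ℤ} {κ : ℂ} (hκ : κ ≠ 0)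
    (hq : nablaPoly ha h = C κ * rootSequence m n) (hm : ∀ i, i + 1 < n → m i ≤ m (i + 1))
    (hm0 : t₀ = 0 ∨ m (n - 1) - m 0 < n) :
    spectrumAtInfty (theta h (linearForm a) Ω t₀) (nabla h (linearForm a) Ω t₀)
      (brieskorn h (linearForm a) Ω t₀) =
      formalSum (Finset.univ.val.map fun i : Fin n => (((i : ℤ) - m i : ℤ) : ℚ)) := by
  refine spectrumAtInfty_brieskorn H ha hspan hΩ (rootSequence m) (fun i => m i)
    (isNilpotentChain_symm_rootSequence nabla_theta H.pos hm
      (aeval_rootSequence H ha hspan hΩ hκ hq) ?_)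
  exact hm0.imp (fun h0 => by rw [h0, mul_zero]) id

end SpectrumOfRoots

section NormalCrossing

variable {n : ℕ}

/-! ### The normal crossing divisor -/

theorem twistedPartial_polyC {h g g' : MvPolynomial (Fin n) ℂ} {i : Fin n}
    (hg : MvPolynomial.pderiv i h * g = h * g') :
    twistedPartial h i (polyC h g) =
      polyC h (MvPolynomial.pderiv i g) + Polynomial.X * polyC h g' := by
  have h1 : logDeriv h i * algebraMap _ (PolarRing h) g = algebraMap _ (PolarRing h) g' := by
    rw [logDeriv, mul_assoc, ← map_mul, hg, map_mul, ← mul_assoc,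
      mul_comm (IsLocalization.Away.invSelf h), algebraMap_mul_invSelf, one_mul]
  rw [twistedPartial_eq, polyC, coeffDeriv_C, polarDeriv_algebraMap, mul_assoc, ← C_mul, h1]
  rfl

theorem pderiv_prod_X_of_notMem {i : Fin n} {S : Finset (Fin n)} (hi : i ∉ S) :
    MvPolynomial.pderiv i (∏ j ∈ S, (MvPolynomial.X j : MvPolynomial (Fin n) ℂ)) = 0 := by
  induction S using Finset.induction_on with
  | empty => rw [Finset.prod_empty, MvPolynomial.pderiv_one]
  | insert j S hj ih =>
    rw [Finset.mem_insert, not_or] at hi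
    rw [Finset.prod_insert hj, Derivation.leibniz, ih hi.2,
      MvPolynomial.pderiv_X_of_ne (Ne.symm hi.1), smul_zero, smul_zero, add_zero]

theorem pderiv_X_mul_prod {i : Fin n} {S : Finset (Fin n)} (hi : i ∉ S) :
    MvPolynomial.pderiv i
      (MvPolynomial.X i * ∏ j ∈ S, (MvPolynomial.X j : MvPolynomial (Fin n) ℂ)) =
      ∏ j ∈ S, MvPolynomial.X j := by
  rw [Derivation.leibniz, pderiv_prod_X_of_notMem hi, MvPolynomial.pderiv_X_self, smul_zero,
    zero_add, smul_eq_mul, mul_one]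

theorem normalCrossing_eq (i : Fin n) : normalCrossing n =
    MvPolynomial.X i * ∏ j ∈ Finset.univ.erase i, MvPolynomial.X j :=
  (Finset.mul_prod_erase _ _ (Finset.mem_univ i)).symm

theorem pderiv_normalCrossing (i : Fin n) : MvPolynomial.pderiv i (normalCrossing n) =
    ∏ j ∈ Finset.univ.erase i, MvPolynomial.X j := by
  rw [normalCrossing_eq i, pderiv_X_mul_prod (Finset.notMem_erase _ _)]

theorem X_mul_pderiv_normalCrossing (i : Fin n) :
    MvPolynomial.X i * MvPolynomial.pderiv i (normalCrossing n) = normalCrossing n := by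
  rw [pderiv_normalCrossing, ← normalCrossing_eq]

/-- Each `∂ᵢ` removes the factor `xᵢ`, which occurs to the power `s + 1` in the function it acts on.
-/
theorem diffOp_prod_X (S : Finset (Fin n)) :
    diffOp (normalCrossing n) (∏ i ∈ S, MvPolynomial.X i)
      (polyC (normalCrossing n) (normalCrossing n)) =
    scalarPoly (normalCrossing n) ((Polynomial.X + 1) ^ S.card) *
      polyC (normalCrossing n) (∏ i ∈ Sᶜ, MvPolynomial.X i) := by
  induction S using Finset.induction_on with
  | empty =>
    rw [Finset.prod_empty, map_one (diffOp _), Finset.card_empty, pow_zero, scalarPoly,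
      Polynomial.map_one, one_mul, Finset.compl_empty]
    rfl
  | insert i S hi ih =>
    have hS : (Sᶜ : Finset (Fin n)) = insert i (insert i S)ᶜ := by
      rw [Finset.insert_compl_insert hi]
    have hi' : i ∉ (insert i S)ᶜ := by simp
    rw [Finset.prod_insert hi, map_mul, Module.End.mul_apply, ih, diffOp_X,
      twistedPartial_scalarPoly_mul, hS, Finset.prod_insert hi',
      twistedPartial_polyC (g' := ∏ j ∈ (insert i S)ᶜ, MvPolynomial.X j), pderiv_X_mul_prod hi',
      Finset.card_insert_of_notMem hi, pow_succ, scalarPoly_mul, mul_assoc]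
    · congr 1
      rw [scalarPoly, Polynomial.map_add, map_X, Polynomial.map_one]
      ring
    · rw [← mul_assoc, mul_comm (MvPolynomial.pderiv _ _), X_mul_pderiv_normalCrossing]

theorem isCapelli_normalCrossing (hn : 0 < n) :
    IsCapelli (normalCrossing n) ((Polynomial.X + 1) ^ (n - 1)) where
  pos := hn
  homogeneous := by
    have := MvPolynomial.IsHomogeneous.prod Finset.univ
      (fun i : Fin n => (MvPolynomial.X i : MvPolynomial (Fin n) ℂ)) (fun _ => 1)
      fun i _ => MvPolynomial.isHomogeneous_X ℂ i
    rwa [Finset.sum_const, Finset.card_univ, Fintype.card_fin, smul_eq_mul, mul_one] at this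
  degree := by
    rw [natDegree_pow, ← C_1, natDegree_X_add_C, mul_one, Nat.sub_add_cancel hn]
  ne_zero := pow_ne_zero _ (by rw [← C_1]; exact X_add_C_ne_zero 1)
  capelli j := by
    rw [pderiv_normalCrossing, diffOp_prod_X, Finset.card_erase_of_mem (Finset.mem_univ j),
      Finset.card_univ, Fintype.card_fin]
    have : ((Finset.univ.erase j)ᶜ : Finset (Fin n)) = {j} := by
      ext i
      simp
    rw [this, Finset.prod_singleton]

/-- A diagonal field multiplies `h` by its trace, and the trace is also its divergence; so a single
condition serves both. -/
theorem isAdmissible_diagonal {t : Fin n → ℂ} (ht : ∑ i, t i = 0) :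
    IsAdmissible (normalCrossing n) fun j => MvPolynomial.C (t j) * MvPolynomial.X j where
  linear j := by
    have := (MvPolynomial.isHomogeneous_C (Fin n) (t j)).mul (MvPolynomial.isHomogeneous_X ℂ j)
    rwa [zero_add] at this
  annihilates := by
    have h1 : ∀ j, MvPolynomial.C (t j) * MvPolynomial.X j *
        MvPolynomial.pderiv j (normalCrossing n) = MvPolynomial.C (t j) * normalCrossing n := by
      intro j
      rw [mul_assoc, X_mul_pderiv_normalCrossing]
    rw [Finset.sum_congr rfl fun j _ => h1 j, ← Finset.sum_mul, ← map_sum, ht, map_zero, zero_mul]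
  divergence := by
    have h1 : ∀ j, MvPolynomial.pderiv j (MvPolynomial.C (t j) * MvPolynomial.X j) =
        (MvPolynomial.C (t j) : MvPolynomial (Fin n) ℂ) := by
      intro j
      rw [MvPolynomial.pderiv_C_mul, MvPolynomial.pderiv_X_self, mul_one]
    rw [Finset.sum_congr rfl fun j _ => h1 j, ← map_sum, ht, map_zero]

theorem eval_normalCrossing (a : Fin n → ℂ) :
    MvPolynomial.eval a (normalCrossing n) = ∏ i, a i := by
  rw [normalCrossing, map_prod]
  exact Finset.prod_congr rfl fun i _ => MvPolynomial.eval_X i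

theorem isSpanningForm_normalCrossing {a : Fin n → ℂ}
    (ha : MvPolynomial.eval a (normalCrossing n) ≠ 0) : IsSpanningForm (normalCrossing n) a := by
  intro i
  have hn : (n : ℂ) ≠ 0 := Nat.cast_ne_zero.2 i.pos.ne'
  rw [eval_normalCrossing, Finset.prod_ne_zero_iff] at ha
  -- The diagonal field with entry `aᵢ⁻¹` in place `i` sends `f` to `xᵢ` but has trace `aᵢ⁻¹`.
  -- Subtracting the scalar `(n aᵢ)⁻¹` removes the trace, and the same multiple of `f` compensates.
  set t : Fin n → ℂ := fun j => (if j = i then (a i)⁻¹ else 0) - (n * a i)⁻¹ with ht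
  refine ⟨(n * a i)⁻¹, _, isAdmissible_diagonal (t := t) ?_, ?_⟩
  · have hai := ha i (Finset.mem_univ i)
    rw [ht, Finset.sum_sub_distrib, Finset.sum_ite_eq' Finset.univ i, if_pos (Finset.mem_univ i),
      Finset.sum_const, Finset.card_univ, Fintype.card_fin, nsmul_eq_mul]
    field_simp
    ring
  · have h1 : ∀ j, MvPolynomial.C (n * a i)⁻¹ * (MvPolynomial.C (a j) * MvPolynomial.X j) +
        MvPolynomial.C (t j) * MvPolynomial.X j *
          MvPolynomial.pderiv j (linearForm a) =
        if j = i then MvPolynomial.X i else (0 : MvPolynomial (Fin n) ℂ) := by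
      intro j
      rw [pderiv_linearForm, ht]
      by_cases hj : j = i
      · subst hj
        rw [if_pos rfl]
        simp only [if_true]
        have h2 : (MvPolynomial.C (a j)⁻¹ * MvPolynomial.C (a j) : MvPolynomial (Fin n) ℂ) = 1 := by
          rw [← map_mul, inv_mul_cancel₀ (ha j (Finset.mem_univ j)), map_one]
        rw [map_sub]
        linear_combination MvPolynomial.X j * h2
      · rw [if_neg hj]
        simp only [if_neg hj, zero_sub, map_neg]
        ring
    rw [linearForm, Finset.mul_sum, ← linearForm, lieDeriv, ← Finset.sum_add_distrib,
      Finset.sum_congr rfl fun j _ => h1 j, Finset.sum_ite_eq' Finset.univ i,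
      if_pos (Finset.mem_univ i)]

theorem eval_ne_zero_of_isGenericForm {h : MvPolynomial (Fin n) ℂ} {a : Fin n → ℂ}
    (hh : MvPolynomial.map (starRingEnd ℂ) h = h) (ha : IsGenericForm h a) :
    MvPolynomial.eval a h ≠ 0 := by
  rwa [IsGenericForm, hh] at ha

theorem map_normalCrossing (φ : ℂ →+* ℂ) :
    MvPolynomial.map φ (normalCrossing n) = normalCrossing n := by
  rw [normalCrossing, map_prod]
  exact Finset.prod_congr rfl fun i _ => MvPolynomial.map_X φ i

theorem nablaPoly_normalCrossing (hn : 0 < n) {a : Fin n → ℂ}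
    (ha : MvPolynomial.eval a (normalCrossing n) ≠ 0) :
    nablaPoly ha (normalCrossing n) =
      C ((-1) ^ n * (MvPolynomial.eval a (normalCrossing n))⁻¹ * (-(n : ℂ)⁻¹) ^ n) *
        rootSequence (fun _ => 0) n := by
  have h1 : ((Polynomial.X + 1 : ℂ[X]) ^ (n - 1) * (Polynomial.X + 1)) =
      (Polynomial.X + 1) ^ n := by
    rw [← pow_succ, Nat.sub_add_cancel hn]
  rw [nablaPoly_self (isCapelli_normalCrossing hn) ha, h1, pow_comp, add_comp, X_comp, one_comp,
    sub_add_cancel, mul_pow, ← C_pow, ← mul_assoc, ← C_mul, rootSequence_apply, Finset.prod_const,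
    Finset.card_range, Int.cast_zero, C_0, add_zero]

theorem spectrum_normalCrossing (hn : 0 < n) {a : Fin n → ℂ}
    (ha : IsGenericForm (normalCrossing n) a) :
    logSpectrumAtZero (normalCrossing n) (linearForm a) =
      formalSum ((Multiset.range n).map fun k : ℕ => (k : ℚ)) ∧
    logSpectrumAtInfty (normalCrossing n) (linearForm a) =
      formalSum ((Multiset.range n).map fun k : ℕ => (k : ℚ)) ∧
    ∀ t₀ : ℂ, t₀ ≠ 0 → gmSpectrumAtInfty (normalCrossing n) (linearForm a) t₀ =
      formalSum ((Multiset.range n).map fun k : ℕ => (k : ℚ)) := by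
  have ha' := eval_ne_zero_of_isGenericForm (map_normalCrossing _) ha
  have hn0 : (n : ℂ) ≠ 0 := Nat.cast_ne_zero.2 hn.ne'
  have hκ : (-1) ^ n * (MvPolynomial.eval a (normalCrossing n))⁻¹ * (-(n : ℂ)⁻¹) ^ n ≠ 0 :=
    mul_ne_zero (mul_ne_zero (pow_ne_zero _ (neg_ne_zero.2 one_ne_zero)) (inv_ne_zero ha'))
      (pow_ne_zero _ (neg_ne_zero.2 (inv_ne_zero hn0)))
  have hs : (Finset.univ.val.map fun i : Fin n => (((i : ℤ) - (fun _ : ℕ => (0 : ℤ)) i : ℤ) : ℚ)) =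
      (Multiset.range n).map fun k : ℕ => (k : ℚ) := by
    have h1 : (Finset.univ.val.map fun i : Fin n => (i : ℕ)) = Multiset.range n := by
      rw [← Finset.range_val, ← Nat.Iio_eq_range, ← Fin.map_valEmbedding_univ]
      rfl
    rw [← h1, Multiset.map_map]
    refine Multiset.map_congr rfl fun i _ => ?_
    simp
  have H := isCapelli_normalCrossing hn
  have hspan := isSpanningForm_normalCrossing ha'
  have hq := nablaPoly_normalCrossing hn ha'
  refine ⟨?_, ?_, fun t₀ ht => ?_⟩
  · rw [logSpectrumAtZero_eq H ha' hspan hκ hq fun _ _ => le_rfl, hs]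
  · rw [logSpectrumAtInfty, spectrumAtInfty_brieskorn_eq H ha' hspan (Or.inl ⟨rfl, rfl⟩) hκ hq
      (fun _ _ => le_rfl) (Or.inl rfl), hs]
  · rw [gmSpectrumAtInfty, spectrumAtInfty_brieskorn_eq H ha' hspan (Or.inr ⟨rfl, ht⟩) hκ hq
      (fun _ _ => le_rfl) (Or.inr (by omega)), hs]

end NormalCrossing

end LogBrieskorn

end

noncomputable section

namespace LogBrieskorn

open Polynomial

section Star

/-! ### The star quiver -/

theorem starThree_eq : starThree =
    (MvPolynomial.X 0 * MvPolynomial.X 4 - MvPolynomial.X 1 * MvPolynomial.X 3) *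
    (MvPolynomial.X 0 * MvPolynomial.X 5 - MvPolynomial.X 2 * MvPolynomial.X 3) *
    (MvPolynomial.X 1 * MvPolynomial.X 5 - MvPolynomial.X 2 * MvPolynomial.X 4) := by
  simp only [starThree, Matrix.det_fin_two_of]

/-- The minor formed by the first and the second column. -/
def minorOne : MvPolynomial (Fin 6) ℂ :=
  MvPolynomial.X 0 * MvPolynomial.X 4 - MvPolynomial.X 1 * MvPolynomial.X 3

/-- The minor formed by the first and the third column. -/
def minorTwo : MvPolynomial (Fin 6) ℂ :=
  MvPolynomial.X 0 * MvPolynomial.X 5 - MvPolynomial.X 2 * MvPolynomial.X 3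

/-- The minor formed by the second and the third column. -/
def minorThree : MvPolynomial (Fin 6) ℂ :=
  MvPolynomial.X 1 * MvPolynomial.X 5 - MvPolynomial.X 2 * MvPolynomial.X 4

theorem starThree_eq_mul : starThree = minorOne * minorTwo * minorThree := starThree_eq

theorem pderiv_minorOne (i : Fin 6) : MvPolynomial.pderiv i minorOne =
    ![MvPolynomial.X 4, -MvPolynomial.X 3, 0, -MvPolynomial.X 1, MvPolynomial.X 0, 0] i := by
  fin_cases i <;> simp [minorOne]

theorem pderiv_minorTwo (i : Fin 6) : MvPolynomial.pderiv i minorTwo =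
    ![MvPolynomial.X 5, 0, -MvPolynomial.X 3, -MvPolynomial.X 2, 0, MvPolynomial.X 0] i := by
  fin_cases i <;> simp [minorTwo]

theorem pderiv_minorThree (i : Fin 6) : MvPolynomial.pderiv i minorThree =
    ![0, MvPolynomial.X 5, -MvPolynomial.X 4, 0, -MvPolynomial.X 2, MvPolynomial.X 1] i := by
  fin_cases i <;> simp [minorThree]

theorem pderiv_starThree (i : Fin 6) : MvPolynomial.pderiv i starThree =
    ![MvPolynomial.X 4 * (minorTwo * minorThree) + MvPolynomial.X 5 * (minorOne * minorThree),
      -MvPolynomial.X 3 * (minorTwo * minorThree) + MvPolynomial.X 5 * (minorOne * minorTwo),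
      -MvPolynomial.X 3 * (minorOne * minorThree) + -MvPolynomial.X 4 * (minorOne * minorTwo),
      -MvPolynomial.X 1 * (minorTwo * minorThree) + -MvPolynomial.X 2 * (minorOne * minorThree),
      MvPolynomial.X 0 * (minorTwo * minorThree) + -MvPolynomial.X 2 * (minorOne * minorTwo),
      MvPolynomial.X 0 * (minorOne * minorThree) + MvPolynomial.X 1 * (minorOne * minorTwo)] i := by
  rw [starThree_eq_mul, Derivation.leibniz, Derivation.leibniz, pderiv_minorOne, pderiv_minorTwo,
    pderiv_minorThree]
  fin_cases i <;> simp <;> ring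

theorem starThree_ne_zero : starThree ≠ 0 := by
  intro h0
  have := congrArg (MvPolynomial.eval ![1, 0, 1, 0, 1, 1]) h0
  simp [starThree_eq] at this

theorem polyC_mul_twistedPartial {n : ℕ} {h : MvPolynomial (Fin n) ℂ} (i : Fin n)
    (g : MvPolynomial (Fin n) ℂ) :
    polyC h h * twistedPartial h i (polyC h g) =
      polyC h (h * MvPolynomial.pderiv i g) +
        Polynomial.X * polyC h (MvPolynomial.pderiv i h * g) := by
  have h1 : algebraMap _ (PolarRing h) h * (logDeriv h i * algebraMap _ (PolarRing h) g) =
      algebraMap _ (PolarRing h) (MvPolynomial.pderiv i h * g) := by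
    rw [logDeriv, ← mul_assoc, ← mul_assoc, algebraMap_mul_invSelf, one_mul, map_mul]
  rw [twistedPartial_eq, polyC, polyC, coeffDeriv_C, polarDeriv_algebraMap, mul_add, mul_assoc,
    ← C_mul, ← C_mul, ← map_mul, mul_left_comm, ← C_mul, h1]
  rfl

/-- Multiplying by `h`, which can be cancelled in the domain, clears the denominator of the
logarithmic derivative. The hypotheses are then polynomial identities, checked separately for the
terms with and without `s`. -/
theorem twistedPartial_add_eq {n : ℕ} {h : MvPolynomial (Fin n) ℂ} (hh : h ≠ 0) {i j : Fin n}
    {p q g : MvPolynomial (Fin n) ℂ} {r s : ℂ}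
    (h1 : MvPolynomial.pderiv i p + MvPolynomial.pderiv j q = MvPolynomial.C r * g)
    (h2 : MvPolynomial.pderiv i h * p + MvPolynomial.pderiv j h * q =
      MvPolynomial.C s * (h * g)) :
    twistedPartial h i (polyC h p) + twistedPartial h j (polyC h q) =
      scalarPoly h (C s * Polynomial.X + C r) * polyC h g := by
  have := isDomain_polarRing hh
  have hh' : polyC h h ≠ 0 := by
    rw [polyC, Ne, C_eq_zero, map_eq_zero_iff _ (algebraMap_polarRing_injective hh)]
    exact hh
  have hadd : ∀ u v : MvPolynomial (Fin n) ℂ, polyC h (u + v) = polyC h u + polyC h v := by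
    intro u v
    rw [polyC, map_add, C_add]
    rfl
  have hmul : ∀ u v : MvPolynomial (Fin n) ℂ, polyC h (u * v) = polyC h u * polyC h v := by
    intro u v
    rw [polyC, map_mul, C_mul]
    rfl
  have hC : ∀ z : ℂ, polyC h (MvPolynomial.C z) = scalarPoly h (C z) := by
    intro z
    rw [polyC, algebraMap_C, scalarPoly, map_C]
  apply mul_left_cancel₀ hh'
  have e1 := congrArg (polyC h) h1
  have e2 := congrArg (polyC h) h2
  rw [hadd, hmul, hC] at e1
  rw [hadd, hmul (MvPolynomial.C s), hC] at e2
  rw [mul_add, polyC_mul_twistedPartial, polyC_mul_twistedPartial, hmul h, hmul h]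
  have e3 : scalarPoly h (C s * Polynomial.X + C r) =
      scalarPoly h (C s) * Polynomial.X + scalarPoly h (C r) := by
    rw [scalarPoly, Polynomial.map_add, Polynomial.map_mul, map_X]
    rfl
  rw [e3]
  rw [hmul h] at e2
  linear_combination polyC h h * e1 + Polynomial.X * e2

/-- The hypotheses say that `h` and `g` have the same logarithmic derivative along `xᵢ`, namely that
`xᵢ` does not occur in `h/g`. So `g hˢ` behaves like a power with exponent `s + 1`. -/
theorem twistedPartial_polyC_of_mul_eq {n : ℕ} {h g k : MvPolynomial (Fin n) ℂ} {i : Fin n}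
    (hg : MvPolynomial.pderiv i h * g = h * k) (hk : MvPolynomial.pderiv i g = k) :
    twistedPartial h i (polyC h g) = scalarPoly h (Polynomial.X + 1) * polyC h k := by
  rw [twistedPartial_polyC hg, hk, scalarPoly, Polynomial.map_add, map_X, Polynomial.map_one]
  ring

theorem polyC_neg {n : ℕ} {h : MvPolynomial (Fin n) ℂ} (g : MvPolynomial (Fin n) ℂ) :
    polyC h (-g) = -polyC h g := by
  rw [polyC, map_neg, C_neg]
  rfl

/-- The action of `(∂ᵢ∂ⱼ - ∂ₖ∂ₗ)` on a product of minors. -/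
theorem diffOp_minor {n : ℕ} {h : MvPolynomial (Fin n) ℂ} (hh : h ≠ 0) {i j k l : Fin n}
    {u p q g : MvPolynomial (Fin n) ℂ} {r s : ℂ}
    (hp : MvPolynomial.pderiv j h * u = h * p) (hp' : MvPolynomial.pderiv j u = p)
    (hq : MvPolynomial.pderiv l h * u = h * q) (hq' : MvPolynomial.pderiv l u = q)
    (h1 : MvPolynomial.pderiv i p - MvPolynomial.pderiv k q = MvPolynomial.C r * g)
    (h2 : MvPolynomial.pderiv i h * p - MvPolynomial.pderiv k h * q =
      MvPolynomial.C s * (h * g)) :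
    diffOp h (MvPolynomial.X i * MvPolynomial.X j - MvPolynomial.X k * MvPolynomial.X l)
      (polyC h u) =
      scalarPoly h ((Polynomial.X + 1) * (C s * Polynomial.X + C r)) * polyC h g := by
  rw [map_sub (diffOp h), map_mul, map_mul, LinearMap.sub_apply, Module.End.mul_apply,
    Module.End.mul_apply, diffOp_X, diffOp_X, diffOp_X, diffOp_X,
    twistedPartial_polyC_of_mul_eq hp hp', twistedPartial_polyC_of_mul_eq hq hq',
    twistedPartial_scalarPoly_mul, twistedPartial_scalarPoly_mul, scalarPoly_mul, mul_assoc,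
    ← twistedPartial_add_eq hh (q := -q) (i := i) (j := k) (p := p) (s := s) (r := r) (g := g),
    polyC_neg, map_neg]
  · ring
  · rw [map_neg, ← sub_eq_add_neg, h1]
  · rw [mul_neg, ← sub_eq_add_neg, h2]

theorem C_two : (MvPolynomial.C 2 : MvPolynomial (Fin 6) ℂ) = 2 := map_ofNat _ 2

theorem C_three : (MvPolynomial.C 3 : MvPolynomial (Fin 6) ℂ) = 3 := map_ofNat _ 3

theorem C_four : (MvPolynomial.C 4 : MvPolynomial (Fin 6) ℂ) = 4 := map_ofNat _ 4

theorem diffOp_minorThree : diffOp starThree minorThree (polyC starThree starThree) =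
    scalarPoly starThree ((Polynomial.X + 1) * (C 3 * Polynomial.X + C 4)) *
      polyC starThree (minorOne * minorTwo) := by
  refine diffOp_minor starThree_ne_zero (mul_comm _ _) rfl (mul_comm _ _) rfl ?_ ?_
  · simp [pderiv_starThree, Derivation.leibniz, pderiv_minorOne, pderiv_minorTwo,
      pderiv_minorThree, C_four]
    simp only [minorOne, minorTwo, minorThree]
    ring
  · simp only [pderiv_starThree, C_three]
    simp
    rw [starThree_eq_mul]
    simp only [minorOne, minorTwo, minorThree]
    ring

theorem diffOp_minorTwo : diffOp starThree minorTwo (polyC starThree starThree) =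
    scalarPoly starThree ((Polynomial.X + 1) * (C 3 * Polynomial.X + C 4)) *
      polyC starThree (minorOne * minorThree) := by
  refine diffOp_minor starThree_ne_zero (mul_comm _ _) rfl (mul_comm _ _) rfl ?_ ?_
  · simp [pderiv_starThree, Derivation.leibniz, pderiv_minorOne, pderiv_minorTwo,
      pderiv_minorThree, C_four]
    simp only [minorOne, minorTwo, minorThree]
    ring
  · simp only [pderiv_starThree, C_three]
    simp
    rw [starThree_eq_mul]
    simp only [minorOne, minorTwo, minorThree]
    ring

/-- The order of factors fixes which derivatives act first. They must be with respect to variables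
absent from the minors missing in the function acted upon, so that `diffOp_minor` applies; hence
several forms of the same minor. -/
theorem minorOne_eq : minorOne =
    MvPolynomial.X 4 * MvPolynomial.X 0 - MvPolynomial.X 1 * MvPolynomial.X 3 := by
  rw [minorOne]
  ring

theorem minorOne_eq' : minorOne =
    MvPolynomial.X 0 * MvPolynomial.X 4 - MvPolynomial.X 3 * MvPolynomial.X 1 := by
  rw [minorOne]
  ring

theorem minorTwo_eq : minorTwo =
    MvPolynomial.X 5 * MvPolynomial.X 0 - MvPolynomial.X 2 * MvPolynomial.X 3 := by
  rw [minorTwo]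
  ring

theorem diffOp_minorTwo_mul :
    diffOp starThree minorTwo (polyC starThree (minorOne * minorTwo)) =
      scalarPoly starThree ((Polynomial.X + 1) * (C 3 * Polynomial.X + C 3)) *
        polyC starThree minorOne := by
  rw [show diffOp starThree minorTwo = diffOp starThree (MvPolynomial.X 5 * MvPolynomial.X 0 -
    MvPolynomial.X 2 * MvPolynomial.X 3) from congrArg _ minorTwo_eq]
  refine diffOp_minor starThree_ne_zero (p := MvPolynomial.X 4 * minorTwo + MvPolynomial.X 5 * minorOne) (q := -MvPolynomial.X 1 * minorTwo + -MvPolynomial.X 2 * minorOne) ?_ ?_ ?_ ?_ ?_ ?_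
  · simp only [pderiv_starThree]
    simp
    rw [starThree_eq_mul]
    ring
  · simp [Derivation.leibniz, pderiv_minorOne, pderiv_minorTwo]
    ring
  · simp only [pderiv_starThree]
    simp
    rw [starThree_eq_mul]
    ring
  · simp [Derivation.leibniz, pderiv_minorOne, pderiv_minorTwo]
    ring
  · simp [Derivation.leibniz, pderiv_minorOne, pderiv_minorTwo, C_three]
    simp only [minorOne]
    ring
  · simp only [pderiv_starThree, C_three]
    simp
    rw [starThree_eq_mul]
    simp only [minorOne, minorTwo, minorThree]
    ring

theorem diffOp_minorOne_mul :
    diffOp starThree minorOne (polyC starThree (minorOne * minorTwo)) =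
      scalarPoly starThree ((Polynomial.X + 1) * (C 3 * Polynomial.X + C 3)) *
        polyC starThree minorTwo := by
  rw [show diffOp starThree minorOne = diffOp starThree (MvPolynomial.X 4 * MvPolynomial.X 0 -
    MvPolynomial.X 1 * MvPolynomial.X 3) from congrArg _ minorOne_eq]
  refine diffOp_minor starThree_ne_zero (p := MvPolynomial.X 4 * minorTwo + MvPolynomial.X 5 * minorOne) (q := -MvPolynomial.X 1 * minorTwo + -MvPolynomial.X 2 * minorOne) ?_ ?_ ?_ ?_ ?_ ?_
  · simp only [pderiv_starThree]
    simp
    rw [starThree_eq_mul]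
    ring
  · simp [Derivation.leibniz, pderiv_minorOne, pderiv_minorTwo]
    ring
  · simp only [pderiv_starThree]
    simp
    rw [starThree_eq_mul]
    ring
  · simp [Derivation.leibniz, pderiv_minorOne, pderiv_minorTwo]
    ring
  · simp [Derivation.leibniz, pderiv_minorOne, pderiv_minorTwo, C_three]
    simp only [minorTwo]
    ring
  · simp only [pderiv_starThree, C_three]
    simp
    rw [starThree_eq_mul]
    simp only [minorOne, minorTwo, minorThree]
    ring

theorem diffOp_minorOne_mul' :
    diffOp starThree minorOne (polyC starThree (minorOne * minorThree)) =
      scalarPoly starThree ((Polynomial.X + 1) * (C 3 * Polynomial.X + C 3)) *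
        polyC starThree minorThree := by
  rw [show diffOp starThree minorOne = diffOp starThree (MvPolynomial.X 0 * MvPolynomial.X 4 -
    MvPolynomial.X 3 * MvPolynomial.X 1) from congrArg _ minorOne_eq']
  refine diffOp_minor starThree_ne_zero (p := MvPolynomial.X 0 * minorThree + -MvPolynomial.X 2 * minorOne) (q := -MvPolynomial.X 3 * minorThree + MvPolynomial.X 5 * minorOne) ?_ ?_ ?_ ?_ ?_ ?_
  · simp only [pderiv_starThree]
    simp
    rw [starThree_eq_mul]
    ring
  · simp [Derivation.leibniz, pderiv_minorOne, pderiv_minorThree]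
    ring
  · simp only [pderiv_starThree]
    simp
    rw [starThree_eq_mul]
    ring
  · simp [Derivation.leibniz, pderiv_minorOne, pderiv_minorThree]
    ring
  · simp [Derivation.leibniz, pderiv_minorOne, pderiv_minorThree, C_three]
    simp only [minorThree]
    ring
  · simp only [pderiv_starThree, C_three]
    simp
    rw [starThree_eq_mul]
    simp only [minorOne, minorTwo, minorThree]
    ring

/-- The polynomial `c` of the Capelli identities for the star quiver. -/
def starPoly : ℂ[X] :=
  (Polynomial.X + 1) * (C 3 * Polynomial.X + C 4) *
    ((Polynomial.X + 1) * (C 3 * Polynomial.X + C 3)) * (C 3 * Polynomial.X + C 2)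

theorem diffOp_minorTwo_minorThree :
    diffOp starThree (minorTwo * minorThree) (polyC starThree starThree) =
      scalarPoly starThree ((Polynomial.X + 1) * (C 3 * Polynomial.X + C 4) *
        ((Polynomial.X + 1) * (C 3 * Polynomial.X + C 3))) * polyC starThree minorOne := by
  rw [map_mul, Module.End.mul_apply, diffOp_minorThree, diffOp_scalarPoly_mul, diffOp_minorTwo_mul,
    ← mul_assoc, ← scalarPoly_mul]

theorem diffOp_minorOne_minorThree :
    diffOp starThree (minorOne * minorThree) (polyC starThree starThree) =
      scalarPoly starThree ((Polynomial.X + 1) * (C 3 * Polynomial.X + C 4) *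
        ((Polynomial.X + 1) * (C 3 * Polynomial.X + C 3))) * polyC starThree minorTwo := by
  rw [map_mul, Module.End.mul_apply, diffOp_minorThree, diffOp_scalarPoly_mul, diffOp_minorOne_mul,
    ← mul_assoc, ← scalarPoly_mul]

theorem diffOp_minorOne_minorTwo :
    diffOp starThree (minorOne * minorTwo) (polyC starThree starThree) =
      scalarPoly starThree ((Polynomial.X + 1) * (C 3 * Polynomial.X + C 4) *
        ((Polynomial.X + 1) * (C 3 * Polynomial.X + C 3))) * polyC starThree minorThree := by
  rw [map_mul, Module.End.mul_apply, diffOp_minorTwo, diffOp_scalarPoly_mul, diffOp_minorOne_mul',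
    ← mul_assoc, ← scalarPoly_mul]

/-- The last of the three stages: two minors have been applied, leaving a single minor, and one more
first-order derivative leaves a coordinate and contributes `3 s + 2`. -/
theorem diffOp_capelli {i j k : Fin 6} {p q u v : MvPolynomial (Fin 6) ℂ} {K : ℂ[X]} {r s : ℂ}
    (hp : diffOp starThree p (polyC starThree starThree) =
      scalarPoly starThree K * polyC starThree u)
    (hq : diffOp starThree q (polyC starThree starThree) =
      scalarPoly starThree K * polyC starThree v)
    (h1 : MvPolynomial.C r * MvPolynomial.pderiv i u + MvPolynomial.C s * MvPolynomial.pderiv j v =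
      MvPolynomial.C 2 * MvPolynomial.X k)
    (h2 : MvPolynomial.pderiv i starThree * (MvPolynomial.C r * u) +
      MvPolynomial.pderiv j starThree * (MvPolynomial.C s * v) =
      MvPolynomial.C 3 * (starThree * MvPolynomial.X k)) :
    diffOp starThree (MvPolynomial.C r * MvPolynomial.X i * p +
      MvPolynomial.C s * MvPolynomial.X j * q) (polyC starThree starThree) =
      scalarPoly starThree (K * (C 3 * Polynomial.X + C 2)) *
        polyC starThree (MvPolynomial.X k) := by
  have hC : ∀ (z : ℂ) (w : MvPolynomial (Fin 6) ℂ),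
      polyC starThree (MvPolynomial.C z * w) = z • polyC starThree w := by
    intro z w
    rw [polyC, map_mul, algebraMap_C, C_mul, Algebra.smul_def]
    rfl
  have hX : ∀ (z : ℂ) (i : Fin 6) (w : MvPolynomial (Fin 6) ℂ),
      diffOp starThree (MvPolynomial.C z * MvPolynomial.X i * w) =
        z • (twistedPartial starThree i * diffOp starThree w) := by
    intro z i w
    rw [mul_assoc, ← MvPolynomial.smul_eq_C_mul, map_smul, map_mul, diffOp_X]
  rw [map_add (diffOp starThree), hX, hX, LinearMap.add_apply, LinearMap.smul_apply,
    LinearMap.smul_apply, Module.End.mul_apply, Module.End.mul_apply, hp, hq,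
    twistedPartial_scalarPoly_mul, twistedPartial_scalarPoly_mul, scalarPoly_mul, mul_assoc,
    ← twistedPartial_add_eq starThree_ne_zero (p := MvPolynomial.C r * u)
      (q := MvPolynomial.C s * v) (by rwa [MvPolynomial.pderiv_C_mul, MvPolynomial.pderiv_C_mul]) h2,
    hC, hC, map_smul, map_smul, mul_add, mul_smul_comm, mul_smul_comm]

theorem starPoly_ne_zero_and_natDegree : starPoly ≠ 0 ∧ starPoly.natDegree = 5 := by
  have h1 : ∀ r : ℂ, (C 3 * Polynomial.X + C r : ℂ[X]).natDegree = 1 := fun r =>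
    natDegree_linear three_ne_zero
  have h2 : ∀ r : ℂ, (C 3 * Polynomial.X + C r : ℂ[X]) ≠ 0 := fun r h0 => by
    have := h1 r
    rw [h0, natDegree_zero] at this
    exact absurd this zero_ne_one
  have h3 : (Polynomial.X + 1 : ℂ[X]).natDegree = 1 := by rw [← C_1, natDegree_X_add_C]
  have h4 : (Polynomial.X + 1 : ℂ[X]) ≠ 0 := by rw [← C_1]; exact X_add_C_ne_zero 1
  have h5 := mul_ne_zero h4 (h2 4)
  have h6 := mul_ne_zero h4 (h2 3)
  refine ⟨mul_ne_zero (mul_ne_zero h5 h6) (h2 2), ?_⟩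
  rw [starPoly, natDegree_mul (mul_ne_zero h5 h6) (h2 2), natDegree_mul h5 h6,
    natDegree_mul h4 (h2 4), natDegree_mul h4 (h2 3), h1, h1, h1, h3]

theorem starThree_isHomogeneous : starThree.IsHomogeneous 6 := by
  have h1 : ∀ i j k l : Fin 6, (MvPolynomial.X i * MvPolynomial.X j -
      MvPolynomial.X k * MvPolynomial.X l : MvPolynomial (Fin 6) ℂ).IsHomogeneous 2 :=
    fun i j k l => ((MvPolynomial.isHomogeneous_X ℂ i).mul (MvPolynomial.isHomogeneous_X ℂ j)).sub
      ((MvPolynomial.isHomogeneous_X ℂ k).mul (MvPolynomial.isHomogeneous_X ℂ l))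
  rw [starThree_eq]
  exact ((h1 _ _ _ _).mul (h1 _ _ _ _)).mul (h1 _ _ _ _)

/-- Each partial derivative of `h` is a combination of two terms, a coordinate times a product of
two minors. Applied to `hˢ⁺¹`, every product of two minors gives the third minor with the same
polynomial in `s`, so `diffOp_capelli` covers the six coordinates. -/
theorem isCapelli_starThree : IsCapelli starThree starPoly where
  pos := by norm_num
  homogeneous := starThree_isHomogeneous
  degree := by rw [starPoly_ne_zero_and_natDegree.2]
  ne_zero := starPoly_ne_zero_and_natDegree.1
  capelli j := by
    fin_cases j
    · have := diffOp_capelli (r := 1) (s := 1) (i := 4) (j := 5) (k := 0)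
        diffOp_minorTwo_minorThree diffOp_minorOne_minorThree (by
          simp [pderiv_minorOne, pderiv_minorTwo, C_two]
          try ring) (by
          simp only [pderiv_starThree, C_three]
          simp
          rw [starThree_eq_mul]
          simp only [minorOne, minorTwo, minorThree]
          ring)
      have e : MvPolynomial.pderiv 0 starThree =
          MvPolynomial.C (1) * MvPolynomial.X 4 * (minorTwo * minorThree) +
            MvPolynomial.C (1) * MvPolynomial.X 5 * (minorOne * minorThree) := by
        rw [pderiv_starThree]
        simp
      change diffOp starThree (MvPolynomial.pderiv 0 starThree) _ =
        scalarPoly starThree starPoly * polyC starThree (MvPolynomial.X 0)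
      rw [e]
      exact this
    · have := diffOp_capelli (r := -1) (s := 1) (i := 3) (j := 5) (k := 1)
        diffOp_minorTwo_minorThree diffOp_minorOne_minorTwo (by
          simp [pderiv_minorOne, pderiv_minorThree, C_two]
          try ring) (by
          simp only [pderiv_starThree, C_three]
          simp
          rw [starThree_eq_mul]
          simp only [minorOne, minorTwo, minorThree]
          ring)
      have e : MvPolynomial.pderiv 1 starThree =
          MvPolynomial.C (-1) * MvPolynomial.X 3 * (minorTwo * minorThree) +
            MvPolynomial.C (1) * MvPolynomial.X 5 * (minorOne * minorTwo) := by
        rw [pderiv_starThree]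
        simp
      change diffOp starThree (MvPolynomial.pderiv 1 starThree) _ =
        scalarPoly starThree starPoly * polyC starThree (MvPolynomial.X 1)
      rw [e]
      exact this
    · have := diffOp_capelli (r := -1) (s := -1) (i := 3) (j := 4) (k := 2)
        diffOp_minorOne_minorThree diffOp_minorOne_minorTwo (by
          simp [pderiv_minorTwo, pderiv_minorThree, C_two]
          try ring) (by
          simp only [pderiv_starThree, C_three]
          simp
          rw [starThree_eq_mul]
          simp only [minorOne, minorTwo, minorThree]
          ring)
      have e : MvPolynomial.pderiv 2 starThree =
          MvPolynomial.C (-1) * MvPolynomial.X 3 * (minorOne * minorThree) +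
            MvPolynomial.C (-1) * MvPolynomial.X 4 * (minorOne * minorTwo) := by
        rw [pderiv_starThree]
        simp
      change diffOp starThree (MvPolynomial.pderiv 2 starThree) _ =
        scalarPoly starThree starPoly * polyC starThree (MvPolynomial.X 2)
      rw [e]
      exact this
    · have := diffOp_capelli (r := -1) (s := -1) (i := 1) (j := 2) (k := 3)
        diffOp_minorTwo_minorThree diffOp_minorOne_minorThree (by
          simp [pderiv_minorOne, pderiv_minorTwo, C_two]
          try ring) (by
          simp only [pderiv_starThree, C_three]
          simp
          rw [starThree_eq_mul]
          simp only [minorOne, minorTwo, minorThree]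
          ring)
      have e : MvPolynomial.pderiv 3 starThree =
          MvPolynomial.C (-1) * MvPolynomial.X 1 * (minorTwo * minorThree) +
            MvPolynomial.C (-1) * MvPolynomial.X 2 * (minorOne * minorThree) := by
        rw [pderiv_starThree]
        simp
      change diffOp starThree (MvPolynomial.pderiv 3 starThree) _ =
        scalarPoly starThree starPoly * polyC starThree (MvPolynomial.X 3)
      rw [e]
      exact this
    · have := diffOp_capelli (r := 1) (s := -1) (i := 0) (j := 2) (k := 4)
        diffOp_minorTwo_minorThree diffOp_minorOne_minorTwo (by
          simp [pderiv_minorOne, pderiv_minorThree, C_two]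
          try ring) (by
          simp only [pderiv_starThree, C_three]
          simp
          rw [starThree_eq_mul]
          simp only [minorOne, minorTwo, minorThree]
          ring)
      have e : MvPolynomial.pderiv 4 starThree =
          MvPolynomial.C (1) * MvPolynomial.X 0 * (minorTwo * minorThree) +
            MvPolynomial.C (-1) * MvPolynomial.X 2 * (minorOne * minorTwo) := by
        rw [pderiv_starThree]
        simp
      change diffOp starThree (MvPolynomial.pderiv 4 starThree) _ =
        scalarPoly starThree starPoly * polyC starThree (MvPolynomial.X 4)
      rw [e]
      exact this
    · have := diffOp_capelli (r := 1) (s := 1) (i := 0) (j := 1) (k := 5)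
        diffOp_minorOne_minorThree diffOp_minorOne_minorTwo (by
          simp [pderiv_minorTwo, pderiv_minorThree, C_two]
          try ring) (by
          simp only [pderiv_starThree, C_three]
          simp
          rw [starThree_eq_mul]
          simp only [minorOne, minorTwo, minorThree]
          ring)
      have e : MvPolynomial.pderiv 5 starThree =
          MvPolynomial.C (1) * MvPolynomial.X 0 * (minorOne * minorThree) +
            MvPolynomial.C (1) * MvPolynomial.X 1 * (minorOne * minorTwo) := by
        rw [pderiv_starThree]
        simp
      change diffOp starThree (MvPolynomial.pderiv 5 starThree) _ =
        scalarPoly starThree starPoly * polyC starThree (MvPolynomial.X 5)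
      rw [e]
      exact this

end Star

end LogBrieskorn

end

noncomputable section

namespace LogBrieskorn

open Polynomial

/-! ### Generic forms, Bernstein polynomial and spectra for the star quiver -/

section StarSpectrum

/-- The linear vector field `M ↦ B M + M T` on `2 × 3` matrices, for `T` diagonal. -/
def matrixField (b : Fin 4 → ℂ) (t : Fin 3 → ℂ) : Fin 6 → MvPolynomial (Fin 6) ℂ :=
  ![MvPolynomial.C (b 0 + t 0) * MvPolynomial.X 0 + MvPolynomial.C (b 1) * MvPolynomial.X 3,
    MvPolynomial.C (b 0 + t 1) * MvPolynomial.X 1 + MvPolynomial.C (b 1) * MvPolynomial.X 4,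
    MvPolynomial.C (b 0 + t 2) * MvPolynomial.X 2 + MvPolynomial.C (b 1) * MvPolynomial.X 5,
    MvPolynomial.C (b 3 + t 0) * MvPolynomial.X 3 + MvPolynomial.C (b 2) * MvPolynomial.X 0,
    MvPolynomial.C (b 3 + t 1) * MvPolynomial.X 4 + MvPolynomial.C (b 2) * MvPolynomial.X 1,
    MvPolynomial.C (b 3 + t 2) * MvPolynomial.X 5 + MvPolynomial.C (b 2) * MvPolynomial.X 2]

/-- The field multiplies the minor of columns `i`, `j` by `tr B + tᵢ + tⱼ`, hence `h` by `3 tr B + 2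
tr T`. This is also the trace of the field on `2 × 3` matrices, so annihilation and divergence are
the same condition. -/
theorem isAdmissible_matrixField {b : Fin 4 → ℂ} {t : Fin 3 → ℂ}
    (hbt : 3 * (b 0 + b 3) + 2 * (t 0 + t 1 + t 2) = 0) :
    IsAdmissible starThree (matrixField b t) where
  linear j := by
    have h1 : ∀ (r s : ℂ) (i j : Fin 6), (MvPolynomial.C r * MvPolynomial.X i +
        MvPolynomial.C s * MvPolynomial.X j : MvPolynomial (Fin 6) ℂ).IsHomogeneous 1 := by
      intro r s i j
      have h2 : ∀ (r : ℂ) (i : Fin 6),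
          (MvPolynomial.C r * MvPolynomial.X i : MvPolynomial (Fin 6) ℂ).IsHomogeneous 1 := by
        intro r i
        have := (MvPolynomial.isHomogeneous_C (Fin 6) r).mul (MvPolynomial.isHomogeneous_X ℂ i)
        rwa [zero_add] at this
      exact (h2 r i).add (h2 s j)
    fin_cases j <;> exact h1 _ _ _ _
  annihilates := by
    have h1 := congrArg (MvPolynomial.C : ℂ → MvPolynomial (Fin 6) ℂ) hbt
    simp only [map_add, map_mul, map_zero, map_ofNat] at h1
    simp only [Fin.sum_univ_six, pderiv_starThree, matrixField]
    simp
    simp only [minorOne, minorTwo, minorThree]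
    linear_combination ((MvPolynomial.X 0 * MvPolynomial.X 4 - MvPolynomial.X 1 * MvPolynomial.X 3) *
      (MvPolynomial.X 0 * MvPolynomial.X 5 - MvPolynomial.X 2 * MvPolynomial.X 3) *
      (MvPolynomial.X 1 * MvPolynomial.X 5 - MvPolynomial.X 2 * MvPolynomial.X 4)) * h1
  divergence := by
    have h1 := congrArg (MvPolynomial.C : ℂ → MvPolynomial (Fin 6) ℂ) hbt
    simp only [map_add, map_mul, map_zero, map_ofNat] at h1
    simp [Fin.sum_univ_six, matrixField]
    linear_combination h1

theorem linearForm_single {n : ℕ} (i : Fin n) :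
    linearForm (Pi.single i (1 : ℂ)) = MvPolynomial.X i := by
  rw [linearForm, Finset.sum_eq_single i]
  · rw [Pi.single_eq_same, map_one, one_mul]
  · intro j _ hj
    rw [Pi.single_eq_of_ne hj, map_zero, zero_mul]
  · intro hi
    exact absurd (Finset.mem_univ i) hi

theorem matrixField_linearForm (κ : ℂ) (b : Fin 4 → ℂ) (t : Fin 3 → ℂ) (a : Fin 6 → ℂ) :
    MvPolynomial.C κ * linearForm a + lieDeriv (matrixField b t) (linearForm a) =
      linearForm ![(κ + b 0 + t 0) * a 0 + b 2 * a 3, (κ + b 0 + t 1) * a 1 + b 2 * a 4,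
        (κ + b 0 + t 2) * a 2 + b 2 * a 5, (κ + b 3 + t 0) * a 3 + b 1 * a 0,
        (κ + b 3 + t 1) * a 4 + b 1 * a 1, (κ + b 3 + t 2) * a 5 + b 1 * a 2] := by
  rw [lieDeriv]
  simp only [pderiv_linearForm]
  rw [linearForm, linearForm]
  simp only [Fin.sum_univ_six, matrixField]
  simp
  ring

/-- A `2 × 2` matrix is determined by its eigenvectors `q`, `r` and the image `v` of `p`. -/
theorem exists_matrix {p₀ p₁ q₀ q₁ r₀ r₁ : ℂ} (hqr : q₀ * r₁ - q₁ * r₀ ≠ 0)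
    (hpr : p₀ * r₁ - p₁ * r₀ ≠ 0) (hpq : p₀ * q₁ - p₁ * q₀ ≠ 0) (v₀ v₁ : ℂ) :
    ∃ c₀₀ c₀₁ c₁₀ c₁₁ s t : ℂ, (c₀₀ * q₀ + c₀₁ * q₁ + s * q₀ = 0 ∧
      c₁₀ * q₀ + c₁₁ * q₁ + s * q₁ = 0) ∧
      (c₀₀ * r₀ + c₀₁ * r₁ + t * r₀ = 0 ∧ c₁₀ * r₀ + c₁₁ * r₁ + t * r₁ = 0) ∧
      c₀₀ * p₀ + c₀₁ * p₁ = v₀ ∧ c₁₀ * p₀ + c₁₁ * p₁ = v₁ := by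
  -- The eigenvalues on `q` and `r` are `l` and `k`. Taking the determinant of the requirement `Cp =
  -- v` against `r` isolates the `q`-component of `p` and determines `l`; against `q` it determines
  -- `k`.
  obtain ⟨l, hl⟩ : ∃ l, l * (p₀ * r₁ - p₁ * r₀) = v₀ * r₁ - v₁ * r₀ :=
    ⟨(v₀ * r₁ - v₁ * r₀) / (p₀ * r₁ - p₁ * r₀), div_mul_cancel₀ _ hpr⟩
  obtain ⟨k, hk⟩ : ∃ k, k * (p₀ * q₁ - p₁ * q₀) = v₀ * q₁ - v₁ * q₀ :=
    ⟨(v₀ * q₁ - v₁ * q₀) / (p₀ * q₁ - p₁ * q₀), div_mul_cancel₀ _ hpq⟩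
  obtain ⟨d, hd⟩ : ∃ d, d * (q₀ * r₁ - q₁ * r₀) = 1 := ⟨_, inv_mul_cancel₀ hqr⟩
  refine ⟨(l * r₁ * q₀ - k * q₁ * r₀) * d, (-(l * r₀ * q₀) + k * q₀ * r₀) * d,
    (l * r₁ * q₁ - k * q₁ * r₁) * d, (-(l * r₀ * q₁) + k * q₀ * r₁) * d, -l, -k,
    ⟨?_, ?_⟩, ⟨?_, ?_⟩, ?_, ?_⟩
  · linear_combination l * q₀ * hd
  · linear_combination l * q₁ * hd
  · linear_combination k * r₀ * hd
  · linear_combination k * r₁ * hd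
  · linear_combination d * q₀ * hl - d * r₀ * hk + v₀ * hd
  · linear_combination d * q₁ * hl - d * r₁ * hk + v₁ * hd

/-- The coefficients of the derivative of a linear form along `matrixField`. -/
def matrixCoeffs (a : Fin 6 → ℂ) (b : Fin 4 → ℂ) (t : Fin 3 → ℂ) : Fin 6 → ℂ :=
  ![(b 0 + t 0) * a 0 + b 2 * a 3, (b 0 + t 1) * a 1 + b 2 * a 4, (b 0 + t 2) * a 2 + b 2 * a 5,
    (b 3 + t 0) * a 3 + b 1 * a 0, (b 3 + t 1) * a 4 + b 1 * a 1, (b 3 + t 2) * a 5 + b 1 * a 2]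

/-- Subtracting `κ` times the identity from `B` lowers `3 tr B + 2 tr T` by `6κ`, so the stated `κ`
makes the field admissible. The multiple `κ f` restores the derivative of `f`. -/
theorem isSpanningForm_of_matrixCoeffs {a : Fin 6 → ℂ}
    (hb : ∀ i, ∃ b t, matrixCoeffs a b t = Pi.single i (1 : ℂ)) : IsSpanningForm starThree a := by
  intro i
  obtain ⟨b, t, hbt⟩ := hb i
  set κ : ℂ := (3 * (b 0 + b 3) + 2 * (t 0 + t 1 + t 2)) / 6 with hκ
  refine ⟨κ, _, isAdmissible_matrixField (b := ![b 0 - κ, b 1, b 2, b 3 - κ]) (t := t) ?_, ?_⟩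
  · simp only [Matrix.cons_val]
    rw [hκ]
    ring
  · rw [matrixField_linearForm, ← linearForm_single, ← hbt]
    simp only [matrixCoeffs, Matrix.cons_val, add_sub_cancel]

/-- Arrange the coefficients of `f` in a `2 × 3` matrix; genericity makes its columns pairwise
independent. A suitable field then moves one column to any prescribed vector and kills the two
others, by making them eigenvectors compensated by the diagonal part. -/
theorem isSpanningForm_starThree {a : Fin 6 → ℂ} (ha : MvPolynomial.eval a starThree ≠ 0) :
    IsSpanningForm starThree a := by
  have h1 : (a 0 * a 4 - a 3 * a 1) * (a 0 * a 5 - a 3 * a 2) * (a 1 * a 5 - a 4 * a 2) ≠ 0 := by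
    convert ha using 1
    rw [starThree_eq]
    simp
    ring
  have h12 := left_ne_zero_of_mul (left_ne_zero_of_mul h1)
  have h13 := right_ne_zero_of_mul (left_ne_zero_of_mul h1)
  have h23 := right_ne_zero_of_mul h1
  have h21 : a 1 * a 3 - a 4 * a 0 ≠ 0 := fun h0 => h12 (by linear_combination -h0)
  have h31 : a 2 * a 3 - a 5 * a 0 ≠ 0 := fun h0 => h13 (by linear_combination -h0)
  have h32 : a 2 * a 4 - a 5 * a 1 ≠ 0 := fun h0 => h23 (by linear_combination -h0)
  have first (v w : ℂ) : ∃ b t, matrixCoeffs a b t = ![v, 0, 0, w, 0, 0] := by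
    obtain ⟨c₀₀, c₀₁, c₁₀, c₁₁, s, t, ⟨e1, e2⟩, ⟨e3, e4⟩, e5, e6⟩ := exists_matrix h23 h13 h12 v w
    refine ⟨![c₀₀, c₁₀, c₀₁, c₁₁], ![0, s, t], ?_⟩
    simp only [matrixCoeffs, Matrix.cons_val]
    congr! <;> first
      | linear_combination e1 | linear_combination e2 | linear_combination e3
      | linear_combination e4 | linear_combination e5 | linear_combination e6
  have second (v w : ℂ) : ∃ b t, matrixCoeffs a b t = ![0, v, 0, 0, w, 0] := by
    obtain ⟨c₀₀, c₀₁, c₁₀, c₁₁, s, t, ⟨e1, e2⟩, ⟨e3, e4⟩, e5, e6⟩ := exists_matrix h13 h23 h21 v w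
    refine ⟨![c₀₀, c₁₀, c₀₁, c₁₁], ![s, 0, t], ?_⟩
    simp only [matrixCoeffs, Matrix.cons_val]
    congr! <;> first
      | linear_combination e1 | linear_combination e2 | linear_combination e3
      | linear_combination e4 | linear_combination e5 | linear_combination e6
  have third (v w : ℂ) : ∃ b t, matrixCoeffs a b t = ![0, 0, v, 0, 0, w] := by
    obtain ⟨c₀₀, c₀₁, c₁₀, c₁₁, s, t, ⟨e1, e2⟩, ⟨e3, e4⟩, e5, e6⟩ := exists_matrix h12 h32 h31 v w
    refine ⟨![c₀₀, c₁₀, c₀₁, c₁₁], ![s, t, 0], ?_⟩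
    simp only [matrixCoeffs, Matrix.cons_val]
    congr! <;> first
      | linear_combination e1 | linear_combination e2 | linear_combination e3
      | linear_combination e4 | linear_combination e5 | linear_combination e6
  refine isSpanningForm_of_matrixCoeffs fun i => ?_
  have hs : ∀ u : Fin 6 → ℂ, (∀ j, u j = if j = i then 1 else 0) → u = Pi.single i (1 : ℂ) :=
    fun u hu => funext fun j => by rw [hu, Pi.single_apply]
  fin_cases i
  · rw [← hs ![1, 0, 0, 0, 0, 0] (by intro j; fin_cases j <;> rfl)]
    exact first 1 0
  · rw [← hs ![0, 1, 0, 0, 0, 0] (by intro j; fin_cases j <;> rfl)]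
    exact second 1 0
  · rw [← hs ![0, 0, 1, 0, 0, 0] (by intro j; fin_cases j <;> rfl)]
    exact third 1 0
  · rw [← hs ![0, 0, 0, 1, 0, 0] (by intro j; fin_cases j <;> rfl)]
    exact first 0 1
  · rw [← hs ![0, 0, 0, 0, 1, 0] (by intro j; fin_cases j <;> rfl)]
    exact second 0 1
  · rw [← hs ![0, 0, 0, 0, 0, 1] (by intro j; fin_cases j <;> rfl)]
    exact third 0 1

theorem map_starThree : MvPolynomial.map (starRingEnd ℂ) starThree = starThree := by
  rw [starThree_eq]
  simp

theorem starPoly_mul : starPoly * (Polynomial.X + 1) = C 27 *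
    ((Polynomial.X + C (4 / 3)) * (Polynomial.X + C 1) ^ 4 * (Polynomial.X + C (2 / 3))) := by
  have h3 : (C 27 : ℂ[X]) = C 3 * C 3 * C 3 := by rw [← C_mul, ← C_mul]; norm_num
  have h4 : (C 3 * C (4 / 3) : ℂ[X]) = C 4 := by rw [← C_mul]; norm_num
  have h2 : (C 3 * C (2 / 3) : ℂ[X]) = C 2 := by rw [← C_mul]; norm_num
  rw [starPoly, ← h4, ← h2, h3, C_1]
  ring

theorem isBernsteinPolynomial_starThree : IsBernsteinPolynomial starThree
    ((Polynomial.X + C (4 / 3)) * (Polynomial.X + C 1) ^ 4 * (Polynomial.X + C (2 / 3))) := by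
  refine isCapelli_starThree.isBernsteinPolynomial starThree_ne_zero ?_ (κ := 27) (by norm_num)
    starPoly_mul fun m => ?_
  · exact ((monic_X_add_C _).mul ((monic_X_add_C _).pow 4)).mul (monic_X_add_C _)
  · have hpos : ∀ r : ℝ, 0 < r → (m : ℂ) + (r : ℂ) ≠ 0 := by
      intro r hr h0
      have h1 : ((m : ℝ) + r : ℝ) = 0 := by exact_mod_cast h0
      have : (0 : ℝ) ≤ m := Nat.cast_nonneg m
      linarith
    have h1 := hpos (4 / 3) (by norm_num)
    have h2 := hpos 1 (by norm_num)
    have h3 := hpos (2 / 3) (by norm_num)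
    push_cast at h1 h2 h3
    simp only [eval_mul, eval_add, eval_X, eval_C, eval_pow]
    exact mul_ne_zero (mul_ne_zero h1 (pow_ne_zero _ h2)) h3

/-- The roots `-4/3`, `-1`, `-2/3` of the Bernstein polynomial go to `2`, `0`, `-2` under `λ ↦ -6(λ
+ 1)`. -/
theorem nablaPoly_starThree {a : Fin 6 → ℂ} (ha : MvPolynomial.eval a starThree ≠ 0) :
    nablaPoly ha starThree = C ((MvPolynomial.eval a starThree)⁻¹ * (27 / 6 ^ 6)) *
      (Polynomial.X ^ 4 * (Polynomial.X - C 2) * (Polynomial.X + C 2)) := by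
  have e1 : ((Polynomial.X + C 1 : ℂ[X]).comp (C (-((6 : ℕ) : ℂ)⁻¹) * Polynomial.X - 1)) =
      -C (1 / 6) * Polynomial.X := by
    rw [add_comp, X_comp, C_comp, ← C_1, sub_add_cancel, C_neg]
    norm_num
  have e2 : ((Polynomial.X + C (4 / 3) : ℂ[X]).comp (C (-((6 : ℕ) : ℂ)⁻¹) * Polynomial.X - 1)) =
      -C (1 / 6) * (Polynomial.X - C 2) := by
    have : (C (4 / 3) : ℂ[X]) = 1 + C (1 / 6) * C 2 := by
      rw [← C_1, ← C_mul, ← C_add]; norm_num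
    rw [add_comp, X_comp, C_comp, this, C_neg]
    norm_num
    ring
  have e3 : ((Polynomial.X + C (2 / 3) : ℂ[X]).comp (C (-((6 : ℕ) : ℂ)⁻¹) * Polynomial.X - 1)) =
      -C (1 / 6) * (Polynomial.X + C 2) := by
    have : (C (2 / 3) : ℂ[X]) = 1 - C (1 / 6) * C 2 := by
      rw [← C_1, ← C_mul, ← C_sub]; norm_num
    rw [add_comp, X_comp, C_comp, this, C_neg]
    norm_num
    ring
  rw [nablaPoly_self isCapelli_starThree ha, starPoly_mul, mul_comp, mul_comp, mul_comp, pow_comp,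
    e1, e2, e3, C_comp]
  have e4 : (C (27 / 6 ^ 6) : ℂ[X]) = C 27 * C (1 / 6) ^ 6 := by
    rw [← C_pow, ← C_mul]; norm_num
  rw [C_mul, C_mul, e4]
  norm_num
  ring

/-- The negatives of the roots, in decreasing order. -/
def starExponents (r : ℤ) (i : ℕ) : ℤ := if i = 0 then r else if i = 5 then -r else 0

theorem rootSequence_starExponents (r : ℤ) : rootSequence (starExponents r) 6 =
    Polynomial.X ^ 4 * (Polynomial.X - C (r : ℂ)) * (Polynomial.X + C (r : ℂ)) := by
  rw [rootSequence_apply]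
  simp only [Finset.prod_range_succ, Finset.prod_range_zero, starExponents]
  norm_num
  ring

theorem spectrum_starThree {a : Fin 6 → ℂ} (ha : IsGenericForm starThree a) :
    logSpectrumAtZero starThree (linearForm a) = formalSum {-2, 1, 2, 3, 4, 7} ∧
    logSpectrumAtInfty starThree (linearForm a) = formalSum {2, 1, 2, 3, 4, 3} := by
  have ha' := eval_ne_zero_of_isGenericForm map_starThree ha
  have hspan := isSpanningForm_starThree ha'
  have hκ : (MvPolynomial.eval a starThree)⁻¹ * (27 / 6 ^ 6) ≠ 0 :=
    mul_ne_zero (inv_ne_zero ha') (by norm_num)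
  have hq1 : nablaPoly ha' starThree = C ((MvPolynomial.eval a starThree)⁻¹ * (27 / 6 ^ 6)) *
      rootSequence (starExponents 2) 6 := by
    rw [nablaPoly_starThree, rootSequence_starExponents]
    norm_num
  -- The same roots listed with increasing exponents, as required at infinity: `(-2, 0, 0, 0, 0, 2)`
  -- instead of `(2, 0, 0, 0, 0, -2)`.
  have hq2 : nablaPoly ha' starThree = C ((MvPolynomial.eval a starThree)⁻¹ * (27 / 6 ^ 6)) *
      rootSequence (starExponents (-2)) 6 := by
    rw [nablaPoly_starThree, rootSequence_starExponents]
    norm_num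
    left
    ring
  constructor
  · rw [logSpectrumAtZero_eq isCapelli_starThree ha' hspan hκ hq1]
    · congr 1
    · intro i hi
      have hi5 : i < 5 := by omega
      interval_cases i <;> decide
  · rw [logSpectrumAtInfty, spectrumAtInfty_brieskorn_eq isCapelli_starThree ha' hspan
      (Or.inl ⟨rfl, rfl⟩) hκ hq2 _ (Or.inl rfl)]
    · congr 1
    · intro i hi
      have hi5 : i < 5 := by omega
      interval_cases i <;> decide

/-- The root `-1` has multiplicity four, so its image under any map has multiplicity at least four,
whereas the spectrum at zero has no repeated entry. -/
theorem not_spectrum_eq_roots {b : ℂ[X]} (hb : IsBernsteinPolynomial starThree b) (φ : ℂ → ℚ) :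
    formalSum {-2, 1, 2, 3, 4, 7} ≠ formalSum (b.roots.map φ) := by
  have hb0 := isBernsteinPolynomial_starThree
  have hbb : b = (Polynomial.X + C (4 / 3)) * (Polynomial.X + C 1) ^ 4 *
      (Polynomial.X + C (2 / 3)) :=
    eq_of_monic_of_associated hb.1 hb0.1 (associated_of_dvd_dvd
      ((hb.2 _).1 ((hb0.2 _).2 dvd_rfl)) ((hb0.2 _).1 ((hb.2 _).2 dvd_rfl)))
  have h4 : 4 ≤ b.roots.count (-1) := by
    rw [count_roots, le_rootMultiplicity_iff hb.1.ne_zero, hbb]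
    rw [C_neg, sub_neg_eq_add]
    exact (dvd_mul_left _ _).mul_right _
  have h5 : 4 ≤ (b.roots.map φ).count (φ (-1)) := by
    have h6 := Multiset.map_le_map (f := φ) (Multiset.le_count_iff_replicate_le.1 h4)
    rw [Multiset.map_replicate] at h6
    exact Multiset.le_count_iff_replicate_le.2 h6
  intro h0
  have h7 := congrFun h0 (φ (-1))
  rw [formalSum, formalSum, Nat.cast_inj] at h7
  have h8 : (({-2, 1, 2, 3, 4, 7} : Multiset ℚ)).Nodup := by
    norm_num
  have h9 := Multiset.nodup_iff_count_le_one.1 h8 (φ (-1))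
  omega

end StarSpectrum

end LogBrieskorn

theorem mainTheorem5 :
    (∀ (n : ℕ) (_ : 0 < n) (a : Fin n → ℂ)
        (_ : LogBrieskorn.IsGenericForm (LogBrieskorn.normalCrossing n) a),
      LogBrieskorn.logSpectrumAtZero (LogBrieskorn.normalCrossing n) (LogBrieskorn.linearForm a) =
          LogBrieskorn.formalSum ((Multiset.range n).map fun k : ℕ => (k : ℚ)) ∧
      LogBrieskorn.logSpectrumAtZero (LogBrieskorn.normalCrossing n) (LogBrieskorn.linearForm a) =
          LogBrieskorn.logSpectrumAtInfty (LogBrieskorn.normalCrossing n)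
            (LogBrieskorn.linearForm a) ∧
      ∀ t₀ : ℂ, t₀ ≠ 0 →
        LogBrieskorn.logSpectrumAtZero (LogBrieskorn.normalCrossing n)
            (LogBrieskorn.linearForm a) =
          LogBrieskorn.gmSpectrumAtInfty (LogBrieskorn.normalCrossing n)
            (LogBrieskorn.linearForm a) t₀) ∧
    (∀ (a : Fin 6 → ℂ) (_ : LogBrieskorn.IsGenericForm LogBrieskorn.starThree a),
      LogBrieskorn.logSpectrumAtZero LogBrieskorn.starThree (LogBrieskorn.linearForm a) =
          LogBrieskorn.formalSum {-2, 1, 2, 3, 4, 7} ∧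
      LogBrieskorn.logSpectrumAtZero LogBrieskorn.starThree (LogBrieskorn.linearForm a) ≠
          LogBrieskorn.logSpectrumAtInfty LogBrieskorn.starThree (LogBrieskorn.linearForm a) ∧
      ∀ b : Polynomial ℂ, LogBrieskorn.IsBernsteinPolynomial LogBrieskorn.starThree b →
        ∀ φ : ℂ → ℚ,
          LogBrieskorn.logSpectrumAtZero LogBrieskorn.starThree (LogBrieskorn.linearForm a) ≠
            LogBrieskorn.formalSum (b.roots.map φ)) ∧
    LogBrieskorn.IsBernsteinPolynomial LogBrieskorn.starThree
      ((Polynomial.X + Polynomial.C (4 / 3)) * (Polynomial.X + Polynomial.C 1) ^ 4 *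
        (Polynomial.X + Polynomial.C (2 / 3))) := by
  refine ⟨fun n hn a ha => ?_, fun a ha => ?_, LogBrieskorn.isBernsteinPolynomial_starThree⟩
  · obtain ⟨h1, h2, h3⟩ := LogBrieskorn.spectrum_normalCrossing hn ha
    exact ⟨h1, h1.trans h2.symm, fun t₀ ht => h1.trans (h3 t₀ ht).symm⟩
  · obtain ⟨h1, h2⟩ := LogBrieskorn.spectrum_starThree ha
    refine ⟨h1, ?_, fun b hb φ => ?_⟩
    · rw [h1, h2]
      intro h0
      -- The value `7` belongs to the spectrum at zero and is absent at infinity.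
      have h3 := congrFun h0 7
      rw [LogBrieskorn.formalSum, LogBrieskorn.formalSum, Nat.cast_inj] at h3
      have h4 : Multiset.count 7 ({2, 1, 2, 3, 4, 3} : Multiset ℚ) = 0 := by
        rw [Multiset.count_eq_zero]
        norm_num
      have h5 : 0 < Multiset.count 7 ({-2, 1, 2, 3, 4, 7} : Multiset ℚ) := by
        rw [Multiset.count_pos]
        norm_num
      omega
    · rw [h1]
      exact LogBrieskorn.not_spectrum_eq_roots hb φ

end
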